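/- For a finite undirected graph $G$ (loops and parallel edges allowed) and a set $F$ of vertices let $\deg(F)=\sum_{v\in F}\deg_G(v)$, where a loop contributes $2$ to the degree of its vertex; $F$ is a feedback vertex set if $G-F$ has no cycle (loops and pairs of parallel edges count as cycles). There are a randomized algorithm (a program for a unit-cost random access machine with addition, subtraction and fair coin flips), a polynomial $p$, and a function $\delta:\mathbb N\to\mathbb R$ with $\delta(k)\to 0$ as $k\to\infty$, such that the following holds for every graph $G$ with $n$ vertices and $m$ edges and every feedback vertex set $F$ of $G$. Given $G$ and $F$ (but not $k$), the algorithm runs in expected time at most $p(n+m)$, and whenever it halts, its output is a tree decomposition of $G$ which, for every integer $k\ge 1$ with $|F|\le k$, has width at most $$\bigl(1-2^{-\bar d}+\delta(k)\bigr)\,k ,\qquad\text{where } \bar d=\deg(F)/k .$$ -/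

import Mathlib

open Filter Topology
open scoped ENNReal

/-! ## Graphs, feedback vertex sets, tree decompositions -/

/-- A finite undirected graph with vertex set `{0, …, n-1}` given by the list of its `m` edges;
`ends e` is the pair of endpoints of the `e`-th edge (in either order).
Loops and parallel edges are allowed; a simple graph is one that happens to have none. -/
structure EdgeListGraph where
  n : ℕ
  m : ℕ
  ends : Fin m → Fin n × Fin n

namespace EdgeListGraph

/-- The degree of a vertex: the number of edge ends at `v` (a loop counts twice). -/
def degree (G : EdgeListGraph) (v : Fin G.n) : ℕ :=
  ∑ e : Fin G.m, ((if (G.ends e).1 = v then 1 else 0) + (if (G.ends e).2 = v then 1 else 0))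

/-- `deg(S)`, the sum of the degrees of the vertices of `S`. -/
def degSum (G : EdgeListGraph) (S : Finset (Fin G.n)) : ℕ := ∑ v ∈ S, G.degree v

/-- The adjacency relation of `G`, as a simple graph (loops and multiplicities forgotten). -/
def toSimple (G : EdgeListGraph) : SimpleGraph (Fin G.n) where
  Adj u v := u ≠ v ∧ ∃ e, G.ends e = (u, v) ∨ G.ends e = (v, u)
  symm := ⟨fun _ _ h => ⟨h.1.symm, h.2.imp fun _ he => he.symm⟩⟩
  loopless := ⟨fun _ h => h.1 rfl⟩

/-- The `e`-th edge survives in `G - F`: neither of its ends is in `F`. -/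
def Avoids (G : EdgeListGraph) (F : Finset (Fin G.n)) (e : Fin G.m) : Prop :=
  (G.ends e).1 ∉ F ∧ (G.ends e).2 ∉ F

/-- `F` is a feedback vertex set: `G - F` has no cycle. A loop is a cycle of length one and two
parallel edges form a cycle of length two; all longer cycles are cycles of the simple graph. -/
def IsFVS (G : EdgeListGraph) (F : Finset (Fin G.n)) : Prop :=
  (∀ e, G.Avoids F e → (G.ends e).1 ≠ (G.ends e).2) ∧
  (∀ e e', G.Avoids F e → e ≠ e' →
    s((G.ends e).1, (G.ends e).2) ≠ s((G.ends e').1, (G.ends e').2)) ∧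
  (G.toSimple.induce {v | v ∉ F}).IsAcyclic

/-- A tree decomposition of `G`. (`IsTree` includes that there is at least one node.) -/
structure TreeDecomposition (G : EdgeListGraph) where
  /-- the number of nodes of the tree -/
  N : ℕ
  tree : SimpleGraph (Fin N)
  isTree : tree.IsTree
  bag : Fin N → Finset (Fin G.n)
  vertex_covered : ∀ v, ∃ i, v ∈ bag i
  edge_covered : ∀ e, ∃ i, (G.ends e).1 ∈ bag i ∧ (G.ends e).2 ∈ bag i
  connected : ∀ v, (tree.induce {i | v ∈ bag i}).Connected

/-- The width: the maximum size of a bag, minus one (an integer, as it is `-1` for `n = 0`). -/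
def TreeDecomposition.width {G : EdgeListGraph} (D : G.TreeDecomposition) : ℤ :=
  ((Finset.univ.sup fun i => (D.bag i).card : ℕ) : ℤ) - 1

end EdgeListGraph

/-! ## Randomized random access machines

Structured programs for a unit-cost RAM whose arithmetic is addition and truncated subtraction,
with fair coin flips. There are finitely many registers in use by a program, and a memory whose
cells are addressed by pairs of natural numbers (so that `mem a` is the array with name `a`).
There is no multiplication or shift, so numbers have at most linearly many bits (in the number of
steps plus the length of the input), and polynomial time has its usual meaning. -/

namespace RandRAM

structure Store where
  reg : ℕ → ℕ
  mem : ℕ → ℕ → ℕ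

inductive Expr where
  | const (c : ℕ)
  | reg (r : ℕ)
  /-- the content of the memory cell with address `(a, i)` -/
  | mem (a i : Expr)
  | add (x y : Expr)
  | sub (x y : Expr)

def Expr.eval (σ : Store) : Expr → ℕ
  | .const c => c
  | .reg r => σ.reg r
  | .mem a i => σ.mem (a.eval σ) (i.eval σ)
  | .add x y => x.eval σ + y.eval σ
  | .sub x y => x.eval σ - y.eval σ

def Store.setReg (σ : Store) (r x : ℕ) : Store :=
  { σ with reg := Function.update σ.reg r x }

def Store.setMem (σ : Store) (a i x : ℕ) : Store :=
  { σ with mem := Function.update σ.mem a (Function.update (σ.mem a) i x) }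

inductive Program where
  | skip
  | setReg (r : ℕ) (x : Expr)
  | setMem (a i x : Expr)
  /-- flip a fair coin and put the outcome, `0` or `1`, in register `r` -/
  | flip (r : ℕ)
  | seq (p q : Program)
  /-- run `p` if the value of `c` is not zero, and `q` otherwise -/
  | cond (c : Expr) (p q : Program)
  /-- as long as the value of `c` is not zero, run `p` -/
  | loop (c : Expr) (p : Program)

/-- A configuration: the stack of program parts still to be run, and the store. -/
structure Config where
  todo : List Program
  store : Store

def Config.Halted (c : Config) : Prop := c.todo = []

/-- One step of the machine. A halted configuration does not change. -/
noncomputable def step : Config → PMF Config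
  | ⟨[], σ⟩ => PMF.pure ⟨[], σ⟩
  | ⟨.skip :: K, σ⟩ => PMF.pure ⟨K, σ⟩
  | ⟨.setReg r x :: K, σ⟩ => PMF.pure ⟨K, σ.setReg r (x.eval σ)⟩
  | ⟨.setMem a i x :: K, σ⟩ => PMF.pure ⟨K, σ.setMem (a.eval σ) (i.eval σ) (x.eval σ)⟩
  | ⟨.flip r :: K, σ⟩ =>
      (PMF.uniformOfFintype Bool).map fun b => ⟨K, σ.setReg r (if b then 1 else 0)⟩
  | ⟨.seq p q :: K, σ⟩ => PMF.pure ⟨p :: q :: K, σ⟩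
  | ⟨.cond c p q :: K, σ⟩ => PMF.pure (if c.eval σ ≠ 0 then ⟨p :: K, σ⟩ else ⟨q :: K, σ⟩)
  | ⟨.loop c p :: K, σ⟩ =>
      PMF.pure (if c.eval σ ≠ 0 then ⟨p :: .loop c p :: K, σ⟩ else ⟨K, σ⟩)

/-- The distribution of the configuration after `t` steps. -/
noncomputable def after : ℕ → Config → PMF Config
  | 0, c => PMF.pure c
  | t + 1, c => (step c).bind (after t)

/-- The expected running time (number of steps until the machine halts, possibly `∞`) of `p`
started in the store `σ`, as `E[T] = ∑ t, P(T > t)`. -/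
noncomputable def expectedTime (p : Program) (σ : Store) : ℝ≥0∞ :=
  ∑' t : ℕ, (after t ⟨[p], σ⟩).toOuterMeasure {c | ¬ c.Halted}

/-- `τ` is the final store of some run of `p` started in `σ` that has positive probability. -/
def IsOutcome (p : Program) (σ τ : Store) : Prop :=
  ∃ t : ℕ, (⟨[], τ⟩ : Config) ∈ (after t ⟨[p], σ⟩).support

end RandRAM

/-! ## Input and output conventions -/

open RandRAM in
/-- The input `(G, F)`: the numbers `n` and `m` in registers `0` and `1`, the endpoints of the
edges in arrays `0` and `1`, and the indicator function of `F` in array `2`.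
All other registers and cells are zero. -/
def inputStore (G : EdgeListGraph) (F : Finset (Fin G.n)) : Store where
  reg := fun r => if r = 0 then G.n else if r = 1 then G.m else 0
  mem := fun a i =>
    if a = 0 then (if h : i < G.m then ((G.ends ⟨i, h⟩).1 : ℕ) else 0)
    else if a = 1 then (if h : i < G.m then ((G.ends ⟨i, h⟩).2 : ℕ) else 0)
    else if a = 2 then (if h : i < G.n then (if (⟨i, h⟩ : Fin G.n) ∈ F then 1 else 0) else 0)
    else 0

open RandRAM in
/-- The final store describes the tree decomposition `D`: register `0` holds the number `N` of
nodes, arrays `0` and `1` hold the endpoints of the `N - 1` edges of the tree, and array `2` holds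
the `N × n` membership matrix of the bags, row by row. -/
def Describes {G : EdgeListGraph} (τ : Store) (D : G.TreeDecomposition) : Prop :=
  τ.reg 0 = D.N ∧
  (∀ i j : Fin D.N, D.tree.Adj i j ↔ i ≠ j ∧ ∃ e : ℕ, e + 1 < D.N ∧
    ((τ.mem 0 e = i ∧ τ.mem 1 e = j) ∨ (τ.mem 0 e = j ∧ τ.mem 1 e = i))) ∧
  (∀ (i : Fin D.N) (v : Fin G.n), v ∈ D.bag i ↔ τ.mem 2 (i * G.n + v) ≠ 0)

/-!
The algorithm is deterministic and flips no coins. Write `f = |F|`, let `4 ^ L ≤ f < 4 ^ (L + 1)`,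
and call a vertex of `F` light if its degree is at most `L`.

*Cutting the forest.* The leaves of `G - F` are eliminated one by one, where an eliminated vertex
hands the number of its edges to light vertices over to its last neighbour. A vertex at which more
than `2 ^ L` of these edges would come together is put into a separator `S`. Every vertex of `S`
uses up more than `2 ^ L` edges at light vertices, of which there are at most `f * L`, so
`|S| ≤ f * L / 2 ^ L` is small, and every component of `G - F - S` has at most `2 ^ L` edges to
light vertices. A leaf exists in every round because `F` is a feedback vertex set
(`EdgeListGraph.IsFVS.exists_count_le_one`, `TreewidthProgram.peel_spec`).

*Colouring.* The items are the components of `G - F - S` and the edges inside `F`. They are coloured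
with two colours. Under a random colouring, a vertex `v` of `F` has all its items in the first
colour with probability at least `2 ^ (-deg v)`, and the same holds for the second colour. The
algorithm replaces the random choices by a greedy rule: it maintains these bounds, conditioned on
the choices made so far and summed over all light vertices, one sum for either colour, and gives
the next item the colour for which the first-order change of the sum of the squared deviations from
the initial values is not positive. As an item involves only few light vertices, the deviations stay
of smaller order than `f` (`Balance.State.step`, `TreewidthProgram.greedy_spec`).
By Jensen's inequality, applied to `F` padded with isolated vertices to `k` vertices, each colour is
the only one at `2 ^ (-deg F / k) * k - (k - f)` vertices of `F` at least, up to the error terms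
(`TreewidthProgram.width_le`).

*Tree decomposition.* There are two adjacent hubs, one for each colour, and the components of either
colour are attached to their hub. A light vertex all of whose items have one colour is left out of
the hub of the other colour; otherwise the bag of a hub contains `F`. To a component belongs the
natural decomposition of a tree, in which the bag of a vertex consists of the vertex and its parent,
and the part of `F` in the bag of the hub is added to all these bags. Finally, `S` is added to every
bag, and every vertex of `F` and of `S` gets a node of its own
(`TreewidthProgram.exists_describes_of_colouring`). Up to the error terms, all bags have at most
`k - 2 ^ (-deg F / k) * k` vertices. The algorithm does not refer to `k`.

*The machine.* The algorithm is written in a language of counting loops, `RandRAM.Cmd`, all of whose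
loops run for `2 * n + m + 3` rounds. A command compiles to a program that computes its effect in a
number of steps that is a polynomial in this number (`RandRAM.Cmd.exists_after`), and loops are
verified with an invariant rule (`RandRAM.Cmd.rep_rule`). `TreewidthProgram.main_spec` puts the
parts together.
-/


/-! ### Counting-loop programs -/

namespace RandRAM

instance : Add Expr := ⟨.add⟩
instance : Sub Expr := ⟨.sub⟩
instance (c : ℕ) : OfNat Expr c := ⟨.const c⟩

namespace Expr

/-- The content of register `r`. -/
abbrev R (r : ℕ) : Expr := .reg r

/-- The content of cell `i` of the array with the fixed name `a`. -/
def M (a : ℕ) (i : Expr) : Expr := .mem (.const a) i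

/-- The truth value (`0` or `1`) of `x = 0`. -/
def isZero (x : Expr) : Expr := 1 - x

/-- The truth value of `x = y`. -/
def equals (x y : Expr) : Expr := 1 - ((x - y) + (y - x))

/-- The truth value of the conjunction of `x ≠ 0` and `y ≠ 0`. -/
def both (x y : Expr) : Expr := 1 - ((1 - x) + (1 - y))

variable (σ : Store)

@[simp] theorem eval_add (x y : Expr) : (x + y).eval σ = x.eval σ + y.eval σ := rfl
@[simp] theorem eval_sub (x y : Expr) : (x - y).eval σ = x.eval σ - y.eval σ := rfl
@[simp] theorem eval_ofNat (c : ℕ) : (ofNat(c) : Expr).eval σ = OfNat.ofNat c := rfl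
@[simp] theorem eval_zero : (0 : Expr).eval σ = 0 := rfl
@[simp] theorem eval_one : (1 : Expr).eval σ = 1 := rfl
@[simp] theorem eval_R (r : ℕ) : (Expr.reg r).eval σ = σ.reg r := rfl
@[simp] theorem eval_M (a : ℕ) (i : Expr) : (M a i).eval σ = σ.mem a (i.eval σ) := rfl

@[simp] theorem eval_isZero (x : Expr) :
    (isZero x).eval σ = if x.eval σ = 0 then 1 else 0 := by
  simp only [isZero, eval_sub, eval_one]; split_ifs <;> omega

@[simp] theorem eval_equals (x y : Expr) :
    (equals x y).eval σ = if x.eval σ = y.eval σ then 1 else 0 := by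
  simp only [equals, eval_sub, eval_add, eval_one]; split_ifs <;> omega

@[simp] theorem eval_both (x y : Expr) :
    (both x y).eval σ = if x.eval σ ≠ 0 ∧ y.eval σ ≠ 0 then 1 else 0 := by
  simp only [both, eval_sub, eval_add, eval_one]; split_ifs <;> omega

end Expr

namespace Store

variable (σ : Store)

@[simp] theorem setReg_reg (r x s : ℕ) :
    (σ.setReg r x).reg s = if s = r then x else σ.reg s := by
  simp [setReg, Function.update_apply]

@[simp] theorem setReg_mem (r x : ℕ) : (σ.setReg r x).mem = σ.mem := rfl

@[simp] theorem setMem_reg (a i x : ℕ) : (σ.setMem a i x).reg = σ.reg := rfl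

@[simp] theorem setMem_mem (a i x b : ℕ) :
    (σ.setMem a i x).mem b = if b = a then Function.update (σ.mem a) i x else σ.mem b := by
  simp [setMem, Function.update_apply]

end Store

/-- Deterministic programs without unbounded loops. The command `rep r p` runs `p` for each value
of register `r` from `0` up to, but not including, the content of register `2`. -/
inductive Cmd where
  | nop
  | setReg (r : ℕ) (x : Expr)
  | setMem (a : ℕ) (i x : Expr)
  | seq (p q : Cmd)
  | ite (c : Expr) (p q : Cmd)
  | rep (r : ℕ) (p : Cmd)

namespace Cmd

/-- The program of the random access machine that implements a command. -/
def compile : Cmd → Program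
  | nop => .skip
  | setReg r x => .setReg r x
  | setMem a i x => .setMem (.const a) i x
  | seq p q => .seq p.compile q.compile
  | ite c p q => .cond c p.compile q.compile
  | rep r p => .seq (.setReg r 0)
      (.loop (.sub (.reg 2) (.reg r)) (.seq p.compile (.setReg r (.add (.reg r) (.const 1)))))

/-- The store after `i` rounds of a counting loop with counter `r` and body `f`. -/
def rounds (f : Store → Store) (r : ℕ) (σ : Store) : ℕ → Store
  | 0 => σ.setReg r 0
  | i + 1 => (f (rounds f r σ i)).setReg r (i + 1)

/-- The effect of a command on the store. -/
def den : Cmd → Store → Store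
  | nop, σ => σ
  | setReg r x, σ => σ.setReg r (x.eval σ)
  | setMem a i x, σ => σ.setMem a (i.eval σ) (x.eval σ)
  | seq p q, σ => q.den (p.den σ)
  | ite c p q, σ => if c.eval σ ≠ 0 then p.den σ else q.den σ
  | rep r p, σ => rounds p.den r σ (σ.reg 2)

/-- `c.wr r` tells whether `c` may write to register `r`. -/
def wr : Cmd → ℕ → Bool
  | nop, _ => false
  | setReg r _, s => Nat.beq s r
  | setMem _ _ _, _ => false
  | seq p q, s => p.wr s || q.wr s
  | ite _ p q, s => p.wr s || q.wr s
  | rep r p, s => Nat.beq s r || p.wr s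

/-- `c.wa a` tells whether `c` may write to array `a`. -/
def wa : Cmd → ℕ → Bool
  | nop, _ => false
  | setReg _ _, _ => false
  | setMem a _ _, b => Nat.beq b a
  | seq p q, s => p.wa s || q.wa s
  | ite _ p q, s => p.wa s || q.wa s
  | rep _ p, s => p.wa s

/-- No command writes to the loop bound, and no loop body writes to its counter. -/
def wf : Cmd → Bool
  | nop => true
  | setReg r _ => !Nat.beq 2 r
  | setMem _ _ _ => true
  | seq p q => p.wf && q.wf
  | ite _ p q => p.wf && q.wf
  | rep r p => !Nat.beq 2 r && !p.wr r && p.wf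

/-- A bound on the number of steps, as a polynomial in the loop bound. -/
noncomputable def cost : Cmd → Polynomial ℕ
  | nop => 1
  | setReg _ _ => 1
  | setMem _ _ _ => 1
  | seq p q => 1 + p.cost + q.cost
  | ite _ p q => 1 + p.cost + q.cost
  | rep _ p => 3 + Polynomial.X * (p.cost + 3)

theorem rounds_reg {f : Store → Store} {r s : ℕ} (hs : s ≠ r)
    (hf : ∀ σ, (f σ).reg s = σ.reg s) (σ : Store) (i : ℕ) :
    (rounds f r σ i).reg s = σ.reg s := by
  induction i with
  | zero => simp [rounds, hs]
  | succ i ih => simp [rounds, hs, hf, ih]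

theorem rounds_mem {f : Store → Store} {r a : ℕ}
    (hf : ∀ σ, (f σ).mem a = σ.mem a) (σ : Store) (i : ℕ) :
    (rounds f r σ i).mem a = σ.mem a := by
  induction i with
  | zero => simp [rounds]
  | succ i ih => simp [rounds, hf, ih]

theorem rounds_counter (f : Store → Store) (r : ℕ) (σ : Store) (i : ℕ) :
    (rounds f r σ i).reg r = i := by
  cases i <;> simp [rounds]

theorem den_reg {c : Cmd} {s : ℕ} (h : c.wr s = false) (σ : Store) :
    (c.den σ).reg s = σ.reg s := by
  induction c generalizing σ with
  | nop => rfl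
  | setReg r x =>
    have : s ≠ r := by rintro rfl; simp [wr] at h
    simp [den, this]
  | setMem a i x => rfl
  | seq p q hp hq =>
    simp only [wr, Bool.or_eq_false_iff] at h
    simp [den, hp h.1, hq h.2]
  | ite c p q hp hq =>
    simp only [wr, Bool.or_eq_false_iff] at h
    simp only [den]; split_ifs
    exacts [hp h.1 σ, hq h.2 σ]
  | rep r p hp =>
    simp only [wr, Bool.or_eq_false_iff] at h
    have : s ≠ r := by rintro rfl; simp at h
    exact rounds_reg this (hp h.2) σ _

theorem den_mem {c : Cmd} {a : ℕ} (h : c.wa a = false) (σ : Store) :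
    (c.den σ).mem a = σ.mem a := by
  induction c generalizing σ with
  | nop => rfl
  | setReg r x => rfl
  | setMem b i x =>
    have : a ≠ b := by rintro rfl; simp [wa] at h
    simp [den, this]
  | seq p q hp hq =>
    simp only [wa, Bool.or_eq_false_iff] at h
    simp [den, hp h.1, hq h.2]
  | ite c p q hp hq =>
    simp only [wa, Bool.or_eq_false_iff] at h
    simp only [den]; split_ifs
    exacts [hp h.1 σ, hq h.2 σ]
  | rep r p hp => exact rounds_mem (hp h) σ _

/-- The invariant rule for counting loops. Inside the loop, everything the body does not write is
as it was before the loop. -/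
theorem rep_rule {r : ℕ} {p : Cmd} {σ : Store} (I : ℕ → Store → Prop)
    (h0 : I 0 (σ.setReg r 0))
    (hstep : ∀ i < σ.reg 2, ∀ τ : Store, (∀ s, p.wr s = false → s ≠ r → τ.reg s = σ.reg s) →
      (∀ a, p.wa a = false → τ.mem a = σ.mem a) → τ.reg r = i → I i τ →
      I (i + 1) ((p.den τ).setReg r (i + 1))) :
    I (σ.reg 2) ((rep r p).den σ) := by
  have key : ∀ i ≤ σ.reg 2, I i (rounds p.den r σ i) := by
    intro i
    induction i with
    | zero => intro _; exact h0
    | succ i ih =>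
      intro hi
      exact hstep i (by omega) _ (fun s hs hsr => rounds_reg hsr (den_reg hs) σ i)
        (fun a ha => rounds_mem (den_mem ha) σ i) (rounds_counter _ _ _ _) (ih (by omega))
  exact key _ le_rfl

end Cmd

theorem after_add (s t : ℕ) (c : Config) : after (s + t) c = (after s c).bind (after t) := by
  induction s generalizing c with
  | zero => simp [after]
  | succ s ih =>
    rw [show s + 1 + t = (s + t) + 1 by omega]
    simp only [after, PMF.bind_bind]
    congr 1
    funext d
    exact ih d

theorem after_trans {s t : ℕ} {c d e : Config} (h : after s c = PMF.pure d)
    (h' : after t d = PMF.pure e) : after (s + t) c = PMF.pure e := by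
  rw [after_add, h, PMF.pure_bind, h']

theorem after_one {c d : Config} (h : step c = PMF.pure d) : after 1 c = PMF.pure d := by
  simp [after, h]

theorem after_halted (t : ℕ) (τ : Store) : after t ⟨[], τ⟩ = PMF.pure ⟨[], τ⟩ := by
  induction t with
  | zero => rfl
  | succ t ih => simp [after, step, ih]

/-- The compiled program computes the effect of the command, within the time bound. -/
theorem Cmd.exists_after (c : Cmd) (h : c.wf = true) (σ : Store) (K : List Program) :
    ∃ t ≤ c.cost.eval (σ.reg 2), after t ⟨c.compile :: K, σ⟩ = PMF.pure ⟨K, c.den σ⟩ := by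
  induction c generalizing σ K with
  | nop => exact ⟨1, by simp [cost], after_one rfl⟩
  | setReg r x => exact ⟨1, by simp [cost], after_one rfl⟩
  | setMem a i x => exact ⟨1, by simp [cost], after_one rfl⟩
  | seq p q hp hq =>
    simp only [wf, Bool.and_eq_true] at h
    obtain ⟨s, hs, es⟩ := hp h.1 σ (q.compile :: K)
    obtain ⟨t, ht, et⟩ := hq h.2 (p.den σ) K
    have h2 : (p.den σ).reg 2 = σ.reg 2 := by
      have : ∀ c : Cmd, c.wf = true → c.wr 2 = false := by
        intro c
        induction c <;> simp_all [wf, wr]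
      exact den_reg (this p h.1) σ
    refine ⟨1 + s + t, ?_, after_trans (after_trans (after_one rfl) es) et⟩
    rw [h2] at ht
    simp only [cost, Polynomial.eval_add, Polynomial.eval_one]; omega
  | ite c p q hp hq =>
    simp only [wf, Bool.and_eq_true] at h
    by_cases hc : c.eval σ ≠ 0
    · obtain ⟨s, hs, es⟩ := hp h.1 σ K
      refine ⟨1 + s, ?_, ?_⟩
      · simp only [cost, Polynomial.eval_add, Polynomial.eval_one]; omega
      · refine after_trans (after_one (d := ⟨p.compile :: K, σ⟩) ?_) (by simpa [den, hc] using es)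
        simp [compile, step, hc]
    · obtain ⟨s, hs, es⟩ := hq h.2 σ K
      refine ⟨1 + s, ?_, ?_⟩
      · simp only [cost, Polynomial.eval_add, Polynomial.eval_one]; omega
      · refine after_trans (after_one (d := ⟨q.compile :: K, σ⟩) ?_) (by simpa [den, hc] using es)
        simp [compile, step, hc]
  | rep r p hp =>
    simp only [wf, Bool.and_eq_true, Bool.not_eq_true'] at h
    obtain ⟨⟨hr2, hwr⟩, hwf⟩ := h
    have hr : (2 : ℕ) ≠ r := by rintro rfl; simp at hr2
    have w2 : p.wr 2 = false := by
      have : ∀ c : Cmd, c.wf = true → c.wr 2 = false := by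
        intro c
        induction c <;> simp_all [wf, wr]
      exact this p hwf
    have hN : ∀ i, (rounds p.den r σ i).reg 2 = σ.reg 2 := rounds_reg hr (den_reg w2) σ
    set loop : Program :=
      .loop (.sub (.reg 2) (.reg r)) (.seq p.compile (.setReg r (.add (.reg r) (.const 1))))
      with hloop
    have key : ∀ i ≤ σ.reg 2, ∃ t ≤ 2 + i * (p.cost.eval (σ.reg 2) + 3),
        after t ⟨(rep r p).compile :: K, σ⟩ = PMF.pure ⟨loop :: K, rounds p.den r σ i⟩ := by
      intro i
      induction i with
      | zero => exact fun _ => ⟨1 + 1, by simp, after_trans (after_one rfl) (after_one rfl)⟩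
      | succ i ih =>
        intro hi
        obtain ⟨t, ht, et⟩ := ih (by omega)
        obtain ⟨s, hs, es⟩ := hp hwf (rounds p.den r σ i)
          (.setReg r (.add (.reg r) (.const 1)) :: loop :: K)
        rw [hN] at hs
        refine ⟨t + (1 + 1 + s + 1), by rw [add_mul]; omega, after_trans et ?_⟩
        refine after_trans (after_trans (after_trans (after_one (d :=
          ⟨.seq p.compile (.setReg r (.add (.reg r) (.const 1))) :: loop :: K,
            rounds p.den r σ i⟩) ?_) (after_one rfl)) es) (after_one ?_)
        · have : σ.reg 2 - i ≠ 0 := by omega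
          simp [hloop, step, Expr.eval, hN, rounds_counter, this]
        · simp only [step, Expr.eval, rounds]
          rw [den_reg hwr, rounds_counter]
    obtain ⟨t, ht, et⟩ := key (σ.reg 2) le_rfl
    refine ⟨t + 1, ?_, after_trans et (after_one ?_)⟩
    · simp only [cost, Polynomial.eval_add, Polynomial.eval_mul, Polynomial.eval_X,
        Polynomial.eval_ofNat]
      omega
    · simp [hloop, step, Expr.eval, hN, rounds_counter, den]

/-- A run that surely halts within `t` steps has expected running time at most `t`. -/
theorem expectedTime_le {p : Program} {σ τ : Store} {t : ℕ}
    (h : after t ⟨[p], σ⟩ = PMF.pure ⟨[], τ⟩) : expectedTime p σ ≤ t := by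
  have hz : ∀ s ∉ Finset.range t,
      (after s ⟨[p], σ⟩).toOuterMeasure {c | ¬ c.Halted} = 0 := by
    intro s hs
    obtain ⟨d, rfl⟩ := Nat.exists_eq_add_of_le (not_lt.mp (Finset.mem_range.not.mp hs))
    rw [after_trans h (after_halted d τ), PMF.toOuterMeasure_pure_apply]
    simp [Config.Halted]
  unfold expectedTime
  rw [tsum_eq_sum hz]
  calc _ ≤ ∑ _s ∈ Finset.range t, (1 : ℝ≥0∞) := by
        refine Finset.sum_le_sum fun s _ => ?_
        rw [PMF.toOuterMeasure_apply]
        refine le_trans (ENNReal.tsum_le_tsum fun c => ?_)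
          (after s ⟨[p], σ⟩).tsum_coe.le
        exact Set.indicator_le_self _ _ c
    _ = t := by simp

/-- A run that surely halts in the store `τ` has no other outcome. -/
theorem IsOutcome.eq_of_after {p : Program} {σ τ τ' : Store} {t : ℕ}
    (h : after t ⟨[p], σ⟩ = PMF.pure ⟨[], τ⟩) (h' : IsOutcome p σ τ') : τ' = τ := by
  obtain ⟨s, hs⟩ := h'
  have h1 : (⟨[], τ'⟩ : Config) ∈ (after (s + t) ⟨[p], σ⟩).support := by
    rw [after_add, PMF.mem_support_bind_iff]
    exact ⟨_, hs, by rw [after_halted]; simp⟩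
  rw [add_comm, after_trans h (after_halted s τ), PMF.mem_support_pure_iff] at h1
  simpa using h1

end RandRAM

/-! ### Tree decompositions from parent maps -/

/-- A graph is connected if every vertex other than `t` has a neighbour of larger rank. -/
theorem SimpleGraph.connected_of_parent {V : Type*} [Finite V] {T : SimpleGraph V} (t : V)
    (p : V → V) (rk : V → ℕ) (h : ∀ i, i ≠ t → T.Adj i (p i) ∧ rk i < rk (p i)) :
    T.Connected := by
  obtain ⟨M, hM⟩ : ∃ M, ∀ i, rk i ≤ M := by
    obtain ⟨M, hM⟩ := (Set.finite_range rk).bddAbove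
    exact ⟨M, fun i => hM ⟨i, rfl⟩⟩
  have key : ∀ d i, M - rk i = d → T.Reachable i t := by
    intro d
    induction d using Nat.strong_induction_on with
    | _ d ih =>
      intro i hi
      by_cases hit : i = t
      · rw [hit]
      · obtain ⟨ha, hr⟩ := h i hit
        have := hM (p i)
        exact ha.reachable.trans (ih (M - rk (p i)) (by omega) _ rfl)
  have : Nonempty V := ⟨t⟩
  exact ⟨fun i j => (key _ i rfl).trans (key _ j rfl).symm⟩

/-- The graph of a parent map `p` with root `t` is a tree if parents have larger rank: it is
connected and has at most one edge for each vertex other than the root. -/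
theorem SimpleGraph.isTree_of_parent {V : Type*} [Finite V] {T : SimpleGraph V} (t : V)
    (p : V → V) (rk : V → ℕ) (h : ∀ i, i ≠ t → rk i < rk (p i))
    (hT : ∀ i j, T.Adj i j ↔ (i ≠ t ∧ p i = j) ∨ (j ≠ t ∧ p j = i)) : T.IsTree := by
  classical
  have := Fintype.ofFinite V
  have hconn : T.Connected := connected_of_parent t p rk fun i hi =>
    ⟨(hT _ _).2 (.inl ⟨hi, rfl⟩), h i hi⟩
  rw [SimpleGraph.isTree_iff_connected_and_card]
  refine ⟨hconn, ?_⟩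
  have hle : Nat.card T.edgeSet ≤ Nat.card V - 1 := by
    have hsub : T.edgeSet ⊆ ((Finset.univ.erase t).image fun i => s(i, p i) : Finset (Sym2 V)) := by
      intro e
      induction e with | _ i j => ?_
      intro he
      rw [SimpleGraph.mem_edgeSet, hT] at he
      simp only [Finset.coe_image, Set.mem_image, Finset.mem_coe, Finset.mem_erase,
        Finset.mem_univ, and_true]
      rcases he with ⟨hi, rfl⟩ | ⟨hj, rfl⟩
      · exact ⟨i, hi, rfl⟩
      · exact ⟨j, hj, Sym2.eq_swap⟩
    calc Nat.card T.edgeSet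
        ≤ Nat.card (((Finset.univ.erase t).image fun i => s(i, p i) : Finset (Sym2 V)) :
            Set (Sym2 V)) := Nat.card_mono (Finset.finite_toSet _) hsub
      _ ≤ (Finset.univ.erase t).card := by
          rw [Nat.card_coe_set_eq, Set.ncard_coe_finset]; exact Finset.card_image_le
      _ = Nat.card V - 1 := by
          rw [Finset.card_erase_of_mem (Finset.mem_univ _), Finset.card_univ,
            Nat.card_eq_fintype_card]
  have hge := hconn.card_vert_le_card_edgeSet_add_one
  have : 0 < Nat.card V := Nat.card_pos_iff.2 ⟨⟨t⟩, inferInstance⟩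
  omega

/-- A store that lists a rooted tree through a parent map `p`, with the nodes `0, …, n` and the
root `n + 1`, and bags given by the relation `B`, describes a tree decomposition, provided that
the bags containing a fixed vertex `v` form a set of nodes that is closed under `p`, up to its top
node. The rank `rk` witnesses that `p` has no cycles. -/
theorem exists_describes {G : EdgeListGraph} {p rk : ℕ → ℕ} {B : ℕ → ℕ → Prop} {W : ℕ}
    (hp : ∀ i ≤ G.n, p i < G.n + 2 ∧ rk i < rk (p i))
    (hcov : ∀ v < G.n, ∃ i < G.n + 2, B i v)
    (hedge : ∀ e, ∃ i < G.n + 2, B i (G.ends e).1 ∧ B i (G.ends e).2)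
    (hconn : ∀ v < G.n, ∃ t < G.n + 2, B t v ∧
      ∀ i < G.n + 2, B i v → i ≠ t → i ≤ G.n ∧ B (p i) v)
    (hW : ∀ i < G.n + 2, ∀ X : Finset ℕ, (∀ v ∈ X, v < G.n ∧ B i v) → X.card ≤ W)
    {τ : RandRAM.Store} (h0 : τ.reg 0 = G.n + 2)
    (h1 : ∀ i ≤ G.n, τ.mem 0 i = i ∧ τ.mem 1 i = p i)
    (h2 : ∀ i < G.n + 2, ∀ v < G.n, τ.mem 2 (i * G.n + v) ≠ 0 ↔ B i v) :
    ∃ D : G.TreeDecomposition, Describes τ D ∧ D.width ≤ (W : ℤ) - 1 := by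
  classical
  let P : Fin (G.n + 2) → Fin (G.n + 2) := fun i =>
    if h : (i : ℕ) ≤ G.n then ⟨p i, (hp i h).1⟩ else i
  let r : Fin (G.n + 2) := ⟨G.n + 1, by omega⟩
  have hr : ∀ i : Fin (G.n + 2), i ≠ r ↔ (i : ℕ) ≤ G.n := by
    intro i; rw [Ne, Fin.ext_iff]; have := i.2; simp only [r]; omega
  have hP : ∀ i : Fin (G.n + 2), i ≠ r → ((P i : Fin _) : ℕ) = p i := by
    intro i hi; simp [P, (hr i).1 hi]
  have hrk : ∀ i : Fin (G.n + 2), i ≠ r → rk i < rk (P i) := by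
    intro i hi; rw [hP i hi]; exact (hp i ((hr i).1 hi)).2
  let T : SimpleGraph (Fin (G.n + 2)) :=
    { Adj := fun i j => (i ≠ r ∧ P i = j) ∨ (j ≠ r ∧ P j = i)
      symm := ⟨fun _ _ h => h.symm⟩
      loopless := ⟨fun i h => by
        have h' : i ≠ r ∧ P i = i := by tauto
        have := hrk i h'.1
        rw [h'.2] at this; omega⟩ }
  let D : G.TreeDecomposition :=
    { N := G.n + 2
      tree := T
      isTree := SimpleGraph.isTree_of_parent r P (fun i => rk i) hrk fun _ _ => Iff.rfl
      bag := fun i => Finset.univ.filter fun v => B i v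
      vertex_covered := fun v => by
        obtain ⟨i, hi, h⟩ := hcov v v.2
        exact ⟨⟨i, hi⟩, by simpa using h⟩
      edge_covered := fun e => by
        obtain ⟨i, hi, h⟩ := hedge e
        exact ⟨⟨i, hi⟩, by simpa using h⟩
      connected := fun v => by
        obtain ⟨t, ht, htv, hstep⟩ := hconn v v.2
        have hB : ∀ i : Fin (G.n + 2),
            i ∈ {i : Fin (G.n + 2) | v ∈ Finset.univ.filter fun v : Fin G.n => B i v} ↔ B i v := by
          intro i; simp
        have hcl : ∀ i : Fin (G.n + 2), i ≠ ⟨t, ht⟩ → B i v → i ≠ r ∧ B (P i) v := by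
          intro i hit hi
          obtain ⟨a, b⟩ := hstep i i.2 hi fun h => hit (Fin.ext h)
          have := (hr i).2 a
          exact ⟨this, by rw [hP i this]; exact b⟩
        refine SimpleGraph.connected_of_parent ⟨⟨t, ht⟩, (hB _).2 htv⟩
          (fun i => if h : (i : Fin _) ≠ ⟨t, ht⟩ then
            ⟨P i, (hB _).2 (hcl i h ((hB _).1 i.2)).2⟩ else i) (fun i => rk i) ?_
        rintro ⟨i, hi⟩ hit
        have hit' : i ≠ ⟨t, ht⟩ := fun h => hit (Subtype.ext h)
        have hir := (hcl i hit' ((hB _).1 hi)).1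
        simp only [ne_eq, hit', not_false_eq_true, dite_true]
        exact ⟨Or.inl ⟨hir, rfl⟩, hrk i hir⟩ }
  refine ⟨D, ⟨h0, ?_, ?_⟩, ?_⟩
  · intro i j
    have hi := i.2
    have hj := j.2
    change T.Adj i j ↔ i ≠ j ∧ ∃ e : ℕ, e + 1 < G.n + 2 ∧ _
    constructor
    · intro h
      refine ⟨T.ne_of_adj h, ?_⟩
      rcases h with ⟨hi, h⟩ | ⟨hi, h⟩
      · have hi' := (hr _).1 hi
        refine ⟨(i : ℕ), by omega, .inl ⟨(h1 i hi').1, ?_⟩⟩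
        rw [(h1 i hi').2, ← hP i hi, h]
      · have hi' := (hr _).1 hi
        refine ⟨(j : ℕ), by omega, .inr ⟨(h1 j hi').1, ?_⟩⟩
        rw [(h1 j hi').2, ← hP j hi, h]
    · rintro ⟨hne, e, he, h⟩
      have he' : e ≤ G.n := by omega
      rw [(h1 e he').1, (h1 e he').2] at h
      rcases h with ⟨rfl, h⟩ | ⟨rfl, h⟩
      · exact .inl ⟨(hr i).2 he', Fin.ext (by rw [hP i ((hr i).2 he')]; exact h)⟩
      · exact .inr ⟨(hr j).2 he', Fin.ext (by rw [hP j ((hr j).2 he')]; exact h)⟩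
  · intro i v
    rw [h2 i i.2 v v.2]
    exact Finset.mem_filter.trans (and_iff_right (Finset.mem_univ v))
  · have : (Finset.univ.sup fun i => (D.bag i).card) ≤ W := by
      refine Finset.sup_le fun i _ => ?_
      have := hW i i.2 ((D.bag i).map Fin.valEmbedding) (by
        intro v hv
        obtain ⟨w, hw, rfl⟩ := Finset.mem_map.1 hv
        exact ⟨w.2, (Finset.mem_filter.1 hw).2⟩)
      rwa [Finset.card_map] at this
    simp only [EdgeListGraph.TreeDecomposition.width]
    omega

/-! ### Numerical estimates -/

/-- Jensen's inequality for `x ↦ 2 ^ (-x)`, applied to the numbers `d v` together with `k - |s|`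
further numbers that are zero. It is obtained from the tangent at the average. -/
theorem two_rpow_neg_average_le {ι : Type*} (s : Finset ι) (d : ι → ℕ) {k : ℕ} (hk : 0 < k)
    (hs : s.card ≤ k) :
    (2 : ℝ) ^ (-(((∑ v ∈ s, d v : ℕ) : ℝ) / k)) * k ≤
      ∑ v ∈ s, ((2 : ℝ) ^ d v)⁻¹ + (k - s.card) := by
  set a : ℝ := ((∑ v ∈ s, d v : ℕ) : ℝ) / k with ha
  set c : ℝ := (2 : ℝ) ^ (-a) with hc
  have hk0 : (k : ℝ) ≠ 0 := by positivity
  have hc0 : 0 < c := by positivity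
  have tangent : ∀ x : ℝ, c * (1 + (a - x) * Real.log 2) ≤ (2 : ℝ) ^ (-x) := by
    intro x
    have h1 : (2 : ℝ) ^ (-x) = c * (2 : ℝ) ^ (a - x) := by
      rw [hc, ← Real.rpow_add two_pos]; ring_nf
    rw [h1]
    refine mul_le_mul_of_nonneg_left ?_ hc0.le
    rw [Real.rpow_def_of_pos two_pos]
    have := Real.add_one_le_exp (Real.log 2 * (a - x))
    linarith
  have h0 : c * (1 + a * Real.log 2) ≤ 1 := by simpa using tangent 0
  have hsum : ∑ v ∈ s, c * (1 + (a - d v) * Real.log 2) ≤ ∑ v ∈ s, ((2 : ℝ) ^ d v)⁻¹ := by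
    refine Finset.sum_le_sum fun v _ => ?_
    refine (tangent (d v)).trans_eq ?_
    rw [Real.rpow_neg two_pos.le, Real.rpow_natCast]
  have hD : ∑ v ∈ s, (d v : ℝ) = a * k := by
    rw [ha, div_mul_cancel₀ _ hk0]; push_cast; rfl
  have hsum' : ∑ v ∈ s, c * (1 + (a - d v) * Real.log 2) =
      c * (s.card + (a * s.card - a * k) * Real.log 2) := by
    rw [← Finset.mul_sum, Finset.sum_add_distrib, ← Finset.sum_mul, Finset.sum_sub_distrib, hD]
    simp [mul_comm]
  have hks : (0 : ℝ) ≤ k - s.card := sub_nonneg.2 (by exact_mod_cast hs)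
  have := mul_le_mul_of_nonneg_left h0 hks
  nlinarith

/-- The error terms of the construction sum up to `O(k ^ (13 / 16))`. Here `f` is the size of the
feedback vertex set, `s` the number of separating vertices, `f / 2 ^ (L + 1)` bounds the
contribution of vertices of degree more than `L`, and `y` is the discrepancy of the colouring. -/
theorem error_le {f L s k : ℕ} {y : ℝ} (hk : 0 < k) (hfk : f ≤ k) (hL : f = 0 ∨ 4 ^ L ≤ f)
    (hL' : f < 4 ^ (L + 1)) (hs : 2 ^ L * s ≤ f * L)
    (hy : y ^ 2 ≤ 2 * max (2 ^ L) 2 * (f * L)) :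
    s + 1 + (f : ℝ) * ((2 : ℝ) ^ (L + 1))⁻¹ + y ≤ 24 * (k : ℝ) ^ (-(3 / 16) : ℝ) * k := by
  have hk1 : (1 : ℝ) ≤ k := by exact_mod_cast hk
  have hkk : (k : ℝ) ^ (-(3 / 16) : ℝ) * k = ((k : ℝ) ^ (1 / 16 : ℝ)) ^ 13 := by
    rw [← Real.rpow_natCast, ← Real.rpow_mul (by positivity), ← Real.rpow_add_one (by positivity)]
    norm_num
  rw [mul_assoc, hkk]
  have hq1k : (1 : ℝ) ≤ (k : ℝ) ^ (1 / 16 : ℝ) := Real.one_le_rpow hk1 (by norm_num)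
  rcases Nat.eq_zero_or_pos f with rfl | hf
  · have hs0 : s = 0 := by
      have : 2 ^ L * s = 0 := by simpa using hs
      have h2 : 2 ^ L ≠ 0 := by positivity
      simpa [h2] using this
    have hy0 : y = 0 := by
      have : y ^ 2 ≤ 0 := by simpa using hy
      nlinarith [sq_nonneg y]
    have : (1 : ℝ) ≤ ((k : ℝ) ^ (1 / 16 : ℝ)) ^ 13 := one_le_pow₀ hq1k
    subst hs0 hy0
    simp; linarith
  have hL4 : 4 ^ L ≤ f := by omega
  have hf1 : (1 : ℝ) ≤ f := by exact_mod_cast hf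
  set q : ℝ := (f : ℝ) ^ (1 / 16 : ℝ) with hq
  have hq1 : 1 ≤ q := Real.one_le_rpow hf1 (by norm_num)
  have hqk : q ≤ (k : ℝ) ^ (1 / 16 : ℝ) :=
    Real.rpow_le_rpow (by positivity) (by exact_mod_cast hfk) (by norm_num)
  have hfq : (f : ℝ) = q ^ 16 := by
    rw [hq, ← Real.rpow_natCast, ← Real.rpow_mul (by positivity)]; norm_num
  set P : ℝ := (2 : ℝ) ^ L with hP
  have hP1 : 1 ≤ P := one_le_pow₀ (by norm_num)
  have hPq : P ≤ q ^ 8 := by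
    have h1 : P ^ 2 ≤ (q ^ 8) ^ 2 := by
      have : ((4 ^ L : ℕ) : ℝ) ≤ f := by exact_mod_cast hL4
      rw [hP, ← pow_mul, mul_comm, pow_mul, ← pow_mul q, ← hfq]
      norm_num at this ⊢; exact this
    exact le_of_pow_le_pow_left₀ two_ne_zero (by positivity) h1
  have hqP : q ^ 8 ≤ 2 * P := by
    have h1 : (q ^ 8) ^ 2 ≤ (2 * P) ^ 2 := by
      have : (f : ℝ) ≤ ((4 ^ (L + 1) : ℕ) : ℝ) := by exact_mod_cast hL'.le
      rw [← pow_mul, ← hfq, hP, mul_pow, ← pow_mul, mul_comm L, pow_mul]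
      norm_num at this ⊢
      rw [pow_succ] at this; linarith
    exact le_of_pow_le_pow_left₀ two_ne_zero (by positivity) h1
  have hLq : (L : ℝ) ≤ 8 * q ^ 2 := by
    have h1 : (L : ℝ) / 8 ≤ (2 : ℝ) ^ ((L : ℝ) / 4) := by
      rw [Real.rpow_def_of_pos two_pos]
      have h2 := Real.add_one_le_exp (Real.log 2 * ((L : ℝ) / 4))
      have h3 := Real.log_two_gt_d9
      have h4 : (0 : ℝ) ≤ L := by positivity
      nlinarith
    have h2 : (2 : ℝ) ^ ((L : ℝ) / 4) ≤ q ^ 2 := by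
      have h3 : ((2 : ℝ) ^ ((L : ℝ) / 4)) ^ 4 ≤ (q ^ 2) ^ 4 := by
        rw [← Real.rpow_natCast, ← Real.rpow_mul two_pos.le, ← pow_mul]
        norm_num
        exact hPq
      exact le_of_pow_le_pow_left₀ (by norm_num) (by positivity) h3
    linarith
  have hq0 : 0 < q := by linarith
  have hsq : (s : ℝ) ≤ 16 * q ^ 10 := by
    have h1 : P * s ≤ q ^ 16 * (8 * q ^ 2) := by
      have : ((2 ^ L * s : ℕ) : ℝ) ≤ ((f * L : ℕ) : ℝ) := by exact_mod_cast hs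
      push_cast at this
      rw [hfq] at this
      exact this.trans (mul_le_mul_of_nonneg_left hLq (by positivity))
    have h2 : q ^ 8 / 2 * s ≤ P * s := mul_le_mul_of_nonneg_right (by linarith) (by positivity)
    have h3 : q ^ 8 * (s : ℝ) ≤ q ^ 8 * (16 * q ^ 10) := by
      calc q ^ 8 * (s : ℝ) = 2 * (q ^ 8 / 2 * s) := by ring
        _ ≤ 2 * (q ^ 16 * (8 * q ^ 2)) := by linarith
        _ = _ := by ring
    exact le_of_mul_le_mul_left h3 (by positivity)
  have hyq : y ≤ 6 * q ^ 13 := by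
    have hmax : max P 2 ≤ 2 * q ^ 8 := by
      have : 1 ≤ q ^ 8 := one_le_pow₀ hq1
      exact max_le (by linarith) (by linarith)
    have h1 : y ^ 2 ≤ (6 * q ^ 13) ^ 2 := by
      calc y ^ 2 ≤ 2 * max P 2 * (f * L) := hy
        _ ≤ 2 * (2 * q ^ 8) * (q ^ 16 * (8 * q ^ 2)) := by
          rw [hfq]; gcongr
        _ = 32 * q ^ 26 := by ring
        _ ≤ _ := by nlinarith [pow_pos hq0 26]
    exact le_trans (le_abs_self y) (abs_le_of_sq_le_sq h1 (by positivity))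
  have hfP : (f : ℝ) * ((2 : ℝ) ^ (L + 1))⁻¹ ≤ q ^ 8 := by
    rw [← div_eq_mul_inv, div_le_iff₀ (by positivity), pow_succ (2 : ℝ) L, ← hP, hfq]
    nlinarith [pow_pos hq0 8]
  have h10 : q ^ 10 ≤ q ^ 13 := pow_le_pow_right₀ hq1 (by norm_num)
  have h8 : q ^ 8 ≤ q ^ 13 := pow_le_pow_right₀ hq1 (by norm_num)
  have h0 : 1 ≤ q ^ 13 := one_le_pow₀ hq1
  have hk13 : q ^ 13 ≤ ((k : ℝ) ^ (1 / 16 : ℝ)) ^ 13 := pow_le_pow_left₀ hq0.le hqk 13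
  linarith

theorem tendsto_error : Tendsto (fun k : ℕ => 24 * (k : ℝ) ^ (-(3 / 16) : ℝ)) atTop (𝓝 0) := by
  have := (tendsto_rpow_neg_atTop (y := 3 / 16) (by norm_num)).comp tendsto_natCast_atTop_atTop
  simpa using this.const_mul (24 : ℝ)

/-! ### Cutting a forest by eliminating leaves -/

namespace Peel

/-- The shape of a partial elimination of the forest `G - F` on the vertices `v < n` with
`chi v = 0`, whose edges are the pairs `s e`, `d e` with `e < m`. The vertices with `al v ≠ 0` are
still present; a vertex `v` that has been eliminated points to `par v - 1`, the one neighbour it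
had left at that time, and `par v = 0` if there was none. -/
structure Shape (n m : ℕ) (s d chi al par : ℕ → ℕ) : Prop where
  al_lt : ∀ v, al v ≠ 0 → v < n ∧ chi v = 0
  par_lt : ∀ v u, par v = u + 1 → (v < n ∧ chi v = 0) ∧ (u < n ∧ chi u = 0) ∧ al v = 0
  rank : ∃ (c : ℕ) (rk : ℕ → ℕ), (∀ v, rk v ≤ c) ∧
    ∀ v u, par v = u + 1 → al u ≠ 0 ∨ rk v < rk u
  edge : ∀ e < m, s e < n → d e < n → chi (s e) = 0 → chi (d e) = 0 →
    (al (s e) ≠ 0 ∧ al (d e) ≠ 0) ∨ par (s e) = d e + 1 ∨ par (d e) = s e + 1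

/-- The total weight of the vertices outside the separator `S` that carry the label `j`. -/
def group (n : ℕ) (own lab S : ℕ → ℕ) (j : ℕ) : ℕ :=
  ∑ x ∈ Finset.range n with lab x = j ∧ S x = 0, own x

/-- The separator `S` and the labels `lab` that are maintained during the elimination, where every
vertex `x` has a weight `own x`: vertices of the same component of the eliminated part, cut at `S`,
carry the same label, and the weight of every label is at most `P`. The number `w j` is the weight
collected by a remaining vertex `j`. The inequality `total` charges `P` units of weight to every
vertex of `S`. -/
structure Labelling (n P : ℕ) (chi own al par lab w S : ℕ → ℕ) : Prop where
  S_lt : ∀ v, S v ≠ 0 → v < n ∧ chi v = 0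
  lab_lt : ∀ v < n, lab v < n
  lab_self : ∀ v, al v ≠ 0 → S v = 0 → lab v = v
  lab_par : ∀ v u, par v = u + 1 → S v = 0 → S u = 0 → lab v = lab u
  group_le : ∀ j, group n own lab S j ≤ P
  group_le_w : ∀ j, al j ≠ 0 → S j = 0 → group n own lab S j ≤ w j
  total : P * ((Finset.range n).filter fun x => S x ≠ 0).card +
    ∑ x ∈ Finset.range n with al x ≠ 0 ∧ S x = 0, w x ≤ ∑ x ∈ Finset.range n, own x

/-- `v` can be eliminated: it has at most one edge to the remaining vertices, and `nb - 1` is the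
other end of that edge, or `nb = 0` if there is no such edge. -/
structure Leaf (m : ℕ) (s d al : ℕ → ℕ) (v nb : ℕ) : Prop where
  alive : al v ≠ 0
  fst : ∀ e < m, s e = v → al (d e) ≠ 0 → nb = d e + 1
  snd : ∀ e < m, d e = v → al (s e) ≠ 0 → nb = s e + 1
  alive_nb : ∀ u, nb = u + 1 → al u ≠ 0 ∧ u ≠ v

variable {n m N P v nb u : ℕ} {s d chi own al par lab w S : ℕ → ℕ}

theorem Shape.eliminate (h : Shape n m s d chi al par) (hl : Leaf m s d al v nb) :
    Shape n m s d chi (Function.update al v 0) (Function.update par v nb) where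
  al_lt x hx := by
    by_cases hxv : x = v
    · subst hxv; simp at hx
    · exact h.al_lt x (by simpa [hxv] using hx)
  par_lt x y hxy := by
    have hv := h.al_lt v hl.alive
    by_cases hxv : x = v
    · subst hxv
      rw [Function.update_self] at hxy
      exact ⟨hv, h.al_lt y (hl.alive_nb y hxy).1, by simp⟩
    · rw [Function.update_of_ne hxv] at hxy
      obtain ⟨a, b, c⟩ := h.par_lt x y hxy
      exact ⟨a, b, by rw [Function.update_of_ne hxv]; exact c⟩
  rank := by
    obtain ⟨c, rk, hc, hrk⟩ := h.rank
    refine ⟨c + 1, Function.update rk v (c + 1), fun x => ?_, fun x y hxy => ?_⟩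
    · have := hc x
      rw [Function.update_apply]; split_ifs <;> omega
    · by_cases hxv : x = v
      · subst hxv
        rw [Function.update_self] at hxy
        obtain ⟨a, b⟩ := hl.alive_nb y hxy
        exact .inl (by rwa [Function.update_of_ne b])
      · rw [Function.update_of_ne hxv] at hxy ⊢
        by_cases hyv : y = v
        · subst hyv
          right; rw [Function.update_self]; have := hc x; omega
        · rw [Function.update_of_ne hyv, Function.update_of_ne hyv]
          exact hrk x y hxy
  edge e he hs hd hcs hcd := by
    have key := h.edge e he hs hd hcs hcd
    have hv : ∀ y, par v ≠ y + 1 := fun y hy => hl.alive (h.par_lt v y hy).2.2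
    have h1 := hl.fst e he
    have h2 := hl.snd e he
    have h3 := hv (s e)
    have h4 := hv (d e)
    have h5 := hl.alive
    simp only [Function.update_apply]
    by_cases hsv : s e = v <;> by_cases hdv : d e = v <;> simp_all <;> tauto

/-- Eliminating a vertex that is isolated, or one end of whose last edge belongs to the separator,
changes neither the labels nor the separator. -/
theorem Labelling.of_eliminate_of_separated (h : Labelling n P chi own al par lab w S)
    (hsep : ∀ u, nb = u + 1 → S v ≠ 0 ∨ S u ≠ 0) :
    Labelling n P chi own (Function.update al v 0) (Function.update par v nb) lab w S where
  S_lt := h.S_lt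
  lab_lt := h.lab_lt
  lab_self x hx := h.lab_self x (by simp only [Function.update_apply] at hx; grind)
  lab_par x y hxy := by
    have h1 := h.lab_par x y
    simp only [Function.update_apply] at hxy
    grind
  group_le := h.group_le
  group_le_w x hx := h.group_le_w x (by simp only [Function.update_apply] at hx; grind)
  total := by
    refine le_trans (Nat.add_le_add_left (Finset.sum_le_sum_of_subset fun x => ?_) _) h.total
    simp only [Finset.mem_filter, Function.update_apply]
    grind

/-- If a vertex and its last neighbour have collected more than `P` together, the neighbour is put
into the separator. The weights that both have collected pay for it in `Labelling.total`. -/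
theorem Labelling.of_eliminate_of_cut (hs : Shape n m s d chi al par)
    (h : Labelling n P chi own al par lab w S)
    (hl : Leaf m s d al v (u + 1)) (hv : S v = 0) (hu : S u = 0) (hw : P < w u + w v) :
    Labelling n P chi own (Function.update al v 0) (Function.update par v (u + 1)) lab w
      (Function.update S u 1) where
  S_lt x hx := by
    by_cases hxu : x = u
    · subst hxu; exact hs.al_lt x (hl.alive_nb x rfl).1
    · exact h.S_lt x (by simpa [hxu] using hx)
  lab_lt := h.lab_lt
  lab_self x hx hx' := h.lab_self x (by simp only [Function.update_apply] at hx; grind)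
    (by simp only [Function.update_apply] at hx'; grind)
  lab_par x y hxy := by
    have h1 := h.lab_par x y
    simp only [Function.update_apply] at hxy ⊢
    grind
  group_le j := by
    refine le_trans (Finset.sum_le_sum_of_subset fun x => ?_) (h.group_le j)
    simp only [Finset.mem_filter, Function.update_apply]
    grind
  group_le_w j hj hj' := by
    refine le_trans (Finset.sum_le_sum_of_subset fun x => ?_) (h.group_le_w j
      (by simp only [Function.update_apply] at hj; grind)
      (by simp only [Function.update_apply] at hj'; grind))
    simp only [Finset.mem_filter, Function.update_apply]
    grind
  total := by
    have hun := hs.al_lt u (hl.alive_nb u rfl).1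
    have hvn := hs.al_lt v hl.alive
    have huv := (hl.alive_nb u rfl).2
    have h1 : ((Finset.range n).filter fun x => Function.update S u 1 x ≠ 0) =
        insert u ((Finset.range n).filter fun x => S x ≠ 0) := by
      ext x; simp only [Finset.mem_filter, Function.update_apply, Finset.mem_insert,
        Finset.mem_range]
      grind
    rw [h1, Finset.card_insert_of_notMem (by simp [hu])]
    have h2 : ((Finset.range n).filter fun x => al x ≠ 0 ∧ S x = 0) =
        insert u (insert v ((Finset.range n).filter fun x => Function.update al v 0 x ≠ 0 ∧
          Function.update S u 1 x = 0)) := by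
      have := (hl.alive_nb u rfl).1
      have := hl.alive
      ext x; simp only [Finset.mem_filter, Function.update_apply, Finset.mem_insert,
        Finset.mem_range]
      grind
    have h3 := h.total
    rw [h2, Finset.sum_insert (by simp [huv]), Finset.sum_insert (by simp)] at h3
    rw [mul_add, mul_one]
    omega

/-- If a vertex and its last neighbour have collected at most `P` together, the label of the vertex
is replaced by that of its neighbour, which takes over the collected weight. -/
theorem Labelling.of_eliminate_of_merge (hs : Shape n m s d chi al par)
    (h : Labelling n P chi own al par lab w S)
    (hl : Leaf m s d al v (u + 1)) (hv : S v = 0) (hu : S u = 0) (hw : w u + w v ≤ P)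
    {lab' : ℕ → ℕ} (hlab : ∀ x < n, lab' x = if lab x = v then u else lab x) :
    Labelling n P chi own (Function.update al v 0) (Function.update par v (u + 1)) lab'
      (Function.update w u (w u + w v)) S := by
  have hun := hs.al_lt u (hl.alive_nb u rfl).1
  have hvn := hs.al_lt v hl.alive
  have huv := (hl.alive_nb u rfl).2
  have hau := (hl.alive_nb u rfl).1
  have hlu := h.lab_self u hau hu
  have hlv := h.lab_self v hl.alive hv
  have hgu : group n own lab' S u ≤ group n own lab S u + group n own lab S v := by
    unfold group
    rw [← Finset.sum_union_inter]
    refine le_trans (Finset.sum_le_sum_of_subset fun x => ?_) (Nat.le_add_right _ _)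
    simp only [Finset.mem_filter, Finset.mem_union, Finset.mem_range]
    intro hx
    have := hlab x hx.1
    grind
  have hgj : ∀ j, j ≠ u → group n own lab' S j ≤ group n own lab S j := by
    intro j hj
    refine Finset.sum_le_sum_of_subset fun x => ?_
    simp only [Finset.mem_filter, Finset.mem_range]
    intro hx
    have := hlab x hx.1
    grind
  have hgu' := h.group_le_w u hau hu
  have hgv' := h.group_le_w v hl.alive hv
  constructor
  · exact h.S_lt
  · intro x hx
    have := h.lab_lt x hx
    rw [hlab x hx]; split_ifs <;> omega
  · intro x hx hx'
    simp only [Function.update_apply] at hx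
    have hxv : x ≠ v := by rintro rfl; simp at hx
    have hx0 : al x ≠ 0 := by simpa [hxv] using hx
    rw [hlab x (hs.al_lt x hx0).1, h.lab_self x hx0 hx', if_neg hxv]
  · intro x y hxy hx hy
    by_cases hxv : x = v
    · subst hxv
      rw [Function.update_self] at hxy
      obtain rfl : u = y := by omega
      rw [hlab x hvn.1, hlab u hun.1, hlu, hlv, if_pos rfl, if_neg huv]
    · rw [Function.update_of_ne hxv] at hxy
      have h1 := hs.par_lt x y hxy
      rw [hlab x h1.1.1, hlab y h1.2.1.1, h.lab_par x y hxy hx hy]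
  · intro j
    by_cases hj : j = u
    · subst hj; omega
    · exact (hgj j hj).trans (h.group_le j)
  · intro j hj hj'
    by_cases hju : j = u
    · subst hju; rw [Function.update_self]; omega
    · rw [Function.update_of_ne hju]
      exact (hgj j hju).trans (h.group_le_w j (by simp only [Function.update_apply] at hj; grind) hj')
  · have h2 : ((Finset.range n).filter fun x => al x ≠ 0 ∧ S x = 0) =
        insert v (insert u (((Finset.range n).filter fun x => Function.update al v 0 x ≠ 0 ∧
          S x = 0).erase u)) := by
      have := hl.alive
      ext x; simp only [Finset.mem_filter, Function.update_apply, Finset.mem_insert,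
        Finset.mem_range, Finset.mem_erase]
      grind
    have hmem : u ∈ (Finset.range n).filter fun x => Function.update al v 0 x ≠ 0 ∧ S x = 0 := by
      simp [huv, hau, hu, hun.1]
    have h3 := h.total
    rw [h2, Finset.sum_insert (by simp [huv.symm]), Finset.sum_insert (by simp)] at h3
    rw [← Finset.add_sum_erase _ _ hmem, Function.update_self]
    have h4 : ∑ x ∈ ((Finset.range n).filter fun x => Function.update al v 0 x ≠ 0 ∧
        S x = 0).erase u, Function.update w u (w u + w v) x =
        ∑ x ∈ ((Finset.range n).filter fun x => Function.update al v 0 x ≠ 0 ∧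
        S x = 0).erase u, w x := by
      refine Finset.sum_congr rfl fun x hx => ?_
      rw [Function.update_of_ne (Finset.ne_of_mem_erase hx)]
    rw [h4]
    omega

theorem Shape.start {al : ℕ → ℕ} (hal : ∀ v, al v ≠ 0 ↔ v < n ∧ chi v = 0) :
    Shape n m s d chi al (fun _ => 0) where
  al_lt v := (hal v).1
  par_lt := by simp
  rank := ⟨0, fun _ => 0, by simp, by simp⟩
  edge e _ h1 h2 h3 h4 := .inl ⟨(hal _).2 ⟨h1, h3⟩, (hal _).2 ⟨h2, h4⟩⟩

/-- In the beginning, the separator consists of the vertices whose own weight exceeds `P`. -/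
theorem Labelling.start (hal : ∀ v, al v ≠ 0 ↔ v < n ∧ chi v = 0)
    (hlab : ∀ v < n, lab v = v) (hS : ∀ v, S v ≠ 0 ↔ v < n ∧ P < own v)
    (hown : ∀ v, own v ≠ 0 → chi v = 0) :
    Labelling n P chi own al (fun _ => 0) lab own S := by
  have hg : ∀ j, j < n → S j = 0 → group n own lab S j ≤ own j := by
    intro j hj hj'
    have : group n own lab S j ≤ ∑ x ∈ {j}, own x := by
      refine Finset.sum_le_sum_of_subset fun x => ?_
      simp only [Finset.mem_filter, Finset.mem_range, Finset.mem_singleton]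
      rintro ⟨h1, h2, _⟩
      rw [← h2, hlab x h1]
    simpa using this
  constructor
  · intro v hv
    have := (hS v).1 hv
    exact ⟨this.1, hown v (by omega)⟩
  · intro v hv; rw [hlab v hv]; exact hv
  · intro v hv _; exact hlab v ((hal v).1 hv).1
  · simp
  · intro j
    by_cases hj : j < n ∧ S j = 0
    · have h1 := hg j hj.1 hj.2
      have h2 := hS j
      have : ¬ P < own j := fun h => (h2.2 ⟨hj.1, h⟩) hj.2
      omega
    · have : group n own lab S j = 0 := by
        refine Finset.sum_eq_zero fun x hx => ?_
        simp only [Finset.mem_filter, Finset.mem_range] at hx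
        have := hlab x hx.1
        exact absurd ⟨by omega, by rw [← hx.2.1, this]; exact hx.2.2⟩ hj
      omega
  · intro j hj hj'
    exact hg j ((hal j).1 hj).1 hj'
  · have h1 : P * ((Finset.range n).filter fun x => S x ≠ 0).card ≤
        ∑ x ∈ Finset.range n with S x ≠ 0, own x := by
      rw [mul_comm, ← smul_eq_mul, ← Finset.sum_const]
      refine Finset.sum_le_sum fun x hx => ?_
      simp only [Finset.mem_filter] at hx
      exact ((hS x).1 hx.2).2.le
    have h2 : ∑ x ∈ Finset.range n with al x ≠ 0 ∧ S x = 0, own x ≤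
        ∑ x ∈ Finset.range n with ¬ S x ≠ 0, own x := by
      refine Finset.sum_le_sum_of_subset fun x => ?_
      simp only [Finset.mem_filter]; tauto
    have h3 := Finset.sum_filter_add_sum_filter_not (Finset.range n) (fun x => S x ≠ 0) own
    omega

end Peel

/-! ### Leaves of the forest -/

namespace Peel

/-- The number of edge ends at `v` whose other end satisfies `al`. -/
def count (m : ℕ) (s d al : ℕ → ℕ) (v : ℕ) : ℕ :=
  ∑ e ∈ Finset.range m,
    ((if s e = v ∧ al (d e) ≠ 0 then 1 else 0) + (if d e = v ∧ al (s e) ≠ 0 then 1 else 0))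

end Peel

theorem SimpleGraph.IsAcyclic.exists_subsingleton_neighbors {V : Type*} [Finite V] [Nonempty V]
    {T : SimpleGraph V} (h : T.IsAcyclic) :
    ∃ v, ∀ x y, T.Adj v x → T.Adj v y → x = y := by
  classical
  have := Fintype.ofFinite V
  obtain ⟨v₀⟩ := ‹Nonempty V›
  set c := T.connectedComponentMk v₀ with hc
  have htree := h.isTree_connectedComponent c
  rcases subsingleton_or_nontrivial c with hs | hn
  · refine ⟨v₀, fun x y hx _ => ?_⟩
    have hx' : x ∈ c.supp := by
      rw [SimpleGraph.ConnectedComponent.mem_supp_iff, hc, SimpleGraph.ConnectedComponent.eq]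
      exact hx.symm.reachable
    have := hs.elim (⟨v₀, rfl⟩ : c) ⟨x, hx'⟩
    exact absurd (congrArg Subtype.val this) hx.ne
  · obtain ⟨⟨v, hv⟩, _, -, hd, -⟩ := htree.exists_ne_and_degree_eq_one
    obtain ⟨w, hw, hu⟩ := SimpleGraph.degree_eq_one_iff_existsUnique_adj.1 hd
    have key : ∀ x, T.Adj v x → x = w := by
      intro x hx
      have hx' : x ∈ c.supp := by
        have hv' : T.connectedComponentMk v = c := hv
        rw [SimpleGraph.ConnectedComponent.mem_supp_iff, ← hv', SimpleGraph.ConnectedComponent.eq]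
        exact hx.symm.reachable
      exact congrArg Subtype.val (hu ⟨x, hx'⟩ hx)
    exact ⟨v, fun x y hx hy => (key x hx).trans (key y hy).symm⟩

theorem inputStore_ends (G : EdgeListGraph) (F : Finset (Fin G.n)) (e : Fin G.m) :
    (inputStore G F).mem 0 e = (G.ends e).1 ∧ (inputStore G F).mem 1 e = (G.ends e).2 := by
  simp [inputStore]

/-- Every nonempty set of vertices outside a feedback vertex set has a vertex with at most one edge
end to the set. Here multiplicities count, and loops and parallel edges have to be excluded. -/
theorem EdgeListGraph.IsFVS.exists_count_le_one {G : EdgeListGraph} {F : Finset (Fin G.n)}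
    (hF : G.IsFVS F) {s d al : ℕ → ℕ} (hs : ∀ e : Fin G.m, s e = (G.ends e).1)
    (hd : ∀ e : Fin G.m, d e = (G.ends e).2)
    (hal : ∀ v, al v ≠ 0 → ∃ h : v < G.n, (⟨v, h⟩ : Fin G.n) ∉ F) (hne : ∃ v, al v ≠ 0) :
    ∃ v, al v ≠ 0 ∧ Peel.count G.m s d al v ≤ 1 := by
  obtain ⟨hloop, hpar, hacyc⟩ := hF
  set A : Set (Fin G.n) := {v | al v ≠ 0} with hA
  have hAF : ∀ v : Fin G.n, al v ≠ 0 → v ∉ F := fun v hv => (hal v hv).2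
  have hAac : (G.toSimple.induce A).IsAcyclic :=
    hacyc.embedding (SimpleGraph.induceHomOfLE G.toSimple
      (s := A) (s' := {v | v ∉ F}) (fun v hv => hAF v hv))
  obtain ⟨v₁, hv₁⟩ := hne
  have : Nonempty A := ⟨⟨⟨v₁, (hal v₁ hv₁).1⟩, hv₁⟩⟩
  obtain ⟨⟨v, hv⟩, huniq⟩ := hAac.exists_subsingleton_neighbors
  have hvF := hAF v hv
  refine ⟨v, hv, ?_⟩
  -- every edge end that is counted belongs to an edge of `G - F` with the ends `v` and `w`
  have hterm : ∀ e ∈ Finset.range G.m,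
      (if s e = v ∧ al (d e) ≠ 0 then 1 else 0) + (if d e = v ∧ al (s e) ≠ 0 then 1 else 0) ≠ 0 →
      ∃ (he : e < G.m) (w : Fin G.n), al w ≠ 0 ∧ w ≠ v ∧ G.Avoids F ⟨e, he⟩ ∧
        s((G.ends ⟨e, he⟩).1, (G.ends ⟨e, he⟩).2) = s(v, w) ∧ G.toSimple.Adj v w := by
    intro e he h
    have he' := Finset.mem_range.1 he
    have h1 := hs ⟨e, he'⟩
    have h2 := hd ⟨e, he'⟩
    simp only at h1 h2
    have hcase : (s e = v ∧ al (d e) ≠ 0) ∨ (d e = v ∧ al (s e) ≠ 0) := by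
      by_contra hcon
      rw [not_or] at hcon
      exact h (by rw [if_neg hcon.1, if_neg hcon.2])
    rcases hcase with ⟨ha, hb⟩ | ⟨ha, hb⟩
    · have hv' : (G.ends ⟨e, he'⟩).1 = v := Fin.ext (by omega)
      rw [h2] at hb
      have hav : G.Avoids F ⟨e, he'⟩ := ⟨by rw [hv']; exact hvF, hAF _ hb⟩
      have hne := hloop _ hav
      refine ⟨he', _, hb, fun h => hne (hv'.trans h.symm), hav, by rw [hv'], ?_⟩
      refine ⟨fun h => hne (hv'.trans h), ⟨e, he'⟩, .inl (Prod.ext hv' rfl)⟩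
    · have hv' : (G.ends ⟨e, he'⟩).2 = v := Fin.ext (by omega)
      rw [h1] at hb
      have hav : G.Avoids F ⟨e, he'⟩ := ⟨hAF _ hb, by rw [hv']; exact hvF⟩
      have hne := hloop _ hav
      refine ⟨he', _, hb, fun h => hne (h.trans hv'.symm), hav, by rw [hv', Sym2.eq_swap], ?_⟩
      refine ⟨fun h => hne (h.symm.trans hv'.symm), ⟨e, he'⟩, .inr (Prod.ext rfl hv')⟩
  by_cases hz : ∀ e ∈ Finset.range G.m,
      (if s e = v ∧ al (d e) ≠ 0 then 1 else 0) + (if d e = v ∧ al (s e) ≠ 0 then 1 else 0) = 0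
  · rw [Peel.count, Finset.sum_eq_zero hz]; omega
  push Not at hz
  obtain ⟨e, he, hez⟩ := hz
  obtain ⟨he', w, hw, hwv, hav, hew, hadj⟩ := hterm e he hez
  rw [Peel.count, Finset.sum_eq_single_of_mem e he]
  · have h1 := hs ⟨e, he'⟩
    have h2 := hd ⟨e, he'⟩
    have hne := hloop _ hav
    simp only at h1 h2
    have : ¬ (s e = v ∧ d e = v) := fun h => hne (Fin.ext (by omega))
    split_ifs <;> omega
  · intro e' he'' hne
    by_contra hez'
    obtain ⟨he₂, w', hw', hwv', hav', hew', hadj'⟩ := hterm e' he'' hez'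
    have : (⟨w, hw⟩ : A) = ⟨w', hw'⟩ := huniq _ _ (by simpa using hadj) (by simpa using hadj')
    obtain rfl : w = w' := congrArg Subtype.val this
    exact hpar ⟨e', he₂⟩ ⟨e, he'⟩ hav' (by simpa [Fin.ext_iff] using hne) (hew'.trans hew.symm)

/-- A leaf, as the program finds it. The second half of the hypothesis says that `nb - 1` is the
other end of the edge end that was counted last. -/
theorem Peel.Leaf.of_count {n m : ℕ} {s d chi al : ℕ → ℕ} {v nb : ℕ} (hv : al v ≠ 0)
    (hcount : count m s d al v ≤ 1)
    (hal : ∀ v, al v ≠ 0 → v < n ∧ chi v = 0)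
    (hloop : ∀ e < m, s e < n → chi (s e) = 0 → s e ≠ d e)
    (h0 : count m s d al v = 0 → nb = 0)
    (h1 : count m s d al v ≠ 0 → ∃ e < m, (s e = v ∧ al (d e) ≠ 0 ∧ nb = d e + 1) ∨
      (d e = v ∧ al (s e) ≠ 0 ∧ nb = s e + 1)) : Leaf m s d al v nb := by
  have hpos : ∀ e < m, (s e = v ∧ al (d e) ≠ 0) ∨ (d e = v ∧ al (s e) ≠ 0) →
      1 ≤ (if s e = v ∧ al (d e) ≠ 0 then 1 else 0) +
        (if d e = v ∧ al (s e) ≠ 0 then 1 else 0) := by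
    intro e _ h
    rcases h with h | h <;> simp [h]
  have huniq : ∀ e < m, ∀ e' < m, (s e = v ∧ al (d e) ≠ 0) ∨ (d e = v ∧ al (s e) ≠ 0) →
      (s e' = v ∧ al (d e') ≠ 0) ∨ (d e' = v ∧ al (s e') ≠ 0) → e = e' := by
    intro e he e' he' h h'
    by_contra hne
    have h2 : ∑ i ∈ {e, e'}, ((if s i = v ∧ al (d i) ≠ 0 then 1 else 0) +
        (if d i = v ∧ al (s i) ≠ 0 then 1 else 0)) ≤ count m s d al v := by
      refine Finset.sum_le_sum_of_subset fun x => ?_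
      simp only [Finset.mem_insert, Finset.mem_singleton, Finset.mem_range]
      rintro (rfl | rfl) <;> assumption
    rw [Finset.sum_pair hne] at h2
    have := hpos e he h
    have := hpos e' he' h'
    omega
  have hnz : ∀ e < m, (s e = v ∧ al (d e) ≠ 0) ∨ (d e = v ∧ al (s e) ≠ 0) →
      count m s d al v ≠ 0 := by
    intro e he h h2
    have h3 := Finset.sum_eq_zero_iff.1 h2 e (Finset.mem_range.2 he)
    have := hpos e he h
    omega
  have hnl : ∀ e < m, ¬ (s e = v ∧ d e = v) := by
    rintro e he ⟨h, h'⟩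
    have := hal v hv
    exact hloop e he (by omega) (by rw [h]; exact this.2) (h.trans h'.symm)
  refine ⟨hv, fun e he hse hde => ?_, fun e he hde hse => ?_, fun u hu => ?_⟩
  · obtain ⟨e', he', h'⟩ := h1 (hnz e he (.inl ⟨hse, hde⟩))
    obtain rfl := huniq e he e' he' (.inl ⟨hse, hde⟩) (by tauto)
    have := hnl e he
    tauto
  · obtain ⟨e', he', h'⟩ := h1 (hnz e he (.inr ⟨hde, hse⟩))
    obtain rfl := huniq e he e' he' (.inr ⟨hde, hse⟩) (by tauto)
    have := hnl e he
    tauto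
  · have hc : count m s d al v ≠ 0 := fun h => by have := h0 h; omega
    obtain ⟨e, he, h | h⟩ := h1 hc
    · obtain rfl : u = d e := by omega
      exact ⟨h.2.1, fun h2 => hnl e he ⟨h.1, h2⟩⟩
    · obtain rfl : u = s e := by omega
      exact ⟨h.2.1, fun h2 => hnl e he ⟨h2, h.1⟩⟩

/-! ### Greedy colouring -/

namespace Balance

variable {n L E₀ j : ℕ} {W deg : ℕ → ℕ} {adj : ℕ → ℕ → Prop}
  {QA QB QA' QB' : ℕ → Prop} {wA wB wA' wB' : ℕ → ℕ} {EA EB EA' EB' : ℕ}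

open Classical in
/-- The number of items before item `j` that involve the vertex `v`. -/
noncomputable def seen (adj : ℕ → ℕ → Prop) (j v : ℕ) : ℕ :=
  ((Finset.range j).filter fun i => adj i v).card

open Classical in
/-- The number of vertices of nonzero weight that item `i` involves. -/
noncomputable def size (n : ℕ) (W : ℕ → ℕ) (adj : ℕ → ℕ → Prop) (i : ℕ) : ℕ :=
  ((Finset.range n).filter fun v => W v ≠ 0 ∧ adj i v).card

/-- The state of the greedy colouring after the items `i < j` have been coloured. `QA i` and
`QB i` say that item `i` has the first and the second colour. The number `wA v` is `2 ^ L` times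
the probability that all items at `v` get the first colour, if the remaining ones are coloured at
random and `v` has as many of them as its degree permits; `EA` is the sum of these numbers,
and `E₀` is the value that `EA` and `EB` had at the beginning. -/
structure State (n L : ℕ) (W deg : ℕ → ℕ) (adj : ℕ → ℕ → Prop) (E₀ j : ℕ)
    (QA QB : ℕ → Prop) (wA wB : ℕ → ℕ) (EA EB : ℕ) : Prop where
  sumA : EA = ∑ v ∈ Finset.range n, wA v
  sumB : EB = ∑ v ∈ Finset.range n, wB v
  boundA : ∀ v, wA v * 2 ^ deg v ≤ 2 ^ L * 2 ^ seen adj j v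
  boundB : ∀ v, wB v * 2 ^ deg v ≤ 2 ^ L * 2 ^ seen adj j v
  suppA : ∀ v, wA v ≠ 0 → W v ≠ 0
  suppB : ∀ v, wB v ≠ 0 → W v ≠ 0
  disc : ((EA : ℤ) - E₀) ^ 2 + ((EB : ℤ) - E₀) ^ 2 ≤
    2 * (2 ^ L) ^ 2 * max (2 ^ L) 2 * ∑ i ∈ Finset.range j, size n W adj i
  settled : ∀ i < j, ∀ v < n, adj i v → (QA i → wB v = 0) ∧ (QB i → wA v = 0)

theorem State.swap (h : State n L W deg adj E₀ j QA QB wA wB EA EB) :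
    State n L W deg adj E₀ j QB QA wB wA EB EA :=
  ⟨h.sumB, h.sumA, h.boundB, h.boundA, h.suppB, h.suppA, by rw [add_comm]; exact h.disc,
    fun i hi v hv ha => (h.settled i hi v hv ha).symm⟩

/-- A weight is `2 ^ L` times a probability as long as no vertex has more items than its degree. -/
theorem State.le (h : State n L W deg adj E₀ j QA QB wA wB EA EB)
    (hseen : ∀ v, W v ≠ 0 → seen adj j v ≤ deg v) (v : ℕ) : wA v ≤ 2 ^ L := by
  by_cases hv : wA v = 0
  · simp [hv]
  · have h1 := h.boundA v
    have h2 : 2 ^ seen adj j v ≤ 2 ^ deg v :=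
      Nat.pow_le_pow_right two_pos (hseen v (h.suppA v hv))
    have h3 : wA v * 2 ^ deg v ≤ 2 ^ L * 2 ^ deg v := h1.trans (Nat.mul_le_mul_left _ h2)
    exact Nat.le_of_mul_le_mul_right h3 (by positivity)

open Classical in
theorem State.sum_le (h : State n L W deg adj E₀ j QA QB wA wB EA EB)
    (hseen : ∀ v, W v ≠ 0 → seen adj j v ≤ deg v) (i : ℕ) :
    ∑ v ∈ Finset.range n with adj i v, wA v ≤ 2 ^ L * size n W adj i := by
  rw [mul_comm, size, ← smul_eq_mul, ← Finset.sum_const]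
  calc ∑ v ∈ Finset.range n with adj i v, wA v
      = ∑ v ∈ Finset.range n with W v ≠ 0 ∧ adj i v, wA v := by
        symm
        refine Finset.sum_subset (fun v => ?_) fun v => ?_
        · simp only [Finset.mem_filter]; tauto
        · simp only [Finset.mem_filter]
          intro h1 h2
          by_contra h3
          exact h2 ⟨h1.1, h.suppA v h3, h1.2⟩
    _ ≤ _ := Finset.sum_le_sum fun v _ => h.le hseen v

theorem seen_succ_of_adj {v : ℕ} (h : adj j v) : seen adj (j + 1) v = seen adj j v + 1 := by
  classical
  rw [seen, Finset.range_add_one, Finset.filter_insert, if_pos h,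
    Finset.card_insert_of_notMem (by simp), seen]

theorem seen_succ_of_not_adj {v : ℕ} (h : ¬ adj j v) : seen adj (j + 1) v = seen adj j v := by
  classical
  rw [seen, Finset.range_add_one, Finset.filter_insert, if_neg h, seen]

open Classical in
/-- Giving item `j` the first colour, when this does not move `(EA, EB)` away from `(E₀, E₀)` to
first order. -/
theorem State.step (h : State n L W deg adj E₀ j QA QB wA wB EA EB)
    (hseen : ∀ v, W v ≠ 0 → seen adj j v ≤ deg v)
    (hsize : size n W adj j ≤ max (2 ^ L) 2)
    (hA : ∀ v, wA' v = if adj j v then wA v + wA v else wA v)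
    (hB : ∀ v, wB' v = if adj j v then 0 else wB v)
    (hEA : EA' = EA + ∑ v ∈ Finset.range n with adj j v, wA v)
    (hEB : EB' = EB - ∑ v ∈ Finset.range n with adj j v, wB v)
    (hQA : ∀ i < j, QA' i → QA i) (hQB : ∀ i < j, QB' i → QB i) (hj : ¬ QB' j)
    (hgreedy : EA * (∑ v ∈ Finset.range n with adj j v, wA v) +
        E₀ * (∑ v ∈ Finset.range n with adj j v, wB v) ≤
      EB * (∑ v ∈ Finset.range n with adj j v, wB v) +
        E₀ * (∑ v ∈ Finset.range n with adj j v, wA v)) :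
    State n L W deg adj E₀ (j + 1) QA' QB' wA' wB' EA' EB' := by
  have hx := h.sum_le hseen j
  have hy := h.swap.sum_le hseen j
  have hyE : ∑ v ∈ Finset.range n with adj j v, wB v ≤ EB := by
    rw [h.sumB]; exact Finset.sum_le_sum_of_subset (Finset.filter_subset _ _)
  constructor
  · rw [hEA, h.sumA, Finset.sum_filter, ← Finset.sum_add_distrib]
    refine Finset.sum_congr rfl fun v _ => ?_
    rw [hA]; split_ifs <;> simp
  · rw [hEB, h.sumB, ← Finset.sum_filter_add_sum_filter_not (Finset.range n) (adj j) wB,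
      Nat.add_sub_cancel_left, Finset.sum_filter]
    refine Finset.sum_congr rfl fun v _ => ?_
    rw [hB]; split_ifs <;> simp_all
  · intro v
    rw [hA]; split_ifs with hv
    · have := h.boundA v
      rw [seen_succ_of_adj hv, pow_succ, add_mul]; linarith
    · rw [seen_succ_of_not_adj hv]; exact h.boundA v
  · intro v
    rw [hB]; split_ifs with hv
    · simp
    · rw [seen_succ_of_not_adj hv]; exact h.boundB v
  · intro v hv
    rw [hA] at hv
    exact h.suppA v (by split_ifs at hv <;> omega)
  · intro v hv
    rw [hB] at hv
    exact h.suppB v (by split_ifs at hv <;> omega)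
  · rw [Finset.sum_range_succ]
    have h1 := h.disc
    set x := ∑ v ∈ Finset.range n with adj j v, wA v
    set y := ∑ v ∈ Finset.range n with adj j v, wB v
    set a := size n W adj j
    have hsq : ∀ z : ℕ, z ≤ 2 ^ L * a → (z : ℤ) ^ 2 ≤ (2 ^ L) ^ 2 * max (2 ^ L) 2 * a := by
      intro z hz
      have h3 : z ^ 2 ≤ (2 ^ L) ^ 2 * max (2 ^ L) 2 * a := by
        calc z ^ 2 ≤ (2 ^ L * a) ^ 2 := Nat.pow_le_pow_left hz 2
          _ = (2 ^ L) ^ 2 * (a * a) := by ring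
          _ ≤ (2 ^ L) ^ 2 * (max (2 ^ L) 2 * a) :=
            Nat.mul_le_mul_left _ (Nat.mul_le_mul_right _ hsize)
          _ = _ := by ring
      exact_mod_cast h3
    have hx2 := hsq x hx
    have hy2 := hsq y hy
    have hg : (EA : ℤ) * x + E₀ * y ≤ EB * y + E₀ * x := by exact_mod_cast hgreedy
    rw [hEA, hEB, Nat.cast_sub hyE]
    push_cast at h1 ⊢
    nlinarith
  · intro i hi v hv hav
    rcases Nat.lt_succ_iff_lt_or_eq.1 hi with hi' | rfl
    · have h1 := h.settled i hi' v hv hav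
      refine ⟨fun hq => ?_, fun hq => ?_⟩
      · have := h1.1 (hQA i hi' hq)
        rw [hB]; split_ifs <;> simp [this]
      · have := h1.2 (hQB i hi' hq)
        rw [hA]; split_ifs <;> simp [this]
    · exact ⟨fun _ => by rw [hB, if_pos hav], fun hq => absurd hq hj⟩

theorem State.start (hW : ∀ v, W v * 2 ^ deg v ≤ 2 ^ L) (hE : E₀ = ∑ v ∈ Finset.range n, W v) :
    State n L W deg adj E₀ 0 QA QB W W E₀ E₀ where
  sumA := hE
  sumB := hE
  boundA v := by simpa [seen] using hW v
  boundB v := by simpa [seen] using hW v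
  suppA _ h := h
  suppB _ h := h
  disc := by simp
  settled := by simp

/-- In the end, `2 ^ L` times the number of surviving vertices is at least `EA`. -/
theorem State.sum_le_card (h : State n L W deg adj E₀ j QA QB wA wB EA EB)
    (hseen : ∀ v, W v ≠ 0 → seen adj j v ≤ deg v) :
    EA ≤ 2 ^ L * ((Finset.range n).filter fun v => wA v ≠ 0).card := by
  rw [h.sumA, mul_comm, ← smul_eq_mul, ← Finset.sum_const, ← Finset.sum_filter_ne_zero]
  exact Finset.sum_le_sum fun v _ => h.le hseen v

end Balance

namespace RandRAM

/-- Sequential composition of a list of commands. -/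
def Cmd.block : List Cmd → Cmd
  | [] => .nop
  | p :: l => .seq p (block l)

@[simp] theorem Cmd.den_block_nil (σ : Store) : (Cmd.block []).den σ = σ := rfl

@[simp] theorem Cmd.den_block_cons (p : Cmd) (l : List Cmd) (σ : Store) :
    (Cmd.block (p :: l)).den σ = (Cmd.block l).den (p.den σ) := rfl

end RandRAM

/-! ### The program -/

namespace TreewidthProgram

open RandRAM RandRAM.Cmd RandRAM.Expr

/-- Copies the indicator function of `F` to array `3`, and puts `|F|` into register `3`. -/
def copyF : Cmd := rep 10 (block [
  setMem 3 (R 10) (M 2 (R 10)),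
  setReg 3 (R 3 + M 2 (R 10))])

/-- Fills array `4` with the powers of two. -/
def powers : Cmd := block [
  setMem 4 0 1,
  rep 10 (setMem 4 (R 10 + 1) (M 4 (R 10) + M 4 (R 10)))]

/-- Computes the largest `L` with `4 ^ L ≤ |F|` in register `4`, and `2 ^ L`, `4 ^ L` in
registers `5`, `6`. -/
def logs : Cmd := block [
  setReg 5 1,
  setReg 6 1,
  rep 10 (ite (R 6 + R 6 + R 6 + R 6 - R 3) nop (block [
    setReg 6 (R 6 + R 6 + R 6 + R 6),
    setReg 5 (R 5 + R 5),
    setReg 4 (R 4 + 1)]))]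

/-- Computes the degrees in array `5`. -/
def degrees : Cmd := rep 10 (ite (R 1 - R 10) (block [
  setMem 5 (M 0 (R 10)) (M 5 (M 0 (R 10)) + 1),
  setMem 5 (M 1 (R 10)) (M 5 (M 1 (R 10)) + 1)]) nop)

/-- Gives the weight `2 ^ (L - deg v)` to every `v` in `F` of degree at most `L`, in arrays `12`
and `13`, and puts the sum of the weights into register `7`. -/
def weights : Cmd := rep 10 (ite (both (M 3 (R 10)) (isZero (M 5 (R 10) - R 4))) (block [
  setMem 12 (R 10) (M 4 (R 4 - M 5 (R 10))),
  setMem 13 (R 10) (M 4 (R 4 - M 5 (R 10))),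
  setReg 7 (R 7 + M 12 (R 10))]) nop)

/-- For every vertex outside `F`, counts its edges to vertices of nonzero weight, in array `6`. -/
def loads : Cmd := rep 10 (ite (R 1 - R 10) (block [
  ite (both (M 12 (M 0 (R 10))) (isZero (M 3 (M 1 (R 10)))))
    (setMem 6 (M 1 (R 10)) (M 6 (M 1 (R 10)) + 1)) nop,
  ite (both (M 12 (M 1 (R 10))) (isZero (M 3 (M 0 (R 10)))))
    (setMem 6 (M 0 (R 10)) (M 6 (M 0 (R 10)) + 1)) nop]) nop)

/-- Marks the vertices outside `F` as remaining (array `7`), puts those of load more than `2 ^ L`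
into the separator (array `8`), and labels every vertex by itself (array `9`). -/
def startPeel : Cmd := rep 10 (block [
  setMem 7 (R 10) (both (R 0 - R 10) (isZero (M 3 (R 10)))),
  setMem 9 (R 10) (R 10),
  setMem 8 (R 10) (both (R 0 - R 10) (M 6 (R 10) - R 5))])

/-- Counts the edges from the vertex in register `11` to remaining vertices in register `13`, and
puts the other end of the last such edge, plus one, into register `14`. -/
def scan : Cmd := block [
  setReg 13 0,
  setReg 14 0,
  rep 12 (ite (R 1 - R 12) (block [
    ite (both (equals (M 0 (R 12)) (R 11)) (M 7 (M 1 (R 12))))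
      (block [setReg 13 (R 13 + 1), setReg 14 (M 1 (R 12) + 1)]) nop,
    ite (both (equals (M 1 (R 12)) (R 11)) (M 7 (M 0 (R 12))))
      (block [setReg 13 (R 13 + 1), setReg 14 (M 0 (R 12) + 1)]) nop]) nop)]

/-- Replaces the label in register `11` by its new value everywhere. -/
def relabel : Cmd := rep 12 (ite (equals (M 9 (R 12)) (R 11)) (setMem 9 (R 12) (R 14 - 1)) nop)

/-- Eliminates the vertex in register `11`: its parent (array `10`) is the vertex found by `scan`,
which either takes over its load and label or is put into the separator. -/
def eliminate : Cmd := block [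
  setMem 7 (R 11) 0,
  setMem 10 (R 11) (R 14),
  ite (both (R 14) (isZero (M 8 (R 11) + M 8 (R 14 - 1))))
    (ite (M 6 (R 14 - 1) + M 6 (R 11) - R 5)
      (setMem 8 (R 14 - 1) 1)
      (block [setMem 6 (R 14 - 1) (M 6 (R 14 - 1) + M 6 (R 11)), relabel]))
    nop]

/-- Eliminates the vertex in register `11` if it remains and is a leaf. -/
def visit : Cmd := ite (M 7 (R 11)) (block [scan, ite (R 13 - 1) nop eliminate]) nop

/-- Eliminates the whole forest. -/
def peel : Cmd := rep 10 (rep 11 visit)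

/-- Assigns edges at `F` to items: array `11` holds the number of the item plus one, or zero. The
items are the labels of the forest vertices, and `n + e` for an edge `e` inside `F`. -/
def items : Cmd := rep 10 (ite (R 1 - R 10)
  (ite (M 3 (M 0 (R 10)))
    (ite (M 3 (M 1 (R 10)))
      (setMem 11 (R 10) (R 0 + R 10 + 1))
      (ite (M 8 (M 1 (R 10))) nop (setMem 11 (R 10) (M 9 (M 1 (R 10)) + 1))))
    (ite (M 3 (M 1 (R 10)))
      (ite (M 8 (M 0 (R 10))) nop (setMem 11 (R 10) (M 9 (M 0 (R 10)) + 1)))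
      nop)) nop)

/-- Marks the ends of the edges of the item in register `10`, in array `14`. -/
def mark : Cmd := block [
  rep 11 (setMem 14 (R 11) 0),
  rep 11 (ite (equals (M 11 (R 11)) (R 10 + 1)) (block [
    setMem 14 (M 0 (R 11)) 1,
    setMem 14 (M 1 (R 11)) 1]) nop)]

/-- Adds up the weights of the marked vertices, in registers `15` and `16`. -/
def sums : Cmd := block [
  setReg 15 0,
  setReg 16 0,
  rep 11 (ite (M 14 (R 11)) (block [
    setReg 15 (R 15 + M 12 (R 11)),
    setReg 16 (R 16 + M 13 (R 11))]) nop)]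

/-- Computes the two sides of the inequality that decides the colour of an item. -/
def products : Cmd := block [
  setReg 17 0,
  setReg 18 0,
  rep 11 (block [
    ite (R 15 - R 11) (block [setReg 17 (R 17 + R 8), setReg 18 (R 18 + R 7)]) nop,
    ite (R 16 - R 11) (block [setReg 17 (R 17 + R 7), setReg 18 (R 18 + R 9)]) nop])]

/-- Doubles the weights in array `a` and clears those in array `b`, for all marked vertices. -/
def transfer (a b : ℕ) : Cmd := rep 11 (ite (M 14 (R 11)) (block [
  setMem a (R 11) (M a (R 11) + M a (R 11)),
  setMem b (R 11) 0]) nop)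

/-- Chooses the colour of the item in register `10` (array `15`) and updates the weights. -/
def colour : Cmd := ite (R 17 - R 18)
  (block [setMem 15 (R 10) 1, setReg 8 (R 8 - R 15), setReg 9 (R 9 + R 16), transfer 13 12])
  (block [setReg 8 (R 8 + R 15), setReg 9 (R 9 - R 16), transfer 12 13])

/-- Colours all items. -/
def greedy : Cmd := block [
  setReg 8 (R 7),
  setReg 9 (R 7),
  rep 10 (block [mark, sums, products, colour])]

/-- Computes which of the two halves of `F` the node of a vertex has in its bag, in array `16`, and
removes the parents of separating vertices. -/
def vertexKinds : Cmd := rep 10 (ite (R 0 - R 10) (ite (M 3 (R 10) + M 8 (R 10))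
  (setMem 10 (R 10) 0)
  (setMem 16 (R 10) (M 15 (M 9 (R 10)) + 1))) nop)

/-- Does the same as `vertexKinds` for all nodes, including the two hubs. -/
def kinds : Cmd := block [vertexKinds, setMem 16 (R 0) 1, setMem 16 (R 0 + 1) 2]

/-- Writes the edges from the nodes of the vertices to their parents in the tree. -/
def vertexEdges : Cmd := rep 10 (ite (R 0 - R 10) (block [
  setMem 0 (R 10) (R 10),
  ite (M 3 (R 10))
    (ite (M 13 (R 10)) (setMem 1 (R 10) (R 0 + 1)) (setMem 1 (R 10) (R 0)))
    (ite (both (M 10 (R 10)) (isZero (M 8 (M 10 (R 10) - 1))))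
      (setMem 1 (R 10) (M 10 (R 10) - 1))
      (setMem 1 (R 10) (R 0 + (M 16 (R 10) - 1))))]) nop)

/-- Writes the list of the tree edges. -/
def edges : Cmd := block [vertexEdges, setMem 0 (R 0) (R 0), setMem 1 (R 0) (R 0 + 1)]

/-- An expression that is nonzero if the vertex in register `11` is in the bag of the node in
register `10`. -/
def inBag : Expr := M 8 (R 11) + equals (R 11) (R 10) + equals (M 10 (R 10)) (R 11 + 1) +
  both (M 3 (R 11)) (both (equals (M 16 (R 10)) 1) (isZero (M 13 (R 11)))) +
  both (M 3 (R 11)) (both (equals (M 16 (R 10)) 2) (isZero (M 12 (R 11))))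

/-- Writes the membership matrix of the bags. -/
def matrix : Cmd := rep 10 (ite (R 0 + 2 - R 10)
  (rep 11 (ite (R 0 - R 11) (block [setMem 2 (R 19) inBag, setReg 19 (R 19 + 1)]) nop)) nop)

/-- The whole algorithm, except for the computation of the loop bound. -/
def main : Cmd := block [copyF, powers, logs, degrees, weights, loads, startPeel, peel, items,
  greedy, kinds, edges, matrix, setReg 0 (R 0 + 2)]

/-- The algorithm. Every loop runs for `2 * n + m + 3` rounds. -/
def program : Program := .seq (.setReg 2 (R 0 + R 0 + R 1 + 3)) main.compile

theorem main_wf : main.wf = true := by decide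

/-! ### Preparations -/

variable (σ : Store)

theorem copyF_spec :
    (copyF.den σ).mem 3 = (fun i => if i < σ.reg 2 then σ.mem 2 i else σ.mem 3 i) ∧
    (copyF.den σ).reg 3 = σ.reg 3 + ∑ i ∈ Finset.range (σ.reg 2), σ.mem 2 i := by
  refine rep_rule (fun k τ => τ.mem 3 = (fun i => if i < k then σ.mem 2 i else σ.mem 3 i) ∧
    τ.reg 3 = σ.reg 3 + ∑ i ∈ Finset.range k, σ.mem 2 i) (by simp) ?_
  intro i _ τ hr hm hi ⟨h1, h2⟩
  have hm2 := hm 2 rfl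
  refine ⟨?_, ?_⟩
  · funext x
    simp [den, hm2, hi, h1, Function.update_apply]
    grind
  · simp [den, hm2, hi, h2, Finset.sum_range_succ, add_assoc]

theorem powers_spec : ∀ i ≤ σ.reg 2, (powers.den σ).mem 4 i = 2 ^ i := by
  refine rep_rule (σ := (setMem 4 0 1).den σ)
    (fun k τ => ∀ i ≤ k, τ.mem 4 i = 2 ^ i) ?_ ?_
  · intro i hi
    simp [den, Nat.le_zero.1 hi]
  intro i _ τ hr hm hi h x hx
  simp [den, hi, h, Function.update_apply]
  split_ifs with hxi
  · rw [hxi, pow_succ]; ring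
  · exact h x (by omega)

theorem logs_spec (h4 : σ.reg 4 = 0) (hf : σ.reg 3 ≤ σ.reg 2) :
    (logs.den σ).reg 5 = 2 ^ (logs.den σ).reg 4 ∧
    (σ.reg 3 = 0 ∨ 4 ^ (logs.den σ).reg 4 ≤ σ.reg 3) ∧
    σ.reg 3 < 4 ^ ((logs.den σ).reg 4 + 1) ∧ (logs.den σ).reg 4 ≤ σ.reg 2 := by
  have key := rep_rule (r := 10) (p := ite (R 6 + R 6 + R 6 + R 6 - R 3) nop (block [
    setReg 6 (R 6 + R 6 + R 6 + R 6), setReg 5 (R 5 + R 5), setReg 4 (R 4 + 1)]))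
    (σ := (setReg 6 1).den ((setReg 5 1).den σ))
    (fun k τ => τ.reg 6 = 4 ^ τ.reg 4 ∧ τ.reg 5 = 2 ^ τ.reg 4 ∧
      (σ.reg 3 = 0 ∨ 4 ^ τ.reg 4 ≤ σ.reg 3) ∧
      ((τ.reg 4 = k) ∨ σ.reg 3 < 4 ^ (τ.reg 4 + 1)) ∧ τ.reg 4 ≤ k) ?_ ?_
  · obtain ⟨-, k2, k3, k4, k5⟩ := key
    refine ⟨k2, k3, ?_, k5⟩
    rcases k4 with k4 | k4
    · have h1 : σ.reg 2 < 4 ^ σ.reg 2 := Nat.lt_pow_self (by norm_num)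
      have h2 : (logs.den σ).reg 4 = σ.reg 2 := k4
      rw [h2, pow_succ]; omega
    · exact k4
  · simp [den, h4]; omega
  · intro i _ τ hr hm hi ⟨h1, h2, h3, h5, h6⟩
    have hr3 : τ.reg 3 = σ.reg 3 := hr 3 rfl (by decide)
    have h7 : 4 ^ (τ.reg 4 + 1) = τ.reg 6 + τ.reg 6 + τ.reg 6 + τ.reg 6 := by
      rw [pow_succ, h1]; ring
    simp only [den]
    split_ifs with hc
    · have hlt : σ.reg 3 < 4 ^ (τ.reg 4 + 1) := by
        rw [h7, ← hr3]; simp at hc; omega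
      simp only [Store.setReg_reg]
      simp [h1, h2]
      exact ⟨by simpa [h1] using h3, .inr hlt, by omega⟩
    · have hle : 4 ^ (τ.reg 4 + 1) ≤ σ.reg 3 := by
        rw [h7, ← hr3]; simp at hc; omega
      simp [den]
      refine ⟨h7.symm, by rw [h2, pow_succ]; ring, .inr hle, ?_, h6⟩
      rcases h5 with h5 | h5
      · exact .inl h5
      · omega

theorem degrees_spec (h5 : σ.mem 5 = fun _ => 0) (hm : σ.reg 1 ≤ σ.reg 2) :
    (degrees.den σ).mem 5 = fun v => ∑ e ∈ Finset.range (σ.reg 1),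
      ((if σ.mem 0 e = v then 1 else 0) + (if σ.mem 1 e = v then 1 else 0)) := by
  have key := rep_rule (r := 10) (p := ite (R 1 - R 10) (block [
    setMem 5 (M 0 (R 10)) (M 5 (M 0 (R 10)) + 1),
    setMem 5 (M 1 (R 10)) (M 5 (M 1 (R 10)) + 1)]) nop) (σ := σ)
    (fun k τ => ∀ v, τ.mem 5 v = ∑ e ∈ Finset.range (min k (σ.reg 1)),
      ((if σ.mem 0 e = v then 1 else 0) + (if σ.mem 1 e = v then 1 else 0))) ?_ ?_
  · funext v
    rw [min_eq_right hm] at key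
    exact key v
  · simp [h5]
  · intro i _ τ hr hmm hi h v
    have hr1 : τ.reg 1 = σ.reg 1 := hr 1 rfl (by decide)
    have hm0 := hmm 0 rfl
    have hm1 := hmm 1 rfl
    simp only [den]
    split_ifs with hc
    · have hlt : i < σ.reg 1 := by simp [hr1, hi] at hc; omega
      rw [min_eq_left (by omega), Finset.sum_range_succ]
      have hv := h v
      rw [min_eq_left hlt.le] at hv
      rw [← hv]
      simp [den, hi, hm0, hm1, Function.update_apply]
      grind
    · have hlt : σ.reg 1 ≤ i := by simp [hr1, hi] at hc; omega
      have hv := h v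
      rw [min_eq_right hlt] at hv
      rw [min_eq_right (by omega), ← hv]
      simp

theorem weights_spec (h12 : σ.mem 12 = fun _ => 0) (h13 : σ.mem 13 = fun _ => 0)
    (h7 : σ.reg 7 = 0) {W : ℕ → ℕ} (hW : ∀ v, W v =
      if v < σ.reg 2 ∧ σ.mem 3 v ≠ 0 ∧ σ.mem 5 v ≤ σ.reg 4 then
        σ.mem 4 (σ.reg 4 - σ.mem 5 v) else 0) :
    (weights.den σ).mem 12 = W ∧ (weights.den σ).mem 13 = W ∧
    (weights.den σ).reg 7 = ∑ v ∈ Finset.range (σ.reg 2), W v := by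
  have key := rep_rule (r := 10) (p := ite (both (M 3 (R 10)) (isZero (M 5 (R 10) - R 4))) (block [
  setMem 12 (R 10) (M 4 (R 4 - M 5 (R 10))),
  setMem 13 (R 10) (M 4 (R 4 - M 5 (R 10))),
  setReg 7 (R 7 + M 12 (R 10))]) nop) (σ := σ)
    (fun k τ => (∀ v, τ.mem 12 v = if v < k then W v else 0) ∧
      (∀ v, τ.mem 13 v = if v < k then W v else 0) ∧ τ.reg 7 = ∑ v ∈ Finset.range k, W v) ?_ ?_
  · obtain ⟨k1, k2, k3⟩ := key
    have : ∀ v, (if v < σ.reg 2 then W v else 0) = W v := by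
      intro v
      split_ifs with h
      · rfl
      · rw [hW, if_neg (by tauto)]
    exact ⟨funext fun v => (k1 v).trans (this v), funext fun v => (k2 v).trans (this v), k3⟩
  · simp [h12, h13, h7]
  · intro i hiN τ hr hmm hi ⟨k1, k2, k3⟩
    have hr4 : τ.reg 4 = σ.reg 4 := hr 4 rfl (by decide)
    have hm3 := hmm 3 rfl
    have hm4 := hmm 4 rfl
    have hm5 := hmm 5 rfl
    have hWi := hW i
    simp only [den]
    split_ifs with hc
    · have hc' : σ.mem 3 i ≠ 0 ∧ σ.mem 5 i ≤ σ.reg 4 := by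
        simp [hm3, hm5, hr4, hi] at hc; omega
      rw [if_pos ⟨hiN, hc'⟩] at hWi
      refine ⟨fun v => ?_, fun v => ?_, ?_⟩
      · simp [den, hi, hm4, hm5, hr4, Function.update_apply, k1]
        grind
      · simp [den, hi, hm4, hm5, hr4, Function.update_apply, k2]
        grind
      · simp [den, hi, hm4, hm5, hr4, k3, Finset.sum_range_succ, hWi]
    · have hc' : ¬ (σ.mem 3 i ≠ 0 ∧ σ.mem 5 i ≤ σ.reg 4) := by
        simp [hm3, hm5, hr4, hi] at hc; omega
      rw [if_neg (by tauto)] at hWi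
      refine ⟨fun v => ?_, fun v => ?_, ?_⟩
      · simp [k1]; grind
      · simp [k2]; grind
      · simp [k3, Finset.sum_range_succ, hWi]

theorem loads_spec (h6 : σ.mem 6 = fun _ => 0) (hm : σ.reg 1 ≤ σ.reg 2) :
    (loads.den σ).mem 6 = fun v => ∑ e ∈ Finset.range (σ.reg 1),
      ((if σ.mem 1 e = v ∧ σ.mem 12 (σ.mem 0 e) ≠ 0 ∧ σ.mem 3 v = 0 then 1 else 0) +
        (if σ.mem 0 e = v ∧ σ.mem 12 (σ.mem 1 e) ≠ 0 ∧ σ.mem 3 v = 0 then 1 else 0)) := by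
  have key := rep_rule (r := 10) (p := ite (R 1 - R 10) (block [
  ite (both (M 12 (M 0 (R 10))) (isZero (M 3 (M 1 (R 10)))))
    (setMem 6 (M 1 (R 10)) (M 6 (M 1 (R 10)) + 1)) nop,
  ite (both (M 12 (M 1 (R 10))) (isZero (M 3 (M 0 (R 10)))))
    (setMem 6 (M 0 (R 10)) (M 6 (M 0 (R 10)) + 1)) nop]) nop) (σ := σ)
    (fun k τ => ∀ v, τ.mem 6 v = ∑ e ∈ Finset.range (min k (σ.reg 1)),
      ((if σ.mem 1 e = v ∧ σ.mem 12 (σ.mem 0 e) ≠ 0 ∧ σ.mem 3 v = 0 then 1 else 0) +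
        (if σ.mem 0 e = v ∧ σ.mem 12 (σ.mem 1 e) ≠ 0 ∧ σ.mem 3 v = 0 then 1 else 0))) ?_ ?_
  · funext v
    rw [min_eq_right hm] at key
    exact key v
  · simp [h6]
  · intro i _ τ hr hmm hi h v
    have hr1 : τ.reg 1 = σ.reg 1 := hr 1 rfl (by decide)
    have hm0 := hmm 0 rfl
    have hm1 := hmm 1 rfl
    have hm3 := hmm 3 rfl
    have hm12 := hmm 12 rfl
    have hv := h v
    by_cases hlt : i < σ.reg 1
    · have hc : τ.reg 1 - τ.reg 10 ≠ 0 := by omega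
      rw [min_eq_left (by omega), Finset.sum_range_succ]
      rw [min_eq_left hlt.le] at hv
      rw [← hv]
      clear h hv hr hmm
      simp [den, hi, hm0, hm1, hm3, hm12, apply_ite Store.mem, apply_ite Store.reg, ite_apply,
        Function.update_apply]
      grind
    · have hc : τ.reg 1 - τ.reg 10 = 0 := by omega
      rw [min_eq_right (by omega)] at hv ⊢
      rw [← hv]
      simp [den, hc]

theorem startPeel_spec (h7 : σ.mem 7 = fun _ => 0) (h8 : σ.mem 8 = fun _ => 0)
    (hn : σ.reg 0 ≤ σ.reg 2) :
    (∀ v, (startPeel.den σ).mem 7 v ≠ 0 ↔ v < σ.reg 0 ∧ σ.mem 3 v = 0) ∧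
    (∀ v < σ.reg 0, (startPeel.den σ).mem 9 v = v) ∧
    (∀ v, (startPeel.den σ).mem 8 v ≠ 0 ↔ v < σ.reg 0 ∧ σ.reg 5 < σ.mem 6 v) := by
  have key := rep_rule (r := 10) (p := block [
  setMem 7 (R 10) (both (R 0 - R 10) (isZero (M 3 (R 10)))),
  setMem 9 (R 10) (R 10),
  setMem 8 (R 10) (both (R 0 - R 10) (M 6 (R 10) - R 5))]) (σ := σ)
    (fun k τ => (∀ v, τ.mem 7 v ≠ 0 ↔ v < k ∧ v < σ.reg 0 ∧ σ.mem 3 v = 0) ∧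
      (∀ v < k, τ.mem 9 v = v) ∧
      (∀ v, τ.mem 8 v ≠ 0 ↔ v < k ∧ v < σ.reg 0 ∧ σ.reg 5 < σ.mem 6 v)) ?_ ?_
  · obtain ⟨k1, k2, k3⟩ := key
    exact ⟨fun v => (k1 v).trans (by omega), fun v hv => k2 v (by omega),
      fun v => (k3 v).trans (by omega)⟩
  · simp [h7, h8]
  · intro i hiN τ hr hmm hi ⟨k1, k2, k3⟩
    have hr0 : τ.reg 0 = σ.reg 0 := hr 0 rfl (by decide)
    have hr5 : τ.reg 5 = σ.reg 5 := hr 5 rfl (by decide)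
    have hm3 := hmm 3 rfl
    have hm6 := hmm 6 rfl
    refine ⟨fun v => ?_, fun v hv => ?_, fun v => ?_⟩
    · have := k1 v
      simp [den, hi, hm3, hr0, Function.update_apply]
      grind
    · have := k2 v
      simp [den, hi, Function.update_apply]
      grind
    · have := k3 v
      simp [den, hi, hm6, hr0, hr5, Function.update_apply]
      grind

/-! ### Elimination of the forest -/

/-- When `reg 13` is `1`, register `14` describes the only remaining neighbour. -/
theorem scan_spec (σ : Store) (hm : σ.reg 1 ≤ σ.reg 2) :
    (scan.den σ).reg 13 = Peel.count (σ.reg 1) (σ.mem 0) (σ.mem 1) (σ.mem 7) (σ.reg 11) ∧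
    ((scan.den σ).reg 13 = 0 → (scan.den σ).reg 14 = 0) ∧
    ((scan.den σ).reg 13 ≠ 0 → ∃ e < σ.reg 1,
      (σ.mem 0 e = σ.reg 11 ∧ σ.mem 7 (σ.mem 1 e) ≠ 0 ∧
        (scan.den σ).reg 14 = σ.mem 1 e + 1) ∨
      (σ.mem 1 e = σ.reg 11 ∧ σ.mem 7 (σ.mem 0 e) ≠ 0 ∧
        (scan.den σ).reg 14 = σ.mem 0 e + 1)) := by
  have key := rep_rule (r := 12) (p := ite (R 1 - R 12) (block [
    ite (both (equals (M 0 (R 12)) (R 11)) (M 7 (M 1 (R 12))))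
      (block [setReg 13 (R 13 + 1), setReg 14 (M 1 (R 12) + 1)]) nop,
    ite (both (equals (M 1 (R 12)) (R 11)) (M 7 (M 0 (R 12))))
      (block [setReg 13 (R 13 + 1), setReg 14 (M 0 (R 12) + 1)]) nop]) nop)
    (σ := (setReg 14 0).den ((setReg 13 0).den σ))
    (fun k τ => τ.reg 13 =
        Peel.count (min k (σ.reg 1)) (σ.mem 0) (σ.mem 1) (σ.mem 7) (σ.reg 11) ∧
      (τ.reg 13 = 0 → τ.reg 14 = 0) ∧
      (τ.reg 13 ≠ 0 → ∃ e < σ.reg 1,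
        (σ.mem 0 e = σ.reg 11 ∧ σ.mem 7 (σ.mem 1 e) ≠ 0 ∧ τ.reg 14 = σ.mem 1 e + 1) ∨
        (σ.mem 1 e = σ.reg 11 ∧ σ.mem 7 (σ.mem 0 e) ≠ 0 ∧ τ.reg 14 = σ.mem 0 e + 1))) ?_ ?_
  · rw [show ((setReg 14 0).den ((setReg 13 0).den σ)).reg 2 = σ.reg 2 from rfl,
      min_eq_right hm] at key
    exact key
  · simp [den, Peel.count]
  · intro i _ τ hr hmm hi ⟨h1, h2, h3⟩
    have hr1 : τ.reg 1 = σ.reg 1 := hr 1 rfl (by decide)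
    have hr11 : τ.reg 11 = σ.reg 11 := hr 11 rfl (by decide)
    have hm0 : τ.mem 0 = σ.mem 0 := hmm 0 rfl
    have hm1 : τ.mem 1 = σ.mem 1 := hmm 1 rfl
    have hm7 : τ.mem 7 = σ.mem 7 := hmm 7 rfl
    clear hr hmm
    by_cases hlt : i < σ.reg 1
    · have hc : ¬ (σ.reg 1 - i = 0) := by omega
      have hcount : Peel.count (min (i + 1) (σ.reg 1)) (σ.mem 0) (σ.mem 1) (σ.mem 7) (σ.reg 11) =
          τ.reg 13 + ((if σ.mem 0 i = σ.reg 11 ∧ σ.mem 7 (σ.mem 1 i) ≠ 0 then 1 else 0) +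
            (if σ.mem 1 i = σ.reg 11 ∧ σ.mem 7 (σ.mem 0 i) ≠ 0 then 1 else 0)) := by
        rw [h1, min_eq_left (by omega), min_eq_left (by omega), Peel.count, Peel.count,
          Finset.sum_range_succ]
      rw [hcount]
      clear h1 hcount
      simp [den, hi, hm0, hm1, hm7, hr1, hr11, hc, apply_ite Store.mem, apply_ite Store.reg,
        ite_apply]
      grind
    · have hc : σ.reg 1 - i = 0 := by omega
      rw [min_eq_right (by omega)] at h1 ⊢
      simp only [den]
      rw [if_neg (by simp [hi, hr1, hc])]
      simpa using ⟨h1, h2, h3⟩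

theorem relabel_spec (σ : Store) : (relabel.den σ).mem 9 = fun u =>
    if u < σ.reg 2 ∧ σ.mem 9 u = σ.reg 11 then σ.reg 14 - 1 else σ.mem 9 u := by
  refine rep_rule (fun k τ => τ.mem 9 = fun u =>
    if u < k ∧ σ.mem 9 u = σ.reg 11 then σ.reg 14 - 1 else σ.mem 9 u) (by simp) ?_
  intro i _ τ hr hmm hi h
  have hr11 : τ.reg 11 = σ.reg 11 := hr 11 rfl (by decide)
  have hr14 : τ.reg 14 = σ.reg 14 := hr 14 rfl (by decide)
  clear hr hmm
  funext u
  simp [den, hi, hr11, hr14, h, apply_ite Store.mem, ite_apply, Function.update_apply]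
  grind

variable {n m N P : ℕ} {s d chi own : ℕ → ℕ}

/-- The state of the elimination, as it is held in the store. -/
structure PeelState (n m P : ℕ) (s d chi own : ℕ → ℕ) (τ : Store) : Prop where
  shape : Peel.Shape n m s d chi (τ.mem 7) (τ.mem 10)
  labelling : Peel.Labelling n P chi own (τ.mem 7) (τ.mem 10) (τ.mem 9) (τ.mem 6) (τ.mem 8)

/-- The part of the store that the elimination reads, but does not change. -/
structure PeelInput (n m N P : ℕ) (s d : ℕ → ℕ) (τ : Store) : Prop where
  reg1 : τ.reg 1 = m
  reg2 : τ.reg 2 = N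
  reg5 : τ.reg 5 = P
  mem0 : τ.mem 0 = s
  mem1 : τ.mem 1 = d
  n_le : n ≤ N
  m_le : m ≤ N

theorem eliminate_spec {τ : Store} (hin : PeelInput n m N P s d τ)
    (h : PeelState n m P s d chi own τ)
    (hl : Peel.Leaf m s d (τ.mem 7) (τ.reg 11) (τ.reg 14)) :
    PeelState n m P s d chi own (eliminate.den τ) ∧
    (eliminate.den τ).mem 7 = Function.update (τ.mem 7) (τ.reg 11) 0 := by
  obtain ⟨hs, hlab⟩ := h
  have hs' := hs.eliminate hl
  set v := τ.reg 11 with hv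
  set nb := τ.reg 14 with hnb
  have hcond : ∀ ρ : Store, ρ = ((setMem 10 (R 11) (R 14)).den ((setMem 7 (R 11) 0).den τ)) →
      ((both (R 14) (isZero (M 8 (R 11) + M 8 (R 14 - 1)))).eval ρ ≠ 0 ↔
        nb ≠ 0 ∧ τ.mem 8 v = 0 ∧ τ.mem 8 (nb - 1) = 0) := by
    rintro ρ rfl
    simp [den, ← hv, ← hnb]
  by_cases hsep : nb ≠ 0 ∧ τ.mem 8 v = 0 ∧ τ.mem 8 (nb - 1) = 0
  · obtain ⟨hnb0, hv8, hu8⟩ := hsep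
    obtain ⟨u, hu⟩ : ∃ u, nb = u + 1 := ⟨nb - 1, by omega⟩
    have hu1 : nb - 1 = u := by omega
    rw [hu1] at hu8
    by_cases hw : P < τ.mem 6 u + τ.mem 6 v
    · have hw' : τ.mem 6 u + τ.mem 6 v - P ≠ 0 := by omega
      have hcut := Peel.Labelling.of_eliminate_of_cut hs hlab (hu ▸ hl) hv8 hu8 hw
      have e7 : (eliminate.den τ).mem 7 = Function.update (τ.mem 7) v 0 := by
        simp [eliminate, den, ← hv, ← hnb, hu, hv8, hu8, hin.reg5, hw']
      have e10 : (eliminate.den τ).mem 10 = Function.update (τ.mem 10) v nb := by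
        simp [eliminate, den, ← hv, ← hnb, hu, hv8, hu8, hin.reg5, hw']
      have e8 : (eliminate.den τ).mem 8 = Function.update (τ.mem 8) u 1 := by
        simp [eliminate, den, ← hv, ← hnb, hu, hv8, hu8, hin.reg5, hw']
      have e9 : (eliminate.den τ).mem 9 = τ.mem 9 := by
        simp [eliminate, den, ← hv, ← hnb, hu, hv8, hu8, hin.reg5, hw']
      have e6 : (eliminate.den τ).mem 6 = τ.mem 6 := by
        simp [eliminate, den, ← hv, ← hnb, hu, hv8, hu8, hin.reg5, hw']
      refine ⟨⟨?_, ?_⟩, e7⟩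
      · rw [e7, e10]; exact hs'
      · rw [e7, e10, e9, e6, e8, hu]; exact hcut
    · have hw' : τ.mem 6 u + τ.mem 6 v - P = 0 := by omega
      set ρ := (setMem 6 (R 14 - 1) (M 6 (R 14 - 1) + M 6 (R 11))).den
        ((setMem 10 (R 11) (R 14)).den ((setMem 7 (R 11) 0).den τ)) with hρ
      have e : eliminate.den τ = relabel.den ρ := by
        simp [eliminate, den, ← hv, ← hnb, hu, hv8, hu8, hin.reg5, hw', hρ]
      have e7 : (eliminate.den τ).mem 7 = Function.update (τ.mem 7) v 0 := by
        rw [e, den_mem rfl]; simp [hρ, den, ← hv]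
      have e10 : (eliminate.den τ).mem 10 = Function.update (τ.mem 10) v nb := by
        rw [e, den_mem rfl]; simp [hρ, den, ← hv, ← hnb]
      have e8 : (eliminate.den τ).mem 8 = τ.mem 8 := by
        rw [e, den_mem rfl]; simp [hρ, den]
      have e6 : (eliminate.den τ).mem 6 =
          Function.update (τ.mem 6) u (τ.mem 6 u + τ.mem 6 v) := by
        rw [e, den_mem rfl]; simp [hρ, den, ← hv, ← hnb, hu]
      have e9 : ∀ x < n, (eliminate.den τ).mem 9 x = if τ.mem 9 x = v then u else τ.mem 9 x := by
        intro x hx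
        have hxN : x < τ.reg 2 := by have := hin.n_le; rw [hin.reg2]; omega
        rw [e, relabel_spec]
        simp [hρ, den, ← hv, ← hnb, hu, hxN]
      have hmerge := Peel.Labelling.of_eliminate_of_merge hs hlab (hu ▸ hl) hv8 hu8
        (not_lt.1 hw) e9
      refine ⟨⟨?_, ?_⟩, e7⟩
      · rw [e7, e10]; exact hs'
      · rw [e7, e10, e6, e8, hu]; exact hmerge
  · have e : eliminate.den τ = (setMem 10 (R 11) (R 14)).den ((setMem 7 (R 11) 0).den τ) := by
      simp only [eliminate, den_block_cons, den_block_nil]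
      exact if_neg ((hcond _ rfl).not.2 hsep)
    have e7 : (eliminate.den τ).mem 7 = Function.update (τ.mem 7) v 0 := by
      rw [e]; simp [den, ← hv]
    have e10 : (eliminate.den τ).mem 10 = Function.update (τ.mem 10) v nb := by
      rw [e]; simp [den, ← hv, ← hnb]
    have e8 : (eliminate.den τ).mem 8 = τ.mem 8 := by rw [e]; simp [den]
    have e9 : (eliminate.den τ).mem 9 = τ.mem 9 := by rw [e]; simp [den]
    have e6 : (eliminate.den τ).mem 6 = τ.mem 6 := by rw [e]; simp [den]
    refine ⟨⟨?_, ?_⟩, e7⟩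
    · rw [e7, e10]; exact hs'
    · rw [e7, e10, e9, e6, e8]
      refine hlab.of_eliminate_of_separated fun u hu => ?_
      by_contra hcon
      push Not at hcon
      exact hsep ⟨by omega, hcon.1, by rw [hu, Nat.add_sub_cancel]; exact hcon.2⟩

theorem visit_spec (hloop : ∀ e < m, s e < n → chi (s e) = 0 → s e ≠ d e)
    {τ : Store} (hin : PeelInput n m N P s d τ) (h : PeelState n m P s d chi own τ) :
    PeelState n m P s d chi own (visit.den τ) ∧
    (∀ u, (visit.den τ).mem 7 u ≠ 0 → τ.mem 7 u ≠ 0) ∧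
    (Peel.count m s d (τ.mem 7) (τ.reg 11) ≤ 1 → (visit.den τ).mem 7 (τ.reg 11) = 0) := by
  by_cases hal : τ.mem 7 (τ.reg 11) = 0
  · have e : visit.den τ = τ := by simp [visit, den, hal]
    rw [e]
    exact ⟨h, fun _ h => h, fun _ => hal⟩
  · have hsc := scan_spec τ (by rw [hin.reg1, hin.reg2]; exact hin.m_le)
    have hmem : ∀ a, (scan.den τ).mem a = τ.mem a := fun a => den_mem rfl τ
    have hr11 : (scan.den τ).reg 11 = τ.reg 11 := den_reg rfl τ
    have hin' : PeelInput n m N P s d (scan.den τ) :=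
      ⟨(den_reg rfl τ).trans hin.reg1, (den_reg rfl τ).trans hin.reg2,
        (den_reg rfl τ).trans hin.reg5, (hmem 0).trans hin.mem0, (hmem 1).trans hin.mem1,
        hin.n_le, hin.m_le⟩
    have h' : PeelState n m P s d chi own (scan.den τ) := by
      refine ⟨?_, ?_⟩
      · rw [hmem, hmem]; exact h.shape
      · rw [hmem, hmem, hmem, hmem, hmem]; exact h.labelling
    rw [hin.reg1, hin.mem0, hin.mem1] at hsc
    obtain ⟨h1, h2, h3⟩ := hsc
    by_cases hc : Peel.count m s d (τ.mem 7) (τ.reg 11) ≤ 1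
    · have hc' : (scan.den τ).reg 13 - 1 = 0 := by omega
      have e : visit.den τ = eliminate.den (scan.den τ) := by
        simp [visit, den, hal, hc']
      have hl : Peel.Leaf m s d ((scan.den τ).mem 7) ((scan.den τ).reg 11)
          ((scan.den τ).reg 14) := by
        rw [hmem, hr11]
        rw [h1] at h2 h3
        exact Peel.Leaf.of_count hal hc h.shape.al_lt hloop h2 h3
      obtain ⟨k1, k2⟩ := eliminate_spec hin' h' hl
      rw [e]
      refine ⟨k1, fun u hu => ?_, fun _ => ?_⟩
      · rw [k2, hmem, Function.update_apply] at hu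
        split_ifs at hu
        · exact absurd rfl hu
        · exact hu
      · rw [k2, hr11, Function.update_self]
    · have hc' : (scan.den τ).reg 13 - 1 ≠ 0 := by omega
      have e : visit.den τ = scan.den τ := by simp [visit, den, hal, hc']
      rw [e]
      exact ⟨h', fun u hu => by rwa [hmem] at hu, fun h => absurd h hc⟩

theorem count_mono {al al' : ℕ → ℕ} (h : ∀ u, al' u ≠ 0 → al u ≠ 0) (v : ℕ) :
    Peel.count m s d al' v ≤ Peel.count m s d al v := by
  refine Finset.sum_le_sum fun e _ => Nat.add_le_add ?_ ?_
  · have := h (d e); split_ifs <;> omega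
  · have := h (s e); split_ifs <;> omega

/-- Every round of the outer loop eliminates at least one leaf, so that `n` rounds suffice. -/
theorem peel_spec (hloop : ∀ e < m, s e < n → chi (s e) = 0 → s e ≠ d e)
    (hleaf : ∀ al : ℕ → ℕ, (∀ v, al v ≠ 0 → v < n ∧ chi v = 0) → (∃ v, al v ≠ 0) →
      ∃ v, al v ≠ 0 ∧ Peel.count m s d al v ≤ 1)
    {σ : Store} (hin : PeelInput n m N P s d σ) (h : PeelState n m P s d chi own σ) :
    PeelState n m P s d chi own (peel.den σ) ∧ ∀ v, (peel.den σ).mem 7 v = 0 := by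
  have key := rep_rule (r := 10) (p := rep 11 visit) (σ := σ)
    (fun k τ => PeelState n m P s d chi own τ ∧
      (((Finset.range n).filter fun v => τ.mem 7 v ≠ 0).card + k ≤ n ∨
        ∀ v, τ.mem 7 v = 0)) ?_ ?_
  · obtain ⟨k1, k2⟩ := key
    refine ⟨k1, ?_⟩
    rcases k2 with k2 | k2
    · intro v
      by_contra hv
      have hvn := (k1.shape.al_lt v hv).1
      have : 0 < ((Finset.range n).filter fun v => (peel.den σ).mem 7 v ≠ 0).card :=
        Finset.card_pos.2 ⟨v, Finset.mem_filter.2 ⟨Finset.mem_range.2 hvn, hv⟩⟩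
      have h1 := hin.n_le
      have h2 := hin.reg2
      change ((Finset.range n).filter fun v => (peel.den σ).mem 7 v ≠ 0).card + _ ≤ n at k2
      omega
    · exact k2
  · refine ⟨⟨h.shape, h.labelling⟩, .inl ?_⟩
    exact (Finset.card_filter_le _ _).trans (Finset.card_range n).le
  · intro i _ τ hr hmm hi ⟨h1, h2⟩
    have hin' : PeelInput n m N P s d τ :=
      ⟨(hr 1 rfl (by decide)).trans hin.reg1, (hr 2 rfl (by decide)).trans hin.reg2,
        (hr 5 rfl (by decide)).trans hin.reg5, (hmm 0 rfl).trans hin.mem0,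
        (hmm 1 rfl).trans hin.mem1, hin.n_le, hin.m_le⟩
    clear hr hmm
    have inner := rep_rule (r := 11) (p := visit) (σ := τ)
      (fun k ρ => PeelState n m P s d chi own ρ ∧ (∀ u, ρ.mem 7 u ≠ 0 → τ.mem 7 u ≠ 0) ∧
        ∀ v < k, Peel.count m s d (τ.mem 7) v ≤ 1 → ρ.mem 7 v = 0) ?_ ?_
    · obtain ⟨k1, k2, k3⟩ := inner
      refine ⟨⟨k1.shape, k1.labelling⟩, ?_⟩
      change ((Finset.range n).filter fun v => ((rep 11 visit).den τ).mem 7 v ≠ 0).card + (i + 1)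
        ≤ n ∨ ∀ v, ((rep 11 visit).den τ).mem 7 v = 0
      by_cases hne : ∃ v, τ.mem 7 v ≠ 0
      · obtain ⟨v, hv, hcv⟩ := hleaf _ h1.shape.al_lt hne
        have hvn := (h1.shape.al_lt v hv).1
        left
        have hlt : ((Finset.range n).filter fun v => ((rep 11 visit).den τ).mem 7 v ≠ 0).card <
            ((Finset.range n).filter fun v => τ.mem 7 v ≠ 0).card := by
          refine Finset.card_lt_card (Finset.ssubset_iff_of_subset (fun x => ?_) |>.2
            ⟨v, Finset.mem_filter.2 ⟨Finset.mem_range.2 hvn, hv⟩, ?_⟩)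
          · simp only [Finset.mem_filter]
            exact fun hx => ⟨hx.1, k2 x hx.2⟩
          · simp only [Finset.mem_filter, not_and, not_not]
            intro _
            exact k3 v (by have := hin'.n_le; rw [hin'.reg2]; omega) hcv
        rcases h2 with h2 | h2
        · omega
        · exact absurd (h2 v) hv
      · push Not at hne
        right
        intro v
        by_contra hv
        exact k2 v hv (hne v)
    · exact ⟨⟨h1.shape, h1.labelling⟩, fun _ h => h, fun v hv => absurd hv (by omega)⟩
    · intro j _ ρ hr hmm hj ⟨k1, k2, k3⟩
      have hin'' : PeelInput n m N P s d ρ :=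
        ⟨(hr 1 rfl (by decide)).trans hin'.reg1, (hr 2 rfl (by decide)).trans hin'.reg2,
          (hr 5 rfl (by decide)).trans hin'.reg5, (hmm 0 rfl).trans hin'.mem0,
          (hmm 1 rfl).trans hin'.mem1, hin.n_le, hin.m_le⟩
      obtain ⟨l1, l2, l3⟩ := visit_spec hloop hin'' k1
      rw [hj] at l3
      refine ⟨⟨l1.shape, l1.labelling⟩, fun u hu => k2 u (l2 u hu), fun v hv hcv => ?_⟩
      change (visit.den ρ).mem 7 v = 0
      rcases Nat.lt_succ_iff_lt_or_eq.1 hv with hv | rfl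
      · by_contra hcon
        exact l2 v hcon (k3 v hv hcv)
      · exact l3 ((count_mono k2 _).trans hcv)

/-! ### Colouring the items -/

/-- The item of the edge `e`, plus one, or zero if `e` belongs to no item. -/
def itemOf (n : ℕ) (s d chi S lab : ℕ → ℕ) (e : ℕ) : ℕ :=
  if chi (s e) ≠ 0 then
    if chi (d e) ≠ 0 then n + e + 1 else if S (d e) ≠ 0 then 0 else lab (d e) + 1
  else if chi (d e) ≠ 0 then
    if S (s e) ≠ 0 then 0 else lab (s e) + 1
  else 0

theorem items_spec (σ : Store) (h11 : σ.mem 11 = fun _ => 0) (hm : σ.reg 1 ≤ σ.reg 2) :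
    (items.den σ).mem 11 = fun e => if e < σ.reg 1 then
      itemOf (σ.reg 0) (σ.mem 0) (σ.mem 1) (σ.mem 3) (σ.mem 8) (σ.mem 9) e else 0 := by
  have key := rep_rule (r := 10) (p := ite (R 1 - R 10)
  (ite (M 3 (M 0 (R 10)))
    (ite (M 3 (M 1 (R 10)))
      (setMem 11 (R 10) (R 0 + R 10 + 1))
      (ite (M 8 (M 1 (R 10))) nop (setMem 11 (R 10) (M 9 (M 1 (R 10)) + 1))))
    (ite (M 3 (M 1 (R 10)))
      (ite (M 8 (M 0 (R 10))) nop (setMem 11 (R 10) (M 9 (M 0 (R 10)) + 1)))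
      nop)) nop) (σ := σ)
    (fun k τ => ∀ e, τ.mem 11 e = if e < σ.reg 1 ∧ e < k then
      itemOf (σ.reg 0) (σ.mem 0) (σ.mem 1) (σ.mem 3) (σ.mem 8) (σ.mem 9) e else 0) ?_ ?_
  · funext e
    refine (key e).trans (if_congr ?_ rfl rfl)
    omega
  · simp [h11]
  · intro i _ τ hr hmm hi h e
    have hr0 : τ.reg 0 = σ.reg 0 := hr 0 rfl (by decide)
    have hr1 : τ.reg 1 = σ.reg 1 := hr 1 rfl (by decide)
    have hm0 := hmm 0 rfl
    have hm1 := hmm 1 rfl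
    have hm3 := hmm 3 rfl
    have hm8 := hmm 8 rfl
    have hm9 := hmm 9 rfl
    clear hr hmm
    have he := h e
    have hii := h i
    clear h
    by_cases hlt : i < σ.reg 1
    · have hc : ¬ (σ.reg 1 - i = 0) := by omega
      simp [den, hi, hm0, hm1, hm3, hm8, hm9, hr0, hr1, hc, apply_ite Store.mem, ite_apply,
        Function.update_apply, itemOf] at he hii ⊢
      by_cases hei : e = i
      · subst hei
        simp [hlt, hii]
      · have : e ≤ i ↔ e < i := by omega
        simp [hei, he, this]
    · have hc : σ.reg 1 - i = 0 := by omega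
      simp [den, hi, hr1, hc, he]
      have : e < σ.reg 1 → (e < i ↔ e < i + 1) := by omega
      grind

/-- Item `j` has an edge with the end `v`. -/
def Involves (N : ℕ) (s d el : ℕ → ℕ) (j v : ℕ) : Prop :=
  ∃ e < N, el e = j + 1 ∧ (s e = v ∨ d e = v)

theorem mark_spec (σ : Store) : ∀ v < σ.reg 2, (mark.den σ).mem 14 v ≠ 0 ↔
    Involves (σ.reg 2) (σ.mem 0) (σ.mem 1) (σ.mem 11) (σ.reg 10) v := by
  set ρ := (rep 11 (setMem 14 (R 11) 0)).den σ with hρ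
  have hρ14 : ∀ v < σ.reg 2, ρ.mem 14 v = 0 := by
    refine rep_rule (fun k τ => ∀ v < k, τ.mem 14 v = 0) (by simp) ?_
    intro i _ τ _ _ hi h v hv
    have := h v
    simp [den, hi, Function.update_apply]
    omega
  have hreg : ρ.reg 2 = σ.reg 2 ∧ ρ.reg 10 = σ.reg 10 := ⟨den_reg rfl σ, den_reg rfl σ⟩
  have hmem : ρ.mem 0 = σ.mem 0 ∧ ρ.mem 1 = σ.mem 1 ∧ ρ.mem 11 = σ.mem 11 :=
    ⟨den_mem rfl σ, den_mem rfl σ, den_mem rfl σ⟩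
  rw [← hreg.1] at hρ14 ⊢
  refine rep_rule (r := 11) (p := ite (equals (M 11 (R 11)) (R 10 + 1)) (block [
    setMem 14 (M 0 (R 11)) 1,
    setMem 14 (M 1 (R 11)) 1]) nop) (σ := ρ)
    (fun k τ => ∀ v < ρ.reg 2, τ.mem 14 v ≠ 0 ↔
      Involves k (σ.mem 0) (σ.mem 1) (σ.mem 11) (σ.reg 10) v) ?_ ?_
  · intro v hv
    simp [hρ14 v hv, Involves]
  · intro i _ τ hr hmm hi h v hv
    have hr10 : τ.reg 10 = σ.reg 10 := (hr 10 rfl (by decide)).trans hreg.2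
    have hm0 := (hmm 0 rfl).trans hmem.1
    have hm1 := (hmm 1 rfl).trans hmem.2.1
    have hm11 := (hmm 11 rfl).trans hmem.2.2
    have hstep : Involves (i + 1) (σ.mem 0) (σ.mem 1) (σ.mem 11) (σ.reg 10) v ↔
        (Involves i (σ.mem 0) (σ.mem 1) (σ.mem 11) (σ.reg 10) v ∨
          σ.mem 11 i = σ.reg 10 + 1 ∧ (σ.mem 0 i = v ∨ σ.mem 1 i = v)) := by
      simp only [Involves, Nat.lt_succ_iff_lt_or_eq]
      constructor
      · rintro ⟨e, he | rfl, h1, h2⟩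
        exacts [.inl ⟨e, he, h1, h2⟩, .inr ⟨h1, h2⟩]
      · rintro (⟨e, he, h1, h2⟩ | ⟨h1, h2⟩)
        exacts [⟨e, .inl he, h1, h2⟩, ⟨i, .inr rfl, h1, h2⟩]
    rw [hstep, ← h v hv]
    clear hstep hr hmm h
    simp [den, hi, hm0, hm1, hm11, hr10, apply_ite Store.mem, ite_apply, Function.update_apply]
    grind

theorem sums_spec (σ : Store) :
    (sums.den σ).reg 15 = ∑ v ∈ Finset.range (σ.reg 2) with σ.mem 14 v ≠ 0, σ.mem 12 v ∧
    (sums.den σ).reg 16 = ∑ v ∈ Finset.range (σ.reg 2) with σ.mem 14 v ≠ 0, σ.mem 13 v := by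
  refine rep_rule (r := 11) (p := ite (M 14 (R 11)) (block [
    setReg 15 (R 15 + M 12 (R 11)),
    setReg 16 (R 16 + M 13 (R 11))]) nop) (σ := (setReg 16 0).den ((setReg 15 0).den σ))
    (fun k τ => τ.reg 15 = ∑ v ∈ Finset.range k with σ.mem 14 v ≠ 0, σ.mem 12 v ∧
      τ.reg 16 = ∑ v ∈ Finset.range k with σ.mem 14 v ≠ 0, σ.mem 13 v) ?_ ?_
  · simp [den]
  · intro i _ τ hr hmm hi ⟨h1, h2⟩
    have hm12 : τ.mem 12 = σ.mem 12 := hmm 12 rfl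
    have hm13 : τ.mem 13 = σ.mem 13 := hmm 13 rfl
    have hm14 : τ.mem 14 = σ.mem 14 := hmm 14 rfl
    rw [Finset.range_add_one, Finset.filter_insert]
    by_cases hc : σ.mem 14 i = 0
    · simp [den, hi, hm14, hc, h1, h2]
    · simp [den, hi, hm12, hm13, hm14, hc, h1, h2, add_comm]

/-- Products are computed by repeated addition, which is complete as the sums `reg 15` and `reg 16`
do not exceed the loop bound. -/
theorem products_spec (σ : Store) (hx : σ.reg 15 ≤ σ.reg 2) (hy : σ.reg 16 ≤ σ.reg 2) :
    (products.den σ).reg 17 = σ.reg 8 * σ.reg 15 + σ.reg 7 * σ.reg 16 ∧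
    (products.den σ).reg 18 = σ.reg 9 * σ.reg 16 + σ.reg 7 * σ.reg 15 := by
  have key := rep_rule (r := 11) (p := block [
    ite (R 15 - R 11) (block [setReg 17 (R 17 + R 8), setReg 18 (R 18 + R 7)]) nop,
    ite (R 16 - R 11) (block [setReg 17 (R 17 + R 7), setReg 18 (R 18 + R 9)]) nop])
    (σ := (setReg 18 0).den ((setReg 17 0).den σ))
    (fun k τ => τ.reg 17 = σ.reg 8 * min k (σ.reg 15) + σ.reg 7 * min k (σ.reg 16) ∧
      τ.reg 18 = σ.reg 9 * min k (σ.reg 16) + σ.reg 7 * min k (σ.reg 15)) ?_ ?_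
  · rw [show ((setReg 18 0).den ((setReg 17 0).den σ)).reg 2 = σ.reg 2 from rfl,
      min_eq_right hx, min_eq_right hy] at key
    exact key
  · simp [den]
  · intro i _ τ hr hmm hi ⟨h1, h2⟩
    have hr15 : τ.reg 15 = σ.reg 15 := hr 15 rfl (by decide)
    have hr16 : τ.reg 16 = σ.reg 16 := hr 16 rfl (by decide)
    have hr7 : τ.reg 7 = σ.reg 7 := hr 7 rfl (by decide)
    have hr8 : τ.reg 8 = σ.reg 8 := hr 8 rfl (by decide)
    have hr9 : τ.reg 9 = σ.reg 9 := hr 9 rfl (by decide)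
    have hmin : ∀ x, min (i + 1) x = min i x + if x - i = 0 then 0 else 1 := by
      intro x; split_ifs <;> omega
    rw [hmin, hmin]
    simp [den, hi, hr15, hr16, hr7, hr8, hr9, apply_ite Store.reg, ite_apply]
    rw [h1, h2]
    split_ifs <;> constructor <;> ring

theorem transfer_spec {a b : ℕ} (hab : a ≠ b) (ha : a ≠ 14) (hb : b ≠ 14) (σ : Store) (v : ℕ) :
    ((transfer a b).den σ).mem a v =
      (if v < σ.reg 2 ∧ σ.mem 14 v ≠ 0 then σ.mem a v + σ.mem a v else σ.mem a v) ∧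
    ((transfer a b).den σ).mem b v =
      (if v < σ.reg 2 ∧ σ.mem 14 v ≠ 0 then 0 else σ.mem b v) := by
  revert v
  refine rep_rule (r := 11) (p := ite (M 14 (R 11)) (block [
    setMem a (R 11) (M a (R 11) + M a (R 11)),
    setMem b (R 11) 0]) nop) (σ := σ)
    (fun k τ => ∀ v, τ.mem a v =
        (if v < k ∧ σ.mem 14 v ≠ 0 then σ.mem a v + σ.mem a v else σ.mem a v) ∧
      τ.mem b v = (if v < k ∧ σ.mem 14 v ≠ 0 then 0 else σ.mem b v)) (by simp) ?_
  intro i _ τ hr hmm hi h v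
  have hm14 : τ.mem 14 = σ.mem 14 := hmm 14 (by
    have h1 : Nat.beq 14 a = false :=
      Bool.eq_false_iff.2 fun h => ha (Nat.eq_of_beq_eq_true h).symm
    have h2 : Nat.beq 14 b = false :=
      Bool.eq_false_iff.2 fun h => hb (Nat.eq_of_beq_eq_true h).symm
    simp [wa, block, h1, h2])
  have h1 := h v
  have h2 := h i
  clear h hr hmm
  simp [den, hi, hm14, apply_ite Store.mem, ite_apply, Function.update_apply, hab, hab.symm]
  grind

/-- The program performs the greedy colouring. The assumption `hsizeN` ensures that the weights of
the vertices of an item add up to at most the loop bound, as `products_spec` requires. -/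
theorem greedy_spec {N L : ℕ} {s d el W deg : ℕ → ℕ} {σ : Store}
    (hN : σ.reg 2 = N) (h0 : σ.mem 0 = s) (h1 : σ.mem 1 = d) (h11 : σ.mem 11 = el)
    (h12 : σ.mem 12 = W) (h13 : σ.mem 13 = W) (h15 : σ.mem 15 = fun _ => 0)
    (h7 : σ.reg 7 = ∑ v ∈ Finset.range N, W v)
    (hW : ∀ v, W v * 2 ^ deg v ≤ 2 ^ L)
    (hlt : ∀ j v, Involves N s d el j v → v < N)
    (hseen : ∀ v, W v ≠ 0 → ∀ j, Balance.seen (Involves N s d el) j v ≤ deg v)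
    (hsize : ∀ j, Balance.size N W (Involves N s d el) j ≤ max (2 ^ L) 2)
    (hsizeN : ∀ j, 2 ^ L * Balance.size N W (Involves N s d el) j ≤ N) :
    Balance.State N L W deg (Involves N s d el) (σ.reg 7) N
      (fun i => (greedy.den σ).mem 15 i = 0) (fun i => (greedy.den σ).mem 15 i ≠ 0)
      ((greedy.den σ).mem 12) ((greedy.den σ).mem 13)
      ((greedy.den σ).reg 8) ((greedy.den σ).reg 9) ∧
    ∀ j, (greedy.den σ).mem 15 j ≤ 1 := by
  classical
  have key := rep_rule (r := 10) (p := block [mark, sums, products, colour])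
    (σ := (setReg 9 (R 7)).den ((setReg 8 (R 7)).den σ))
    (fun k τ => Balance.State N L W deg (Involves N s d el) (σ.reg 7) k
      (fun i => τ.mem 15 i = 0) (fun i => τ.mem 15 i ≠ 0) (τ.mem 12) (τ.mem 13)
      (τ.reg 8) (τ.reg 9) ∧ (∀ j, τ.mem 15 j ≤ 1) ∧ ∀ j ≥ k, τ.mem 15 j = 0) ?_ ?_
  · rw [show ((setReg 9 (R 7)).den ((setReg 8 (R 7)).den σ)).reg 2 = σ.reg 2 from rfl, hN] at key
    exact ⟨key.1, key.2.1⟩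
  · refine ⟨?_, by simp [den, h15], by simp [den, h15]⟩
    have := Balance.State.start (n := N) (adj := Involves N s d el) (E₀ := σ.reg 7)
      (QA := fun i => σ.mem 15 i = 0) (QB := fun i => σ.mem 15 i ≠ 0) hW h7
    simpa [den, h12, h13] using this
  · intro i hiN τ hr hmm hi ⟨hst, hle, hz⟩
    have t2 : τ.reg 2 = N := (hr 2 rfl (by decide)).trans hN
    have t7 : τ.reg 7 = σ.reg 7 := hr 7 rfl (by decide)
    have tm0 : τ.mem 0 = s := (hmm 0 rfl).trans h0
    have tm1 : τ.mem 1 = d := (hmm 1 rfl).trans h1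
    have tm11 : τ.mem 11 = el := (hmm 11 rfl).trans h11
    clear hr hmm
    -- the store before the colour is chosen
    set ρ := products.den (sums.den (mark.den τ)) with hρ
    have r2 : ρ.reg 2 = N := by
      rw [hρ, den_reg rfl, den_reg rfl, den_reg rfl, t2]
    have r10 : ρ.reg 10 = i := by
      rw [hρ, den_reg rfl, den_reg rfl, den_reg rfl, hi]
    have r8 : ρ.reg 8 = τ.reg 8 := by rw [hρ, den_reg rfl, den_reg rfl, den_reg rfl]
    have r9 : ρ.reg 9 = τ.reg 9 := by rw [hρ, den_reg rfl, den_reg rfl, den_reg rfl]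
    have m12 : ρ.mem 12 = τ.mem 12 := by rw [hρ, den_mem rfl, den_mem rfl, den_mem rfl]
    have m13 : ρ.mem 13 = τ.mem 13 := by rw [hρ, den_mem rfl, den_mem rfl, den_mem rfl]
    have m15 : ρ.mem 15 = τ.mem 15 := by rw [hρ, den_mem rfl, den_mem rfl, den_mem rfl]
    have hmark : ∀ v < N, (mark.den τ).mem 14 v ≠ 0 ↔ Involves N s d el i v := by
      have := mark_spec τ
      rwa [t2, tm0, tm1, tm11, hi] at this
    have m14 : ∀ v, (v < N ∧ ρ.mem 14 v ≠ 0) ↔ Involves N s d el i v := by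
      intro v
      rw [hρ, den_mem rfl, den_mem rfl]
      exact ⟨fun h => (hmark v h.1).1 h.2, fun h => ⟨hlt i v h, (hmark v (hlt i v h)).2 h⟩⟩
    have hfilter : ((Finset.range N).filter fun v => (mark.den τ).mem 14 v ≠ 0) =
        (Finset.range N).filter fun v => Involves N s d el i v := by
      refine Finset.filter_congr fun v hv => hmark v (Finset.mem_range.1 hv)
    have hs15 : (sums.den (mark.den τ)).reg 15 =
        ∑ v ∈ Finset.range N with Involves N s d el i v, τ.mem 12 v := by
      rw [(sums_spec _).1, den_reg rfl, t2, hfilter, den_mem rfl]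
    have hs16 : (sums.den (mark.den τ)).reg 16 =
        ∑ v ∈ Finset.range N with Involves N s d el i v, τ.mem 13 v := by
      rw [(sums_spec _).2, den_reg rfl, t2, hfilter, den_mem rfl]
    have hseen' : ∀ v, W v ≠ 0 → Balance.seen (Involves N s d el) i v ≤ deg v :=
      fun v hv => hseen v hv i
    have hx := (hst.sum_le hseen' i).trans (hsizeN i)
    have hy := (hst.swap.sum_le hseen' i).trans (hsizeN i)
    have hp := products_spec (sums.den (mark.den τ))
      (by rw [hs15, den_reg rfl, den_reg rfl, t2]; exact hx)
      (by rw [hs16, den_reg rfl, den_reg rfl, t2]; exact hy)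
    have b7 : (sums.den (mark.den τ)).reg 7 = σ.reg 7 := by rw [den_reg rfl, den_reg rfl, t7]
    have b8 : (sums.den (mark.den τ)).reg 8 = τ.reg 8 := by rw [den_reg rfl, den_reg rfl]
    have b9 : (sums.den (mark.den τ)).reg 9 = τ.reg 9 := by rw [den_reg rfl, den_reg rfl]
    rw [hs15, hs16, b7, b8, b9, ← hρ] at hp
    have r15 : ρ.reg 15 = ∑ v ∈ Finset.range N with Involves N s d el i v, τ.mem 12 v := by
      rw [hρ, den_reg rfl, hs15]
    have r16 : ρ.reg 16 = ∑ v ∈ Finset.range N with Involves N s d el i v, τ.mem 13 v := by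
      rw [hρ, den_reg rfl, hs16]
    set x := ∑ v ∈ Finset.range N with Involves N s d el i v, τ.mem 12 v with hxdef
    set y := ∑ v ∈ Finset.range N with Involves N s d el i v, τ.mem 13 v with hydef
    change Balance.State _ _ _ _ _ _ _ (fun j => (colour.den ρ).mem 15 j = 0)
      (fun j => (colour.den ρ).mem 15 j ≠ 0) ((colour.den ρ).mem 12) ((colour.den ρ).mem 13)
      ((colour.den ρ).reg 8) ((colour.den ρ).reg 9) ∧ (∀ j, (colour.den ρ).mem 15 j ≤ 1) ∧
      ∀ j ≥ i + 1, (colour.den ρ).mem 15 j = 0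
    have hif : ∀ v (p q : ℕ), (if v < N ∧ ρ.mem 14 v ≠ 0 then p else q) =
        if Involves N s d el i v then p else q := fun v p q => if_congr (m14 v) rfl rfl
    by_cases hc : ρ.reg 17 - ρ.reg 18 = 0
    · set ρ' := (setReg 9 (R 9 - R 16)).den ((setReg 8 (R 8 + R 15)).den ρ) with hρ'
      have e : colour.den ρ = (transfer 12 13).den ρ' := by
        simp [colour, den, hc, hρ']
      have e15 : (colour.den ρ).mem 15 = τ.mem 15 := by
        rw [e, den_mem rfl]; exact m15
      have e8 : (colour.den ρ).reg 8 = τ.reg 8 + x := by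
        rw [e, den_reg rfl]; simp [hρ', den, r8, r15]
      have e9 : (colour.den ρ).reg 9 = τ.reg 9 - y := by
        rw [e, den_reg rfl]; simp [hρ', den, r9, r16]
      have etr := transfer_spec (a := 12) (b := 13) (by decide) (by decide) (by decide) ρ'
      rw [← e, show ρ'.reg 2 = N from r2, show ρ'.mem 14 = ρ.mem 14 from rfl,
        show ρ'.mem 12 = τ.mem 12 from m12, show ρ'.mem 13 = τ.mem 13 from m13] at etr
      rw [e8, e9, e15]
      refine ⟨hst.step hseen' (hsize i) (fun v => ?_) (fun v => ?_) rfl rfl (fun _ _ h => h)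
        (fun _ _ h => h) (fun h => h (hz i le_rfl)) ?_, hle, fun j hj => hz j (by omega)⟩
      · rw [(etr v).1]; exact hif _ _ _
      · rw [(etr v).2]; exact hif _ _ _
      · have := hp.1
        have := hp.2
        change τ.reg 8 * x + σ.reg 7 * y ≤ τ.reg 9 * y + σ.reg 7 * x
        omega
    · set ρ' := (setReg 9 (R 9 + R 16)).den ((setReg 8 (R 8 - R 15)).den
        ((setMem 15 (R 10) 1).den ρ)) with hρ'
      have e : colour.den ρ = (transfer 13 12).den ρ' := by
        simp [colour, den, hc, hρ']
      have e15 : (colour.den ρ).mem 15 = Function.update (τ.mem 15) i 1 := by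
        rw [e, den_mem rfl]; simp [hρ', den, r10, m15]
      have e8 : (colour.den ρ).reg 8 = τ.reg 8 - x := by
        rw [e, den_reg rfl]; simp [hρ', den, r8, r15]
      have e9 : (colour.den ρ).reg 9 = τ.reg 9 + y := by
        rw [e, den_reg rfl]; simp [hρ', den, r9, r16]
      have etr := transfer_spec (a := 13) (b := 12) (by decide) (by decide) (by decide) ρ'
      rw [← e, show ρ'.reg 2 = N from r2, show ρ'.mem 14 = ρ.mem 14 from rfl,
        show ρ'.mem 12 = τ.mem 12 from m12, show ρ'.mem 13 = τ.mem 13 from m13] at etr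
      rw [e8, e9, e15]
      have hne : ∀ j, j < i → Function.update (τ.mem 15) i 1 j = τ.mem 15 j :=
        fun j hj => Function.update_of_ne hj.ne _ _
      refine ⟨(hst.swap.step hseen' (hsize i) (fun v => ?_) (fun v => ?_) rfl rfl
        (fun j hj h => ?_) (fun j hj h => ?_) (fun h => ?_) ?_).swap, fun j => ?_, fun j hj => ?_⟩
      · rw [(etr v).1]; exact hif _ _ _
      · rw [(etr v).2]; exact hif _ _ _
      · rwa [hne j hj] at h
      · rwa [hne j hj] at h
      · simp at h
      · have := hp.1
        have := hp.2
        change τ.reg 9 * y + σ.reg 7 * x ≤ τ.reg 8 * x + σ.reg 7 * y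
        omega
      · have := hle j
        rw [Function.update_apply]; split_ifs <;> omega
      · rw [Function.update_of_ne (by omega)]; exact hz j (by omega)

/-! ### The output -/

theorem kinds_spec (σ : Store) (h16 : σ.mem 16 = fun _ => 0) (hn : σ.reg 0 ≤ σ.reg 2) :
    (∀ v, (kinds.den σ).mem 10 v =
      if v < σ.reg 0 ∧ ¬ (σ.mem 3 v = 0 ∧ σ.mem 8 v = 0) then 0 else σ.mem 10 v) ∧
    (∀ v, (kinds.den σ).mem 16 v = if v = σ.reg 0 + 1 then 2 else if v = σ.reg 0 then 1 else
      if v < σ.reg 0 ∧ σ.mem 3 v = 0 ∧ σ.mem 8 v = 0 then σ.mem 15 (σ.mem 9 v) + 1 else 0) := by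
  have key := rep_rule (σ := σ) (r := 10) (p := ite (R 0 - R 10) (ite (M 3 (R 10) + M 8 (R 10))
    (setMem 10 (R 10) 0) (setMem 16 (R 10) (M 15 (M 9 (R 10)) + 1))) nop)
    (fun k τ => (∀ v, τ.mem 10 v =
      if (v < σ.reg 0 ∧ v < k) ∧ ¬ (σ.mem 3 v = 0 ∧ σ.mem 8 v = 0) then 0 else σ.mem 10 v) ∧
      (∀ v, τ.mem 16 v = if (v < σ.reg 0 ∧ v < k) ∧ σ.mem 3 v = 0 ∧ σ.mem 8 v = 0 then
        σ.mem 15 (σ.mem 9 v) + 1 else 0)) (by simp [h16]) ?_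
  · obtain ⟨k1, k2⟩ := key
    have hlt : ∀ v, (v < σ.reg 0 ∧ v < σ.reg 2) ↔ v < σ.reg 0 := by intro v; omega
    simp only [hlt] at k1 k2
    have hr0 : (vertexKinds.den σ).reg 0 = σ.reg 0 := den_reg rfl σ
    simp only [kinds, den_block_cons, den_block_nil]
    change ∀ v, (vertexKinds.den σ).mem 10 v = _ at k1
    change ∀ v, (vertexKinds.den σ).mem 16 v = _ at k2
    generalize vertexKinds.den σ = ρ at hr0 k1 k2 ⊢
    refine ⟨fun v => ?_, fun v => ?_⟩
    · rw [← k1]; simp [den]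
    · rw [← k2]; simp [den, hr0, Function.update_apply]
  · intro i _ τ hr hmm hi ⟨h1, h2⟩
    have hr0 : τ.reg 0 = σ.reg 0 := hr 0 rfl (by decide)
    have hm3 := hmm 3 rfl
    have hm8 := hmm 8 rfl
    have hm9 := hmm 9 rfl
    have hm15 := hmm 15 rfl
    clear hr hmm
    refine ⟨fun v => ?_, fun v => ?_⟩
    · have := h1 v
      clear h1 h2
      simp [den, hi, hm3, hm8, hr0, apply_ite Store.mem, ite_apply,
        Function.update_apply]
      grind
    · have := h2 v
      clear h1 h2
      simp [den, hi, hm3, hm8, hm9, hm15, hr0, apply_ite Store.mem, ite_apply,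
        Function.update_apply]
      grind

/-- The parent of the node `v` of the tree of the decomposition. The nodes `n` and `n + 1` are the
two hubs, and `n + 1` is the root. -/
def treeParent (n : ℕ) (chi S par kind wB : ℕ → ℕ) (v : ℕ) : ℕ :=
  if v = n then n + 1
  else if chi v ≠ 0 then (if wB v ≠ 0 then n + 1 else n)
  else if par v ≠ 0 ∧ S (par v - 1) = 0 then par v - 1 else n + (kind v - 1)

theorem edges_spec (σ : Store) (hn : σ.reg 0 ≤ σ.reg 2) :
    ∀ v ≤ σ.reg 0, (edges.den σ).mem 0 v = v ∧ (edges.den σ).mem 1 v =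
      treeParent (σ.reg 0) (σ.mem 3) (σ.mem 8) (σ.mem 10) (σ.mem 16) (σ.mem 13) v := by
  have key := rep_rule (σ := σ) (r := 10) (p := ite (R 0 - R 10) (block [
    setMem 0 (R 10) (R 10),
    ite (M 3 (R 10))
      (ite (M 13 (R 10)) (setMem 1 (R 10) (R 0 + 1)) (setMem 1 (R 10) (R 0)))
      (ite (both (M 10 (R 10)) (isZero (M 8 (M 10 (R 10) - 1))))
        (setMem 1 (R 10) (M 10 (R 10) - 1))
        (setMem 1 (R 10) (R 0 + (M 16 (R 10) - 1))))]) nop)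
    (fun k τ => ∀ v < σ.reg 0, v < k → τ.mem 0 v = v ∧ τ.mem 1 v =
      treeParent (σ.reg 0) (σ.mem 3) (σ.mem 8) (σ.mem 10) (σ.mem 16) (σ.mem 13) v)
      (by simp) ?_
  · intro v hv
    have hr0 : (vertexEdges.den σ).reg 0 = σ.reg 0 := den_reg rfl σ
    simp only [edges, den_block_cons, den_block_nil]
    change ∀ v < σ.reg 0, v < σ.reg 2 → (vertexEdges.den σ).mem 0 v = v ∧
      (vertexEdges.den σ).mem 1 v = _ at key
    generalize vertexEdges.den σ = ρ at hr0 key ⊢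
    rcases Nat.lt_or_eq_of_le hv with hv' | rfl
    · have := key v hv' (by omega)
      simpa [den, hr0, Function.update_apply, hv'.ne] using this
    · simp [den, hr0, treeParent]
  · intro i _ τ hr hmm hi h v hv hvi
    have hr0 : τ.reg 0 = σ.reg 0 := hr 0 rfl (by decide)
    have hm3 := hmm 3 rfl
    have hm8 := hmm 8 rfl
    have hm10 := hmm 10 rfl
    have hm13 := hmm 13 rfl
    have hm16 := hmm 16 rfl
    have h1 := h v hv
    clear hr hmm h
    by_cases hvi' : v = i
    · subst hvi'
      have hc : ¬ (σ.reg 0 - v = 0) := by omega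
      simp [den, hi, hm3, hm8, hm10, hm13, hm16, hr0, hc, hv.ne, apply_ite Store.mem, ite_apply,
        treeParent]
    · have h2 := h1 (by omega)
      rw [← h2.2]
      simp [den, hi, apply_ite Store.mem, ite_apply, hvi', h2.1]

/-- The relation between the nodes `i` of the tree and the vertices `v` in their bags. -/
def InBag (chi S par kind wA wB : ℕ → ℕ) (i v : ℕ) : Prop :=
  S v ≠ 0 ∨ v = i ∨ par i = v + 1 ∨ (chi v ≠ 0 ∧ kind i = 1 ∧ wB v = 0) ∨
    (chi v ≠ 0 ∧ kind i = 2 ∧ wA v = 0)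

theorem inBag_eval (τ : Store) : inBag.eval τ ≠ 0 ↔
    InBag (τ.mem 3) (τ.mem 8) (τ.mem 10) (τ.mem 16) (τ.mem 12) (τ.mem 13)
      (τ.reg 10) (τ.reg 11) := by
  simp only [inBag, InBag, eval_add, eval_M, eval_both, eval_equals, eval_isZero, eval_R,
    eval_ofNat]
  grind

/-- The matrix is written row by row, and register `19` holds the next index. -/
theorem matrix_spec (σ : Store) (h19 : σ.reg 19 = 0) (hn : σ.reg 0 + 2 ≤ σ.reg 2) :
    ∀ i < σ.reg 0 + 2, ∀ v < σ.reg 0, (matrix.den σ).mem 2 (i * σ.reg 0 + v) ≠ 0 ↔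
      InBag (σ.mem 3) (σ.mem 8) (σ.mem 10) (σ.mem 16) (σ.mem 12) (σ.mem 13) i v := by
  have key := rep_rule (r := 10) (p := ite (R 0 + 2 - R 10)
    (rep 11 (ite (R 0 - R 11) (block [setMem 2 (R 19) inBag, setReg 19 (R 19 + 1)]) nop)) nop)
    (σ := σ)
    (fun k τ => (k ≤ σ.reg 0 + 2 → τ.reg 19 = k * σ.reg 0) ∧
      ∀ i < σ.reg 0 + 2, i < k → ∀ v < σ.reg 0, τ.mem 2 (i * σ.reg 0 + v) ≠ 0 ↔
      InBag (σ.mem 3) (σ.mem 8) (σ.mem 10) (σ.mem 16) (σ.mem 12) (σ.mem 13) i v)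
      (by simp [h19]) ?_
  · intro i hi
    exact key.2 i hi (by omega)
  · intro i _ τ hr hmm hi ⟨h1, h2⟩
    have t0 : τ.reg 0 = σ.reg 0 := hr 0 rfl (by decide)
    have t2 : τ.reg 2 = σ.reg 2 := hr 2 rfl (by decide)
    have t3 := hmm 3 rfl
    have t8 := hmm 8 rfl
    have t10 := hmm 10 rfl
    have t12 := hmm 12 rfl
    have t13 := hmm 13 rfl
    have t16 := hmm 16 rfl
    clear hr hmm
    by_cases hlt : i < σ.reg 0 + 2
    · have hc : (R 0 + 2 - R 10).eval τ ≠ 0 := by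
        simp [t0, hi]; omega
      have e : (ite (R 0 + 2 - R 10)
        (rep 11 (ite (R 0 - R 11) (block [setMem 2 (R 19) inBag, setReg 19 (R 19 + 1)]) nop))
          nop).den τ = (rep 11 (ite (R 0 - R 11)
            (block [setMem 2 (R 19) inBag, setReg 19 (R 19 + 1)]) nop)).den τ := if_pos hc
      rw [e]
      have h1' := h1 (by omega)
      have inner := rep_rule (r := 11) (p := ite (R 0 - R 11)
        (block [setMem 2 (R 19) inBag, setReg 19 (R 19 + 1)]) nop) (σ := τ)
        (fun k ρ => ρ.reg 19 = i * σ.reg 0 + min k (σ.reg 0) ∧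
          (∀ x < i * σ.reg 0, ρ.mem 2 x = τ.mem 2 x) ∧
          ∀ v < min k (σ.reg 0), ρ.mem 2 (i * σ.reg 0 + v) ≠ 0 ↔
          InBag (σ.mem 3) (σ.mem 8) (σ.mem 10) (σ.mem 16) (σ.mem 12) (σ.mem 13) i v)
          (by simp [h1']) ?_
      · obtain ⟨k1, k2, k3⟩ := inner
        rw [t2, min_eq_right (by omega)] at k1 k3
        refine ⟨fun _ => ?_, fun j hj hji v hv => ?_⟩
        · simp only [Store.setReg_reg]
          rw [if_neg (by decide), k1]; ring
        · simp only [Store.setReg_mem]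
          rcases Nat.lt_succ_iff_lt_or_eq.1 hji with hji | rfl
          · rw [k2 _ ?_]
            · exact h2 j hj hji v hv
            · calc j * σ.reg 0 + v < (j + 1) * σ.reg 0 := by rw [add_mul]; omega
                _ ≤ i * σ.reg 0 := Nat.mul_le_mul_right _ hji
          · exact k3 v hv
      · intro j _ ρ hr hmm hj ⟨k1, k2, k3⟩
        have r0 : ρ.reg 0 = σ.reg 0 := (hr 0 rfl (by decide)).trans t0
        have r10 : ρ.reg 10 = i := (hr 10 rfl (by decide)).trans hi
        have hbag := inBag_eval ρ
        rw [(hmm 3 rfl).trans t3, (hmm 8 rfl).trans t8, (hmm 10 rfl).trans t10,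
          (hmm 12 rfl).trans t12, (hmm 13 rfl).trans t13, (hmm 16 rfl).trans t16, r10, hj] at hbag
        clear hr hmm
        by_cases hjn : j < σ.reg 0
        · have hc : σ.reg 0 - j ≠ 0 := by omega
          rw [min_eq_left (by omega)] at k1 k3 ⊢
          refine ⟨?_, fun x hx => ?_, fun v hv => ?_⟩
          · simp [den, r0, hj, hc, k1]; omega
          · rw [← k2 x hx]
            simp [den, r0, hj, hc, k1, Function.update_apply]
            omega
          · by_cases hvj : v = j
            · subst hvj; simpa [den, r0, hj, hc, k1] using hbag
            · rw [← k3 v (by omega)]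
              simp [den, r0, hj, hc, k1, hvj]
        · have hc : σ.reg 0 - j = 0 := by omega
          rw [min_eq_right (by omega)] at k1 k3 ⊢
          refine ⟨?_, fun x hx => ?_, fun v hv => ?_⟩
          · simp [den, r0, hj, hc, k1]
          · rw [← k2 x hx]; simp [den, r0, hj, hc]
          · rw [← k3 v hv]; simp [den, r0, hj, hc]
    · refine ⟨fun h => by omega, fun j hj hji v hv => ?_⟩
      have hc : σ.reg 0 + 2 - i = 0 := by omega
      rw [← h2 j hj (by omega) v hv]
      simp [den, t0, hi, hc]

/-! ### The tree decomposition -/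

/-- The store that the program leaves behind describes a tree decomposition of `G`. The node of a
vertex outside `F` and the separator `S` has the vertices of one half of `F` in its bag, according
to the colour of its label. The vertices of `F` that keep a nonzero weight `wA` have only items of
the first colour, so that they are not needed in the second hub, and similarly for `wB`. -/
theorem exists_describes_of_colouring {G : EdgeListGraph}
    {s d chi own S par lab w col wA wB kind par' al : ℕ → ℕ} {P W : ℕ}
    (hs : ∀ e : Fin G.m, s e = (G.ends e).1) (hd : ∀ e : Fin G.m, d e = (G.ends e).2)
    (hshape : Peel.Shape G.n G.m s d chi al par)
    (hlab : Peel.Labelling G.n P chi own al par lab w S) (hal : ∀ v, al v = 0)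
    (hpar' : ∀ v, par' v = if v < G.n ∧ ¬ (chi v = 0 ∧ S v = 0) then 0 else par v)
    (hkind : ∀ v, kind v = if v = G.n + 1 then 2 else if v = G.n then 1 else
      if v < G.n ∧ chi v = 0 ∧ S v = 0 then col (lab v) + 1 else 0)
    (hcol : ∀ j, col j ≤ 1)
    (hin : ∀ e < G.m, chi (s e) ≠ 0 → chi (d e) ≠ 0 →
      (wB (s e) = 0 ∧ wB (d e) = 0) ∨ (wA (s e) = 0 ∧ wA (d e) = 0))
    (hout : ∀ e < G.m, ∀ u v, (s e = u ∧ d e = v ∨ s e = v ∧ d e = u) → chi u ≠ 0 → chi v = 0 →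
      S v = 0 → (col (lab v) = 0 → wB u = 0) ∧ (col (lab v) ≠ 0 → wA u = 0))
    (hWA : ((Finset.range G.n).filter fun v => S v ≠ 0).card + 2 +
      ((Finset.range G.n).filter fun v => chi v ≠ 0 ∧ wA v = 0).card ≤ W)
    (hWB : ((Finset.range G.n).filter fun v => S v ≠ 0).card + 2 +
      ((Finset.range G.n).filter fun v => chi v ≠ 0 ∧ wB v = 0).card ≤ W)
    {τ : RandRAM.Store} (h0 : τ.reg 0 = G.n + 2)
    (h1 : ∀ i ≤ G.n, τ.mem 0 i = i ∧ τ.mem 1 i = treeParent G.n chi S par' kind wB i)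
    (h2 : ∀ i < G.n + 2, ∀ v < G.n, τ.mem 2 (i * G.n + v) ≠ 0 ↔
      InBag chi S par' kind wA wB i v) :
    ∃ D : G.TreeDecomposition, Describes τ D ∧ D.width ≤ (W : ℤ) - 1 := by
  obtain ⟨c, rk, hrk, hrk'⟩ := hshape.rank
  set n := G.n with hn
  -- facts about parents and kinds
  have hparS : ∀ v u, par' v = u + 1 → par v = u + 1 ∧ v < n ∧ chi v = 0 ∧ S v = 0 ∧ u < n ∧
      chi u = 0 := by
    intro v u h
    rw [hpar'] at h
    split_ifs at h with hc
    have h3 := hshape.par_lt v u h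
    exact ⟨h, h3.1.1, h3.1.2, by by_contra h4; exact hc ⟨h3.1.1, fun h5 => h4 h5.2⟩, h3.2.1.1,
      h3.2.1.2⟩
  have hparS' : ∀ v u, v < n → chi v = 0 → S v = 0 → par v = u + 1 → par' v = u + 1 := by
    intro v u _ hv hv' h
    rw [hpar', if_neg (by tauto)]; exact h
  have hkA : kind n = 1 := by rw [hkind]; simp
  have hkB : kind (n + 1) = 2 := by rw [hkind]; simp
  have hkv : ∀ v, v < n → chi v = 0 → S v = 0 → kind v = col (lab v) + 1 := by
    intro v hv hv' hv''
    rw [hkind, if_neg (by omega), if_neg (by omega), if_pos ⟨hv, hv', hv''⟩]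
  have hk0 : ∀ v, v < n → kind v ≠ 0 → chi v = 0 ∧ S v = 0 := by
    intro v hv hv'
    rw [hkind, if_neg (by omega), if_neg (by omega)] at hv'
    split_ifs at hv' with h
    · exact h.2
    · exact absurd rfl hv'
  have hk2 : ∀ v, kind v ≤ 2 := by
    intro v
    have := hcol (lab v)
    rw [hkind]; split_ifs <;> omega
  set p := treeParent n chi S par' kind wB with hp
  have hpn : p n = n + 1 := by simp [hp, treeParent]
  have hpF : ∀ v, v < n → chi v ≠ 0 → p v = if wB v ≠ 0 then n + 1 else n := by
    intro v hv hv'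
    simp only [hp, treeParent]
    rw [if_neg (by omega), if_pos hv']
  have hpP : ∀ v u, par' v = u + 1 → S u = 0 → p v = u := by
    intro v u hv hu
    obtain ⟨-, hvn, hcv, -⟩ := hparS v u hv
    simp only [hp, treeParent]
    rw [if_neg (by omega), if_neg (by omega), hv, if_pos (by simpa using hu)]
    rfl
  have hpH : ∀ v, v < n → chi v = 0 → (∃ u, par' v = u + 1 ∧ S u = 0 ∧ p v = u) ∨
      p v = n + (kind v - 1) := by
    intro v hv hv'
    by_cases hc : par' v ≠ 0 ∧ S (par' v - 1) = 0
    · left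
      have h3 : par' v = (par' v - 1) + 1 := by omega
      exact ⟨_, h3, hc.2, hpP v _ h3 hc.2⟩
    · right
      simp only [hp, treeParent]
      rw [if_neg (by omega), if_neg (by omega), if_neg hc]
  -- a node of a vertex and its parent have the same kind
  have hkp : ∀ v, v < n → kind v ≠ 0 → p v < n + 2 ∧ kind (p v) = kind v := by
    intro v hv hkv0
    obtain ⟨hc, hS⟩ := hk0 v hv hkv0
    rcases hpH v hv hc with ⟨u, h3, h4, h5⟩ | h3
    · obtain ⟨h6, -, -, -, h7, h8⟩ := hparS v u h3
      rw [h5, hkv v hv hc hS, hkv u h7 h8 h4, hlab.lab_par v u h6 hS h4]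
      exact ⟨by omega, rfl⟩
    · have := hk2 v
      have : kind v = 1 ∨ kind v = 2 := by omega
      rcases this with h4 | h4
      · rw [h3, h4]; exact ⟨by omega, hkA⟩
      · rw [h3, h4]; exact ⟨by omega, hkB⟩
  refine exists_describes (p := p)
    (rk := fun v => if v = n + 1 then c + 2 else if v = n then c + 1 else rk v)
    (B := InBag chi S par' kind wA wB) ?_ ?_ ?_ ?_ ?_ h0 h1 h2
  · intro i hi
    rcases Nat.lt_or_eq_of_le hi with hi | rfl
    · have hri := hrk i
      have hlarge : ∀ q, q = n ∨ q = n + 1 → q < n + 2 ∧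
          (if i = n + 1 then c + 2 else if i = n then c + 1 else rk i) <
          (if q = n + 1 then c + 2 else if q = n then c + 1 else rk q) := by
        intro q hq
        refine ⟨by omega, ?_⟩
        rw [if_neg (show i ≠ n + 1 by omega), if_neg (show i ≠ n by omega)]
        split_ifs <;> omega
      by_cases hc : chi i = 0
      · rcases hpH i hi hc with ⟨u, h3, h4, h5⟩ | h3
        · obtain ⟨h6, -, -, -, h7, h8⟩ := hparS i u h3
          rw [h5]
          refine ⟨by omega, ?_⟩
          rw [if_neg (show i ≠ n + 1 by omega), if_neg (show i ≠ n by omega),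
            if_neg (show u ≠ n + 1 by omega), if_neg (show u ≠ n by omega)]
          exact (hrk' i u h6).resolve_left (by simp [hal])
        · have := hk2 i
          exact hlarge _ (by omega)
      · refine hlarge _ ?_
        rw [hpF i hi hc]; split_ifs <;> simp
    · rw [← hn, hpn]; simp
  · intro v hv
    exact ⟨v, by omega, .inr (.inl rfl)⟩
  · intro e
    have h3 := hs e
    have h4 := hd e
    have hsn : s e < n := by rw [h3]; exact (G.ends e).1.2
    have hdn : d e < n := by rw [h4]; exact (G.ends e).2.2
    rw [← h3, ← h4]
    have half : ∀ u v, (s e = u ∧ d e = v ∨ s e = v ∧ d e = u) → v < n → chi u ≠ 0 → chi v = 0 →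
        S v = 0 → InBag chi S par' kind wA wB v u := by
      intro u v huv hvn hu hv hSv
      have h5 := hout e e.2 u v huv hu hv hSv
      have h6 := hkv v hvn hv hSv
      have h7 := hcol (lab v)
      by_cases h8 : col (lab v) = 0
      · exact .inr (.inr (.inr (.inl ⟨hu, by omega, h5.1 h8⟩)))
      · exact .inr (.inr (.inr (.inr ⟨hu, by omega, h5.2 h8⟩)))
    by_cases hcs : chi (s e) = 0 <;> by_cases hcd : chi (d e) = 0
    · by_cases hSs : S (s e) = 0
      · by_cases hSd : S (d e) = 0
        · rcases hshape.edge e e.2 hsn hdn hcs hcd with h5 | h5 | h5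
          · exact absurd (hal _) h5.1
          · exact ⟨s e, by omega, .inr (.inl rfl), .inr (.inr (.inl (hparS' _ _ hsn hcs hSs h5)))⟩
          · exact ⟨d e, by omega, .inr (.inr (.inl (hparS' _ _ hdn hcd hSd h5))), .inr (.inl rfl)⟩
        · exact ⟨s e, by omega, .inr (.inl rfl), .inl hSd⟩
      · exact ⟨d e, by omega, .inl hSs, .inr (.inl rfl)⟩
    · by_cases hSs : S (s e) = 0
      · exact ⟨s e, by omega, .inr (.inl rfl), half _ _ (.inr ⟨rfl, rfl⟩) hsn hcd hcs hSs⟩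
      · exact ⟨d e, by omega, .inl hSs, .inr (.inl rfl)⟩
    · by_cases hSd : S (d e) = 0
      · exact ⟨d e, by omega, half _ _ (.inl ⟨rfl, rfl⟩) hdn hcs hcd hSd, .inr (.inl rfl)⟩
      · exact ⟨s e, by omega, .inr (.inl rfl), .inl hSd⟩
    · rcases hin e e.2 hcs hcd with ⟨h5, h6⟩ | ⟨h5, h6⟩
      · exact ⟨n, by omega, .inr (.inr (.inr (.inl ⟨hcs, hkA, h5⟩))),
          .inr (.inr (.inr (.inl ⟨hcd, hkA, h6⟩)))⟩
      · exact ⟨n + 1, by omega, .inr (.inr (.inr (.inr ⟨hcs, hkB, h5⟩))),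
          .inr (.inr (.inr (.inr ⟨hcd, hkB, h6⟩)))⟩
  · intro v hv
    rw [← hn] at hv
    by_cases hSv : S v = 0
    swap
    · exact ⟨n + 1, by omega, .inl hSv, fun i _ _ _ => ⟨by omega, .inl hSv⟩⟩
    by_cases hcv : chi v = 0
    · refine ⟨v, by omega, .inr (.inl rfl), fun i _ hi hiv => ?_⟩
      rcases hi with h3 | h3 | h3 | h3 | h3
      · exact absurd hSv h3
      · exact absurd h3.symm hiv
      · obtain ⟨-, h4, -⟩ := hparS i v h3
        rw [hpP i v h3 hSv]
        exact ⟨by omega, .inr (.inl rfl)⟩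
      · exact absurd hcv h3.1
      · exact absurd hcv h3.1
    · -- the bags with a vertex of `F`, apart from its own node, form subtrees at the hubs
      have hbag : ∀ i, InBag chi S par' kind wA wB i v → v ≠ i →
          (kind i = 1 ∧ wB v = 0) ∨ (kind i = 2 ∧ wA v = 0) := by
        rintro i (h3 | h3 | h3 | h3 | h3) hiv
        · exact absurd hSv h3
        · exact absurd h3 hiv
        · exact absurd (hparS i v h3).2.2.2.2.2 hcv
        · exact .inl h3.2
        · exact .inr h3.2
      have hbagA : ∀ i, kind i = 1 → wB v = 0 → InBag chi S par' kind wA wB i v :=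
        fun i h3 h4 => .inr (.inr (.inr (.inl ⟨hcv, h3, h4⟩)))
      have hbagB : ∀ i, kind i = 2 → wA v = 0 → InBag chi S par' kind wA wB i v :=
        fun i h3 h4 => .inr (.inr (.inr (.inr ⟨hcv, h3, h4⟩)))
      have hpv := hpF v hv hcv
      have hup : ∀ i < n, InBag chi S par' kind wA wB i v → v ≠ i →
          InBag chi S par' kind wA wB (p i) v := by
        intro i hi hb hiv
        rcases hbag i hb hiv with ⟨h3, h4⟩ | ⟨h3, h4⟩
        · exact hbagA _ ((hkp i hi (by omega)).2.trans h3) h4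
        · exact hbagB _ ((hkp i hi (by omega)).2.trans h3) h4
      by_cases hA : wA v = 0
      · refine ⟨n + 1, by omega, hbagB _ hkB hA, fun i hi hb hin1 => ⟨by omega, ?_⟩⟩
        by_cases hiv : v = i
        · rw [← hiv, hpv]
          split_ifs with h3
          · exact hbagB _ hkB hA
          · exact hbagA _ hkA (not_not.1 h3)
        · rcases Nat.lt_or_eq_of_le (show i ≤ n by omega) with h3 | h3
          · exact hup i h3 hb hiv
          · rw [h3, hpn]; exact hbagB _ hkB hA
      · by_cases hB : wB v = 0
        · refine ⟨n, by omega, hbagA _ hkA hB, fun i hi hb hin1 => ?_⟩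
          by_cases hiv : v = i
          · rw [← hiv, hpv, if_neg (by simpa using hB)]
            exact ⟨by omega, hbagA _ hkA hB⟩
          · have h3 : i < n := by
              by_contra h4
              obtain rfl : i = n + 1 := by omega
              rcases hbag _ hb hiv with h5 | h5
              · omega
              · exact hA h5.2
            exact ⟨by omega, hup i h3 hb hiv⟩
        · refine ⟨v, by omega, .inr (.inl rfl), fun i hi hb hiv => ?_⟩
          rcases hbag i hb (Ne.symm hiv) with h3 | h3
          · exact absurd h3.2 hB
          · exact absurd h3.2 hA
  · intro i hi X hX
    set T := (Finset.range n).filter fun v => S v ≠ 0 with hT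
    have hcard : ∀ Y : Finset ℕ, X ⊆ insert i (insert (par' i - 1) (T ∪ Y)) →
        X.card ≤ T.card + 2 + Y.card := by
      intro Y hY
      have h3 := Finset.card_le_card hY
      have h4 := Finset.card_insert_le i (insert (par' i - 1) (T ∪ Y))
      have h5 := Finset.card_insert_le (par' i - 1) (T ∪ Y)
      have h6 := Finset.card_union_le T Y
      omega
    by_cases hk : kind i = 1
    · refine (hcard ((Finset.range n).filter fun v => chi v ≠ 0 ∧ wB v = 0) ?_).trans hWB
      intro v hv
      obtain ⟨h3, h4⟩ := hX v hv
      simp only [Finset.mem_insert, Finset.mem_union, hT, Finset.mem_filter, Finset.mem_range]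
      rcases h4 with h4 | h4 | h4 | h4 | h4
      · tauto
      · tauto
      · exact .inr (.inl (by omega))
      · tauto
      · omega
    · refine (hcard ((Finset.range n).filter fun v => chi v ≠ 0 ∧ wA v = 0) ?_).trans hWA
      intro v hv
      obtain ⟨h3, h4⟩ := hX v hv
      simp only [Finset.mem_insert, Finset.mem_union, hT, Finset.mem_filter, Finset.mem_range]
      rcases h4 with h4 | h4 | h4 | h4 | h4
      · tauto
      · tauto
      · exact .inr (.inl (by omega))
      · omega
      · tauto

/-! ### Counting items and edges -/

/-- The degree of `v`, as the program computes it. -/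
def degOf (m : ℕ) (s d : ℕ → ℕ) (v : ℕ) : ℕ :=
  ∑ e ∈ Finset.range m, ((if s e = v then 1 else 0) + (if d e = v then 1 else 0))

/-- The number of edges from the vertex `v` outside `F` to the vertices of nonzero weight. -/
def loadOf (m : ℕ) (s d chi W : ℕ → ℕ) (v : ℕ) : ℕ :=
  ∑ e ∈ Finset.range m, ((if d e = v ∧ W (s e) ≠ 0 ∧ chi v = 0 then 1 else 0) +
    (if s e = v ∧ W (d e) ≠ 0 ∧ chi v = 0 then 1 else 0))

variable {n m N L P : ℕ} {s d chi W S lab el : ℕ → ℕ}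

/-- A vertex has at most as many items as edge ends. -/
theorem seen_le_degOf (hel : ∀ e, ¬ e < m → el e = 0) (j v : ℕ) :
    Balance.seen (Involves N s d el) j v ≤ degOf m s d v := by
  classical
  have h1 : ((Finset.range j).filter fun i => Involves N s d el i v) ⊆
      ((Finset.range m).filter fun e => s e = v ∨ d e = v).image fun e => el e - 1 := by
    intro i hi
    obtain ⟨-, e, -, he, hv⟩ := Finset.mem_filter.1 hi
    refine Finset.mem_image.2 ⟨e, Finset.mem_filter.2 ⟨Finset.mem_range.2 ?_, hv⟩, by omega⟩
    by_contra hcon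
    have := hel e hcon
    omega
  calc Balance.seen (Involves N s d el) j v
      ≤ ((Finset.range m).filter fun e => s e = v ∨ d e = v).card := by
        rw [Balance.seen]
        convert (Finset.card_le_card h1).trans Finset.card_image_le
    _ = ∑ e ∈ Finset.range m, if s e = v ∨ d e = v then 1 else 0 := Finset.card_filter _ _
    _ ≤ degOf m s d v := Finset.sum_le_sum fun e _ => by split_ifs <;> simp_all

/-- An item involves at most `P` light vertices if it is a component, by the bound on the weight of
its label, and at most two if it is an edge. -/
theorem size_le (hlab : ∀ v < n, lab v < n) (hs : ∀ e < m, s e < n) (hd : ∀ e < m, d e < n)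
    (hW : ∀ v, W v ≠ 0 → chi v ≠ 0)
    (hel : ∀ e, el e = if e < m then itemOf n s d chi S lab e else 0)
    (hgroup : ∀ j, Peel.group n (loadOf m s d chi W) lab S j ≤ P) (j : ℕ) :
    Balance.size N W (Involves N s d el) j ≤ max P 2 := by
  classical
  have hcard : ∀ Y : Finset ℕ, (∀ v e, W v ≠ 0 → e < m → el e = j + 1 →
      s e = v ∨ d e = v → v ∈ Y) → Balance.size N W (Involves N s d el) j ≤ Y.card := by
    intro Y hY
    rw [Balance.size]
    refine Finset.card_le_card fun v hv => ?_
    obtain ⟨-, h1, e, -, h2, h3⟩ := Finset.mem_filter.1 hv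
    refine hY v e h1 ?_ h2 h3
    by_contra hcon
    rw [hel, if_neg hcon] at h2
    omega
  rcases Nat.lt_or_ge j n with hj | hj
  · refine le_trans ?_ (le_max_left P 2)
    refine le_trans ?_ (hgroup j)
    -- the edges of the item have one end in the group and the other one in `F`
    set E := (Finset.range m).filter fun e =>
      (W (s e) ≠ 0 ∧ chi (d e) = 0 ∧ lab (d e) = j ∧ S (d e) = 0) ∨
      (W (d e) ≠ 0 ∧ chi (s e) = 0 ∧ lab (s e) = j ∧ S (s e) = 0) with hE
    have h1 : Balance.size N W (Involves N s d el) j ≤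
        (E.image fun e => if chi (s e) = 0 then d e else s e).card := by
      refine hcard _ fun v e hv he hej hve => ?_
      rw [hel, if_pos he, itemOf] at hej
      have := hW v hv
      refine Finset.mem_image.2 ⟨e, Finset.mem_filter.2 ⟨Finset.mem_range.2 he, ?_⟩, ?_⟩
      · split_ifs at hej with h2 h3 h4 h5 h6
        · omega
        · left
          obtain rfl : s e = v := hve.resolve_right fun h => this (h ▸ not_not.1 h3)
          exact ⟨hv, not_not.1 h3, by omega, not_not.1 h4⟩
        · right
          obtain rfl : d e = v := hve.resolve_left fun h => this (h ▸ not_not.1 h2)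
          exact ⟨hv, not_not.1 h2, by omega, not_not.1 h6⟩
      · split_ifs at hej with h2 h3 h4 h5 h6
        · omega
        · rw [if_neg h2]
          exact hve.resolve_right fun h => this (h ▸ not_not.1 h3)
        · rw [if_pos (not_not.1 h2)]
          exact hve.resolve_left fun h => this (h ▸ not_not.1 h2)
    refine h1.trans (Finset.card_image_le.trans ?_)
    rw [Peel.group]
    unfold loadOf
    rw [Finset.sum_comm, hE, Finset.card_filter]
    refine Finset.sum_le_sum fun e he => ?_
    have he' := Finset.mem_range.1 he
    split_ifs with h2
    · rcases h2 with ⟨h3, h4, h5, h6⟩ | ⟨h3, h4, h5, h6⟩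
      · refine le_trans ?_ (Finset.single_le_sum (fun _ _ => Nat.zero_le _)
          (Finset.mem_filter.2 ⟨Finset.mem_range.2 (hd e he'), h5, h6⟩))
        rw [if_pos ⟨rfl, h3, h4⟩]; omega
      · refine le_trans ?_ (Finset.single_le_sum (fun _ _ => Nat.zero_le _)
          (Finset.mem_filter.2 ⟨Finset.mem_range.2 (hs e he'), h5, h6⟩))
        have h7 : s e = s e ∧ W (d e) ≠ 0 ∧ chi (s e) = 0 := ⟨rfl, h3, h4⟩
        rw [if_pos h7]; omega
    · exact Nat.zero_le _
  · refine le_trans ?_ (le_max_right P 2)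
    refine (hcard {s (j - n), d (j - n)} fun v e hv he hej hve => ?_).trans Finset.card_le_two
    rw [hel, if_pos he, itemOf] at hej
    have h1 := hlab _ (hs e he)
    have h2 := hlab _ (hd e he)
    have h3 : e = j - n := by split_ifs at hej <;> omega
    rw [← h3]
    simp only [Finset.mem_insert, Finset.mem_singleton]
    tauto

/-- Double counting of the pairs of an item and a vertex of nonzero weight. -/
theorem sum_size_le (F : Finset ℕ) (hWF : ∀ v, W v ≠ 0 → v ∈ F ∧ degOf m s d v ≤ L)
    (hel : ∀ e, ¬ e < m → el e = 0) (j : ℕ) :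
    ∑ i ∈ Finset.range j, Balance.size N W (Involves N s d el) i ≤ F.card * L := by
  classical
  have h1 : ∀ i, Balance.size N W (Involves N s d el) i =
      ∑ v ∈ (Finset.range N).filter fun v => W v ≠ 0,
        if Involves N s d el i v then 1 else 0 := by
    intro i
    rw [Balance.size, ← Finset.card_filter, Finset.filter_filter]
  have h2 : ∀ v, ∑ i ∈ Finset.range j, (if Involves N s d el i v then 1 else 0) =
      Balance.seen (Involves N s d el) j v := by
    intro v
    rw [Balance.seen, ← Finset.card_filter]
  simp only [h1]
  rw [Finset.sum_comm]
  simp only [h2]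
  calc ∑ v ∈ (Finset.range N).filter fun v => W v ≠ 0, Balance.seen (Involves N s d el) j v
      ≤ ∑ v ∈ (Finset.range N).filter fun v => W v ≠ 0, L :=
        Finset.sum_le_sum fun v hv => (seen_le_degOf hel j v).trans
          (hWF v (Finset.mem_filter.1 hv).2).2
    _ ≤ F.card * L := by
        rw [Finset.sum_const, smul_eq_mul]
        exact Nat.mul_le_mul_right _ (Finset.card_le_card fun v hv =>
          (hWF v (Finset.mem_filter.1 hv).2).1)

/-- There are at most `|F| * L` edge ends at vertices of degree at most `L` in `F`. -/
theorem sum_loadOf_le (F : Finset ℕ) (hWF : ∀ v, W v ≠ 0 → v ∈ F ∧ degOf m s d v ≤ L) :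
    ∑ v ∈ Finset.range n, loadOf m s d chi W v ≤ F.card * L := by
  classical
  have h1 : ∑ v ∈ Finset.range n, loadOf m s d chi W v ≤ ∑ e ∈ Finset.range m,
      ((if W (s e) ≠ 0 then 1 else 0) + (if W (d e) ≠ 0 then 1 else 0)) := by
    unfold loadOf
    rw [Finset.sum_comm]
    refine Finset.sum_le_sum fun e _ => ?_
    rw [Finset.sum_add_distrib]
    have key : ∀ x y, ∑ v ∈ Finset.range n, (if x = v ∧ W y ≠ 0 ∧ chi v = 0 then 1 else 0) ≤
        if W y ≠ 0 then 1 else 0 := by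
      intro x y
      by_cases hy : W y ≠ 0
      · rw [if_pos hy]
        calc ∑ v ∈ Finset.range n, (if x = v ∧ W y ≠ 0 ∧ chi v = 0 then 1 else 0)
            ≤ ∑ v ∈ Finset.range n, (if x = v then 1 else 0) :=
              Finset.sum_le_sum fun v _ => by split_ifs <;> simp_all
          _ ≤ 1 := by rw [Finset.sum_ite_eq]; split_ifs <;> omega
      · simp [hy]
    exact Nat.add_le_add (key _ _) (key _ _)
  have h2 : ∑ e ∈ Finset.range m,
      ((if W (s e) ≠ 0 then 1 else 0) + (if W (d e) ≠ 0 then 1 else 0)) ≤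
      ∑ v ∈ F.filter fun v => W v ≠ 0, degOf m s d v := by
    unfold degOf
    rw [Finset.sum_comm]
    refine Finset.sum_le_sum fun e _ => ?_
    rw [Finset.sum_add_distrib]
    have key : ∀ x, (if W x ≠ 0 then 1 else 0) ≤
        ∑ v ∈ F.filter fun v => W v ≠ 0, if x = v then 1 else 0 := by
      intro x
      rw [Finset.sum_ite_eq]
      by_cases hx : W x ≠ 0
      · rw [if_pos hx, if_pos (Finset.mem_filter.2 ⟨(hWF x hx).1, hx⟩)]
      · rw [if_neg hx]; omega
    exact Nat.add_le_add (key _) (key _)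
  refine h1.trans (h2.trans ?_)
  calc ∑ v ∈ F.filter fun v => W v ≠ 0, degOf m s d v ≤ ∑ v ∈ F.filter fun v => W v ≠ 0, L :=
        Finset.sum_le_sum fun v hv => (hWF v (Finset.mem_filter.1 hv).2).2
    _ ≤ F.card * L := by
        rw [Finset.sum_const, smul_eq_mul]
        exact Nat.mul_le_mul_right _ (Finset.card_filter_le _ _)

/-! ### Correctness -/

/-- The size of a bag, less one. Here `sz` is the size of the separator and `a` is the number of
vertices of `F` that are left out of the bag. The number `E₀ / 2 ^ L` is the expected number of
vertices left out under a random colouring, up to the vertices of degree more than `L`. -/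
theorem width_le {F : Finset ℕ} {deg W : ℕ → ℕ} {L sz a E₀ EA k : ℕ} (hk : 0 < k)
    (hFk : F.card ≤ k) (hW : ∀ v ∈ F, W v = if deg v ≤ L then 2 ^ (L - deg v) else 0)
    (hE₀ : E₀ = ∑ v ∈ F, W v) (hL : F.card = 0 ∨ 4 ^ L ≤ F.card) (hL' : F.card < 4 ^ (L + 1))
    (hsz : 2 ^ L * sz ≤ F.card * L) (hEA : EA ≤ 2 ^ L * a)
    (hdisc : ((EA : ℤ) - E₀) ^ 2 ≤ 2 * (2 ^ L) ^ 2 * max (2 ^ L) 2 * (F.card * L : ℕ)) :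
    (sz : ℝ) + 1 + (F.card - a) ≤
      (1 - (2 : ℝ) ^ (-(((∑ v ∈ F, deg v : ℕ) : ℝ) / k)) + 24 * (k : ℝ) ^ (-(3 / 16) : ℝ)) *
        k := by
  have hJ := two_rpow_neg_average_le F deg hk hFk
  set y : ℝ := ((E₀ : ℝ) - EA) / 2 ^ L with hy
  have hP : (0 : ℝ) < 2 ^ L := by positivity
  have hy2 : y ^ 2 ≤ 2 * max (2 ^ L) 2 * (F.card * L) := by
    have h1 : ((EA : ℝ) - E₀) ^ 2 ≤ 2 * (2 ^ L) ^ 2 * max (2 ^ L) 2 * (F.card * L) := by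
      exact_mod_cast hdisc
    rw [hy, div_pow, div_le_iff₀ (by positivity)]
    linarith
  have herr := error_le hk hFk hL hL' hsz hy2
  have hya : (E₀ : ℝ) / 2 ^ L - a ≤ y := by
    have h1 : (EA : ℝ) ≤ 2 ^ L * a := by exact_mod_cast hEA
    rw [hy, sub_div]
    have : (EA : ℝ) / 2 ^ L ≤ a := by rw [div_le_iff₀ hP]; linarith
    linarith
  have hsum : ∑ v ∈ F, ((2 : ℝ) ^ deg v)⁻¹ ≤
      (E₀ : ℝ) / 2 ^ L + F.card * ((2 : ℝ) ^ (L + 1))⁻¹ := by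
    rw [hE₀, Nat.cast_sum, Finset.sum_div, ← nsmul_eq_mul, ← Finset.sum_const,
      ← Finset.sum_add_distrib]
    refine Finset.sum_le_sum fun v hv => ?_
    rw [hW v hv]
    split_ifs with h
    · have h1 : (2 : ℝ) ^ L = 2 ^ (L - deg v) * 2 ^ deg v := by
        rw [← pow_add]; congr 1; omega
      have h2 : ((2 ^ (L - deg v) : ℕ) : ℝ) / 2 ^ L = ((2 : ℝ) ^ deg v)⁻¹ := by
        rw [h1]; push_cast; field_simp
      rw [h2]
      have : (0 : ℝ) < ((2 : ℝ) ^ (L + 1))⁻¹ := by positivity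
      linarith
    · have h1 : (2 : ℝ) ^ (L + 1) ≤ 2 ^ deg v := pow_le_pow_right₀ (by norm_num) (by omega)
      have := inv_anti₀ (by positivity) h1
      simpa using this
  have hexp : (1 - (2 : ℝ) ^ (-(((∑ v ∈ F, deg v : ℕ) : ℝ) / k)) +
      24 * (k : ℝ) ^ (-(3 / 16) : ℝ)) * k = k - (2 : ℝ) ^ (-(((∑ v ∈ F, deg v : ℕ) : ℝ) / k)) * k +
        24 * (k : ℝ) ^ (-(3 / 16) : ℝ) * k := by ring
  rw [hexp]
  linarith

/-- The part of the store that all commands before the output leave unchanged. -/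
structure Base (n m N : ℕ) (s d : ℕ → ℕ) (σ : Store) : Prop where
  reg0 : σ.reg 0 = n
  reg1 : σ.reg 1 = m
  reg2 : σ.reg 2 = N
  mem0 : σ.mem 0 = s
  mem1 : σ.mem 1 = d

theorem Base.den {n m N : ℕ} {s d : ℕ → ℕ} {σ : Store} (h : Base n m N s d σ) (c : Cmd)
    (h0 : c.wr 0 = false) (h1 : c.wr 1 = false) (h2 : c.wr 2 = false) (h3 : c.wa 0 = false)
    (h4 : c.wa 1 = false) : Base n m N s d (c.den σ) :=
  ⟨(den_reg h0 σ).trans h.reg0, (den_reg h1 σ).trans h.reg1, (den_reg h2 σ).trans h.reg2,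
    (den_mem h3 σ).trans h.mem0, (den_mem h4 σ).trans h.mem1⟩

set_option maxHeartbeats 2000000 in
/-- The final store of `main` describes a tree decomposition with the required width. In the proof,
`σi` is the store after the first `i` commands of `main`. -/
theorem main_spec (G : EdgeListGraph) (F : Finset (Fin G.n)) (hF : G.IsFVS F) :
    ∃ D : G.TreeDecomposition,
      Describes (main.den ((inputStore G F).setReg 2 (G.n + G.n + G.m + 3))) D ∧
      ∀ k : ℕ, 0 < k → F.card ≤ k → (D.width : ℝ) ≤
        (1 - (2 : ℝ) ^ (-((G.degSum F : ℝ) / (k : ℝ))) + 24 * (k : ℝ) ^ (-(3 / 16) : ℝ)) *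
          (k : ℝ) := by
  classical
  obtain ⟨n, hn⟩ : ∃ n, n = G.n := ⟨_, rfl⟩
  obtain ⟨m, hm⟩ : ∃ m, m = G.m := ⟨_, rfl⟩
  obtain ⟨N, hN⟩ : ∃ N, N = n + n + m + 3 := ⟨_, rfl⟩
  obtain ⟨σ0, e0⟩ : ∃ σ, σ = (inputStore G F).setReg 2 (G.n + G.n + G.m + 3) := ⟨_, rfl⟩
  obtain ⟨s, hs⟩ : ∃ s, s = (inputStore G F).mem 0 := ⟨_, rfl⟩
  obtain ⟨d, hd⟩ : ∃ d, d = (inputStore G F).mem 1 := ⟨_, rfl⟩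
  have hsG : ∀ e : Fin G.m, s e = (G.ends e).1 := fun e => by rw [hs]; exact (inputStore_ends G F e).1
  have hdG : ∀ e : Fin G.m, d e = (G.ends e).2 := fun e => by rw [hd]; exact (inputStore_ends G F e).2
  have hsn : ∀ e < m, s e < n := by
    intro e he
    have := hsG ⟨e, hm ▸ he⟩
    simp only at this
    rw [this, hn]; exact (G.ends _).1.2
  have hdn : ∀ e < m, d e < n := by
    intro e he
    have := hdG ⟨e, hm ▸ he⟩
    simp only at this
    rw [this, hn]; exact (G.ends _).2.2
  have B0 : Base n m N s d σ0 := by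
    rw [e0]
    exact ⟨by simp [inputStore, hn], by simp [inputStore, hm], by simp [hN, hn, hm], hs.symm,
      hd.symm⟩
  have z0 : ∀ a, 3 ≤ a → σ0.mem a = fun _ => 0 := by
    intro a ha
    rw [e0]
    have h1 : a ≠ 0 := by omega
    have h2 : a ≠ 1 := by omega
    have h3 : a ≠ 2 := by omega
    funext i
    simp [inputStore, h1, h2, h3]
  have zr0 : ∀ r, 3 ≤ r → σ0.reg r = 0 := by
    intro r hr
    rw [e0]
    have h1 : r ≠ 0 := by omega
    have h2 : r ≠ 1 := by omega
    have h3 : r ≠ 2 := by omega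
    simp [inputStore, h1, h2, h3]
  -- the indicator function of `F`
  obtain ⟨chi, hchi⟩ : ∃ chi, chi = σ0.mem 2 := ⟨_, rfl⟩
  have hchiF : ∀ v, chi v = if ∃ h : v < G.n, (⟨v, h⟩ : Fin G.n) ∈ F then 1 else 0 := by
    intro v
    rw [hchi, e0]
    by_cases h : v < G.n <;> simp [inputStore, h]
  set Fs : Finset ℕ := F.map Fin.valEmbedding with hFs
  have hFs_mem : ∀ v, v ∈ Fs ↔ chi v ≠ 0 := by
    intro v
    rw [hchiF, hFs, Finset.mem_map]
    constructor
    · rintro ⟨x, hx, rfl⟩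
      rw [if_pos ⟨x.2, hx⟩]; exact one_ne_zero
    · intro h
      split_ifs at h with h1
      · exact ⟨_, h1.2, rfl⟩
      · exact absurd rfl h
  have hFs_card : Fs.card = F.card := Finset.card_map _
  have hchi_lt : ∀ v, chi v ≠ 0 → v < n := by
    intro v hv
    rw [hchiF] at hv
    split_ifs at hv with h1
    · rw [hn]; exact h1.1
    · exact absurd rfl hv
  have hFn : Fs.card ≤ n := by
    rw [hFs_card, hn]; simpa using Finset.card_le_univ F
  -- preparations
  obtain ⟨σ1, e1⟩ : ∃ σ, σ = copyF.den σ0 := ⟨_, rfl⟩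
  have B1 : Base n m N s d σ1 := e1 ▸ B0.den _ rfl rfl rfl rfl rfl
  have F1 : ∀ a, copyF.wa a = false → σ1.mem a = σ0.mem a := fun a h => e1 ▸ den_mem h _
  have R1 : ∀ a, copyF.wr a = false → σ1.reg a = σ0.reg a := fun a h => e1 ▸ den_reg h _
  obtain ⟨c1, c2⟩ := copyF_spec σ0
  rw [← e1] at c1 c2
  have chi1 : σ1.mem 3 = chi := by
    rw [c1, B0.reg2, z0 3 le_rfl, ← hchi]
    funext i
    split_ifs with h
    · rfl
    · by_contra h1
      have := hchi_lt i (Ne.symm h1)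
      omega
  have f1 : σ1.reg 3 = Fs.card := by
    rw [c2, zr0 3 le_rfl, zero_add, B0.reg2, ← hchi, Finset.card_eq_sum_ones]
    symm
    calc ∑ v ∈ Fs, 1 = ∑ v ∈ Fs, chi v := by
          refine Finset.sum_congr rfl fun v hv => ?_
          have h1 := (hFs_mem v).1 hv
          have h2 := hchiF v
          split_ifs at h2 <;> omega
      _ = ∑ v ∈ Finset.range N, chi v := by
          refine Finset.sum_subset (fun v hv => ?_) fun v _ hv => ?_
          · have := hchi_lt v ((hFs_mem v).1 hv)
            exact Finset.mem_range.2 (by omega)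
          · by_contra h1
            exact hv ((hFs_mem v).2 h1)
  obtain ⟨σ2, e2⟩ : ∃ σ, σ = powers.den σ1 := ⟨_, rfl⟩
  have B2 : Base n m N s d σ2 := e2 ▸ B1.den _ rfl rfl rfl rfl rfl
  have F2 : ∀ a, powers.wa a = false → σ2.mem a = σ1.mem a := fun a h => e2 ▸ den_mem h _
  have R2 : ∀ a, powers.wr a = false → σ2.reg a = σ1.reg a := fun a h => e2 ▸ den_reg h _
  have pow2 : ∀ i ≤ N, σ2.mem 4 i = 2 ^ i := by
    have := powers_spec σ1
    rwa [B1.reg2, ← e2] at this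
  obtain ⟨σ3, e3⟩ : ∃ σ, σ = logs.den σ2 := ⟨_, rfl⟩
  have B3 : Base n m N s d σ3 := e3 ▸ B2.den _ rfl rfl rfl rfl rfl
  have F3 : ∀ a, logs.wa a = false → σ3.mem a = σ2.mem a := fun a h => e3 ▸ den_mem h _
  have R3 : ∀ a, logs.wr a = false → σ3.reg a = σ2.reg a := fun a h => e3 ▸ den_reg h _
  have f2 : σ2.reg 3 = Fs.card := (R2 3 rfl).trans f1
  obtain ⟨p3, hL, hL', hLN⟩ := logs_spec σ2
    ((R2 4 rfl).trans ((R1 4 rfl).trans (zr0 4 (by omega)))) (by rw [f2, B2.reg2]; omega)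
  rw [← e3, f2] at hL hL'
  rw [← e3] at p3 hLN
  rw [B2.reg2] at hLN
  obtain ⟨L, hLdef⟩ : ∃ L, L = σ3.reg 4 := ⟨_, rfl⟩
  rw [← hLdef] at p3 hL hL' hLN
  obtain ⟨σ4, e4⟩ : ∃ σ, σ = degrees.den σ3 := ⟨_, rfl⟩
  have B4 : Base n m N s d σ4 := e4 ▸ B3.den _ rfl rfl rfl rfl rfl
  have F4 : ∀ a, degrees.wa a = false → σ4.mem a = σ3.mem a := fun a h => e4 ▸ den_mem h _
  have R4 : ∀ a, degrees.wr a = false → σ4.reg a = σ3.reg a := fun a h => e4 ▸ den_reg h _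
  have deg4 : σ4.mem 5 = degOf m s d := by
    rw [e4, degrees_spec σ3 ((F3 5 rfl).trans ((F2 5 rfl).trans ((F1 5 rfl).trans
      (z0 5 (by omega))))) (by rw [B3.reg1, B3.reg2]; omega), B3.reg1, B3.mem0, B3.mem1]
    rfl
  have chi4 : σ4.mem 3 = chi := (F4 3 rfl).trans ((F3 3 rfl).trans ((F2 3 rfl).trans chi1))
  have L4 : σ4.reg 4 = L := (R4 4 rfl).trans hLdef.symm
  have z4 : ∀ a, (copyF.wa a || powers.wa a || logs.wa a || degrees.wa a) = false → 3 ≤ a →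
      σ4.mem a = fun _ => 0 := by
    intro a ha ha3
    simp only [Bool.or_eq_false_iff] at ha
    rw [F4 a ha.2, F3 a ha.1.2, F2 a ha.1.1.2, F1 a ha.1.1.1, z0 a ha3]
  obtain ⟨W, hW⟩ : ∃ W : ℕ → ℕ, ∀ v, W v =
    if chi v ≠ 0 ∧ degOf m s d v ≤ L then 2 ^ (L - degOf m s d v) else 0 := ⟨_, fun _ => rfl⟩
  obtain ⟨σ5, e5⟩ : ∃ σ, σ = weights.den σ4 := ⟨_, rfl⟩
  have B5 : Base n m N s d σ5 := e5 ▸ B4.den _ rfl rfl rfl rfl rfl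
  have F5 : ∀ a, weights.wa a = false → σ5.mem a = σ4.mem a := fun a h => e5 ▸ den_mem h _
  have R5 : ∀ a, weights.wr a = false → σ5.reg a = σ4.reg a := fun a h => e5 ▸ den_reg h _
  obtain ⟨w12, w13, w7⟩ := weights_spec σ4 (z4 12 rfl (by omega)) (z4 13 rfl (by omega))
    ((R4 7 rfl).trans ((R3 7 rfl).trans ((R2 7 rfl).trans ((R1 7 rfl).trans
      (zr0 7 (by omega)))))) (W := W) (by
      intro v
      rw [hW, B4.reg2, chi4, deg4, L4, F4 4 rfl, F3 4 rfl, pow2 _ (by omega)]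
      refine if_congr ⟨fun h => ⟨?_, h⟩, fun h => h.2⟩ rfl rfl
      have := hchi_lt v h.1
      omega)
  rw [← e5] at w12 w13 w7
  rw [B4.reg2] at w7
  have hWchi : ∀ v, W v ≠ 0 → chi v ≠ 0 ∧ degOf m s d v ≤ L := by
    intro v hv
    rw [hW] at hv
    split_ifs at hv with h
    · exact h
    · exact absurd rfl hv
  have hWFs : ∀ v, W v ≠ 0 → v ∈ Fs ∧ degOf m s d v ≤ L := fun v hv =>
    ⟨(hFs_mem v).2 (hWchi v hv).1, (hWchi v hv).2⟩
  have chi5 : σ5.mem 3 = chi := (F5 3 rfl).trans chi4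
  obtain ⟨σ6, e6⟩ : ∃ σ, σ = loads.den σ5 := ⟨_, rfl⟩
  have B6 : Base n m N s d σ6 := e6 ▸ B5.den _ rfl rfl rfl rfl rfl
  have F6 : ∀ a, loads.wa a = false → σ6.mem a = σ5.mem a := fun a h => e6 ▸ den_mem h _
  have R6 : ∀ a, loads.wr a = false → σ6.reg a = σ5.reg a := fun a h => e6 ▸ den_reg h _
  have load6 : σ6.mem 6 = loadOf m s d chi W := by
    rw [e6, loads_spec σ5 ((F5 6 rfl).trans (z4 6 rfl (by omega)))
      (by rw [B5.reg1, B5.reg2]; omega), B5.reg1, B5.mem0, B5.mem1, w12, chi5]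
    rfl
  have chi6 : σ6.mem 3 = chi := (F6 3 rfl).trans chi5
  have z6 : ∀ a, (weights.wa a || loads.wa a) = false →
      (copyF.wa a || powers.wa a || logs.wa a || degrees.wa a) = false → 3 ≤ a →
      σ6.mem a = fun _ => 0 := by
    intro a ha ha' ha3
    simp only [Bool.or_eq_false_iff] at ha
    rw [F6 a ha.2, F5 a ha.1, z4 a ha' ha3]
  -- elimination of the forest
  obtain ⟨σ7, e7⟩ : ∃ σ, σ = startPeel.den σ6 := ⟨_, rfl⟩
  have B7 : Base n m N s d σ7 := e7 ▸ B6.den _ rfl rfl rfl rfl rfl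
  have F7 : ∀ a, startPeel.wa a = false → σ7.mem a = σ6.mem a := fun a h => e7 ▸ den_mem h _
  have R7 : ∀ a, startPeel.wr a = false → σ7.reg a = σ6.reg a := fun a h => e7 ▸ den_reg h _
  have p6 : σ6.reg 5 = 2 ^ L := by rw [R6 5 rfl, R5 5 rfl, R4 5 rfl, p3]
  obtain ⟨s1, s2, s3⟩ := startPeel_spec σ6 (z6 7 rfl rfl (by omega)) (z6 8 rfl rfl (by omega))
    (by rw [B6.reg0, B6.reg2]; omega)
  rw [← e7, B6.reg0, chi6] at s1
  rw [← e7, B6.reg0] at s2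
  rw [← e7, B6.reg0, load6, p6] at s3
  have par7 : σ7.mem 10 = fun _ => 0 := (F7 10 rfl).trans (z6 10 rfl rfl (by omega))
  have hown : ∀ v, loadOf m s d chi W v ≠ 0 → chi v = 0 := by
    intro v hv
    by_contra h
    exact hv (Finset.sum_eq_zero fun e _ => by simp [h])
  have PS7 : PeelState n m (2 ^ L) s d chi (loadOf m s d chi W) σ7 := by
    refine ⟨?_, ?_⟩
    · rw [par7]; exact Peel.Shape.start s1
    · rw [par7, F7 6 rfl, load6]; exact Peel.Labelling.start s1 s2 s3 hown
  have PI7 : PeelInput n m N (2 ^ L) s d σ7 :=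
    ⟨B7.reg1, B7.reg2, (R7 5 rfl).trans p6, B7.mem0, B7.mem1, by omega, by omega⟩
  have hchi0 : ∀ x : Fin G.n, chi x = 0 → x ∉ F := by
    intro x hx hxF
    have := hchiF x
    rw [if_pos ⟨x.2, hxF⟩] at this
    omega
  have hloop : ∀ e < m, s e < n → chi (s e) = 0 → s e ≠ d e := by
    intro e he _ hc heq
    have h1 := hsG ⟨e, hm ▸ he⟩
    have h2 := hdG ⟨e, hm ▸ he⟩
    simp only at h1 h2
    have h3 : (G.ends ⟨e, hm ▸ he⟩).1 = (G.ends ⟨e, hm ▸ he⟩).2 := Fin.ext (by omega)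
    have h4 := hchi0 (G.ends ⟨e, hm ▸ he⟩).1 (by rw [← h1]; exact hc)
    exact hF.1 ⟨e, hm ▸ he⟩ ⟨h4, h3 ▸ h4⟩ h3
  have hleaf : ∀ al : ℕ → ℕ, (∀ v, al v ≠ 0 → v < n ∧ chi v = 0) → (∃ v, al v ≠ 0) →
      ∃ v, al v ≠ 0 ∧ Peel.count m s d al v ≤ 1 := by
    intro al hal hne
    rw [hm]
    refine hF.exists_count_le_one hsG hdG (fun v hv => ?_) hne
    obtain ⟨h1, h2⟩ := hal v hv
    exact ⟨hn ▸ h1, hchi0 ⟨v, hn ▸ h1⟩ h2⟩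
  obtain ⟨σ8, e8⟩ : ∃ σ, σ = peel.den σ7 := ⟨_, rfl⟩
  have B8 : Base n m N s d σ8 := e8 ▸ B7.den _ rfl rfl rfl rfl rfl
  have F8 : ∀ a, peel.wa a = false → σ8.mem a = σ7.mem a := fun a h => e8 ▸ den_mem h _
  have R8 : ∀ a, peel.wr a = false → σ8.reg a = σ7.reg a := fun a h => e8 ▸ den_reg h _
  obtain ⟨⟨hshape, hlabel⟩, hal⟩ := peel_spec hloop hleaf PI7 PS7
  rw [← e8] at hshape hlabel hal
  have chi8 : σ8.mem 3 = chi := (F8 3 rfl).trans ((F7 3 rfl).trans chi6)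
  -- colouring
  obtain ⟨σ9, e9⟩ : ∃ σ, σ = items.den σ8 := ⟨_, rfl⟩
  have B9 : Base n m N s d σ9 := e9 ▸ B8.den _ rfl rfl rfl rfl rfl
  have F9 : ∀ a, items.wa a = false → σ9.mem a = σ8.mem a := fun a h => e9 ▸ den_mem h _
  have R9 : ∀ a, items.wr a = false → σ9.reg a = σ8.reg a := fun a h => e9 ▸ den_reg h _
  obtain ⟨el, hel⟩ : ∃ el, el = σ9.mem 11 := ⟨_, rfl⟩
  have hel' : ∀ e, el e = if e < m then itemOf n s d chi (σ8.mem 8) (σ8.mem 9) e else 0 := by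
    intro e
    rw [hel, e9, items_spec σ8 ((F8 11 rfl).trans ((F7 11 rfl).trans (z6 11 rfl rfl (by omega))))
      (by rw [B8.reg1, B8.reg2]; omega), B8.reg0, B8.reg1, B8.mem0, B8.mem1, chi8]
  have hel0 : ∀ e, ¬ e < m → el e = 0 := fun e he => by rw [hel', if_neg he]
  have W9 : σ9.mem 12 = W := by rw [F9 12 rfl, F8 12 rfl, F7 12 rfl, F6 12 rfl, w12]
  have W9' : σ9.mem 13 = W := by rw [F9 13 rfl, F8 13 rfl, F7 13 rfl, F6 13 rfl, w13]
  have E9 : σ9.reg 7 = ∑ v ∈ Finset.range N, W v := by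
    rw [R9 7 rfl, R8 7 rfl, R7 7 rfl, R6 7 rfl, w7]
  have hseen : ∀ v, W v ≠ 0 → ∀ j, Balance.seen (Involves N s d el) j v ≤ degOf m s d v :=
    fun v _ j => seen_le_degOf hel0 j v
  have hsize : ∀ j, Balance.size N W (Involves N s d el) j ≤ max (2 ^ L) 2 :=
    size_le hlabel.lab_lt hsn hdn (fun v hv => (hWchi v hv).1) hel' hlabel.group_le
  have hsizeN : ∀ j, 2 ^ L * Balance.size N W (Involves N s d el) j ≤ N := by
    intro j
    rcases hL with h0 | h0
    · have : Balance.size N W (Involves N s d el) j = 0 := by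
        rw [Balance.size, Finset.card_eq_zero, Finset.filter_eq_empty_iff]
        intro v _ h
        have := (hWFs v h.1).1
        rw [Finset.card_eq_zero.1 h0] at this
        simp at this
      rw [this]; omega
    · have h1 : 2 ^ L * max (2 ^ L) 2 ≤ 2 * 4 ^ L := by
        have h2 : 4 ^ L = 2 ^ L * 2 ^ L := by rw [← mul_pow]; norm_num
        have h3 : 1 ≤ 2 ^ L := Nat.one_le_two_pow
        rw [h2]
        rcases max_cases (2 ^ L) 2 with h | h <;> rw [h.1] <;> nlinarith
      have h2 := Nat.mul_le_mul_left (2 ^ L) (hsize j)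
      omega
  have hWdeg : ∀ v, W v * 2 ^ degOf m s d v ≤ 2 ^ L := by
    intro v
    rw [hW]
    split_ifs with h
    · rw [← pow_add, Nat.sub_add_cancel h.2]
    · simp
  have hinv : ∀ j v, Involves N s d el j v → v < N := by
    rintro j v ⟨e, -, h1, h2⟩
    have he : e < m := by
      by_contra h
      rw [hel0 e h] at h1
      omega
    have := hsn e he
    have := hdn e he
    omega
  obtain ⟨σ10, e10⟩ : ∃ σ, σ = greedy.den σ9 := ⟨_, rfl⟩
  have B10 : Base n m N s d σ10 := e10 ▸ B9.den _ rfl rfl rfl rfl rfl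
  have F10 : ∀ a, greedy.wa a = false → σ10.mem a = σ9.mem a := fun a h => e10 ▸ den_mem h _
  obtain ⟨hst, hcol⟩ := greedy_spec B9.reg2 B9.mem0 B9.mem1 hel.symm W9 W9'
    (by rw [F9 15 rfl, F8 15 rfl, F7 15 rfl, z6 15 rfl rfl (by omega)]) E9 hWdeg hinv hseen hsize
    hsizeN
  rw [← e10] at hst hcol
  have chi10 : σ10.mem 3 = chi := (F10 3 rfl).trans ((F9 3 rfl).trans chi8)
  have S10 : σ10.mem 8 = σ8.mem 8 := (F10 8 rfl).trans (F9 8 rfl)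
  have lab10 : σ10.mem 9 = σ8.mem 9 := (F10 9 rfl).trans (F9 9 rfl)
  have par10 : σ10.mem 10 = σ8.mem 10 := (F10 10 rfl).trans (F9 10 rfl)
  -- output
  obtain ⟨σ11, e11⟩ : ∃ σ, σ = kinds.den σ10 := ⟨_, rfl⟩
  have B11 : Base n m N s d σ11 := e11 ▸ B10.den _ rfl rfl rfl rfl rfl
  have F11 : ∀ a, kinds.wa a = false → σ11.mem a = σ10.mem a := fun a h => e11 ▸ den_mem h _
  obtain ⟨k1, k2⟩ := kinds_spec σ10
    (by rw [F10 16 rfl, F9 16 rfl, F8 16 rfl, F7 16 rfl, z6 16 rfl rfl (by omega)])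
    (by rw [B10.reg0, B10.reg2]; omega)
  rw [← e11, B10.reg0, chi10, S10, par10] at k1
  rw [← e11, B10.reg0, chi10, S10, lab10] at k2
  obtain ⟨σ12, e12⟩ : ∃ σ, σ = edges.den σ11 := ⟨_, rfl⟩
  have F12 : ∀ a, edges.wa a = false → σ12.mem a = σ11.mem a := fun a h => e12 ▸ den_mem h _
  have r12 : ∀ r, edges.wr r = false → σ12.reg r = σ11.reg r := fun a h => e12 ▸ den_reg h _
  have o1 := edges_spec σ11 (by rw [B11.reg0, B11.reg2]; omega)
  rw [← e12, B11.reg0, F11 3 rfl, F11 8 rfl, F11 13 rfl, chi10, S10] at o1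
  obtain ⟨σ13, e13⟩ : ∃ σ, σ = matrix.den σ12 := ⟨_, rfl⟩
  have q19 : σ12.reg 19 = 0 := by
    rw [r12 19 rfl, e11, den_reg rfl, e10, den_reg rfl, R9 19 rfl, R8 19 rfl, R7 19 rfl, R6 19 rfl,
      R5 19 rfl, R4 19 rfl, R3 19 rfl, R2 19 rfl, R1 19 rfl, zr0 19 (by omega)]
  have q0 : σ12.reg 0 = n := (r12 0 rfl).trans B11.reg0
  have o2 := matrix_spec σ12 q19 (by rw [q0, r12 2 rfl, B11.reg2]; omega)
  rw [← e13, q0, F12 3 rfl, F12 8 rfl, F12 10 rfl, F12 16 rfl, F12 12 rfl, F12 13 rfl, F11 3 rfl,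
    F11 8 rfl, F11 12 rfl, F11 13 rfl, chi10, S10] at o2
  have F13 : ∀ a, matrix.wa a = false → σ13.mem a = σ12.mem a := fun a h => e13 ▸ den_mem h _
  have q13 : σ13.reg 0 = n := by rw [e13, den_reg rfl, q0]
  have emain : main.den σ0 = (setReg 0 (R 0 + 2)).den σ13 := by
    rw [e13, e12, e11, e10, e9, e8, e7, e6, e5, e4, e3, e2, e1]
    rfl
  -- `sz` is the size of the separator, and the hubs contain `cA` and `cB` vertices of `F`
  obtain ⟨sz, hsz⟩ : ∃ sz, sz = ((Finset.range n).filter fun v => σ8.mem 8 v ≠ 0).card := ⟨_, rfl⟩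
  obtain ⟨cA, hcA⟩ : ∃ c, c =
    ((Finset.range n).filter fun v => chi v ≠ 0 ∧ σ10.mem 12 v = 0).card := ⟨_, rfl⟩
  obtain ⟨cB, hcB⟩ : ∃ c, c =
    ((Finset.range n).filter fun v => chi v ≠ 0 ∧ σ10.mem 13 v = 0).card := ⟨_, rfl⟩
  have helF : ∀ e < m, chi (s e) ≠ 0 → chi (d e) ≠ 0 → el e = n + e + 1 := by
    intro e he h1 h2
    rw [hel', if_pos he, itemOf, if_pos h1, if_pos h2]
  have helH : ∀ e < m, ∀ u v, (s e = u ∧ d e = v ∨ s e = v ∧ d e = u) → chi u ≠ 0 → chi v = 0 →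
      σ8.mem 8 v = 0 → el e = σ8.mem 9 v + 1 := by
    rintro e he u v (⟨rfl, rfl⟩ | ⟨rfl, rfl⟩) h1 h2 h3
    · rw [hel', if_pos he, itemOf, if_pos h1, if_neg (by simpa using h2),
        if_neg (by simpa using h3)]
    · rw [hel', if_pos he, itemOf, if_neg (by simpa using h2), if_pos h1,
        if_neg (by simpa using h3)]
  obtain ⟨D, hD, hDw⟩ := exists_describes_of_colouring (G := G) (W := sz + 2 + max cA cB)
    (s := s) (d := d) (chi := chi) (own := loadOf m s d chi W) (S := σ8.mem 8) (par := σ8.mem 10)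
    (lab := σ8.mem 9) (w := σ8.mem 6) (col := σ10.mem 15) (wA := σ10.mem 12) (wB := σ10.mem 13)
    (kind := σ11.mem 16) (par' := σ11.mem 10) (al := σ8.mem 7) (P := 2 ^ L)
    (τ := main.den σ0) hsG hdG (hn ▸ hm ▸ hshape) (hn ▸ hlabel) hal (hn ▸ k1) (hn ▸ k2) hcol
    (by
      intro e he h1 h2
      rw [← hm] at he
      have h3 := helF e he h1 h2
      have h4 := hst.settled (n + e) (by omega) (s e) (by have := hsn e he; omega)
        ⟨e, by omega, h3, .inl rfl⟩
      have h5 := hst.settled (n + e) (by omega) (d e) (by have := hdn e he; omega)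
        ⟨e, by omega, h3, .inr rfl⟩
      by_cases h6 : σ10.mem 15 (n + e) = 0
      · exact .inl ⟨h4.1 h6, h5.1 h6⟩
      · exact .inr ⟨h4.2 h6, h5.2 h6⟩)
    (by
      intro e he u v huv h1 h2 h3
      rw [← hm] at he
      have h4 := helH e he u v huv h1 h2 h3
      have hvn : v < n := by
        rcases huv with ⟨-, rfl⟩ | ⟨rfl, -⟩
        exacts [hdn e he, hsn e he]
      have h5 := hlabel.lab_lt v hvn
      exact hst.settled (σ8.mem 9 v) (by omega) u (by have := hchi_lt u h1; omega)
        ⟨e, by omega, h4, by tauto⟩)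
    (by rw [← hn, ← hsz, ← hcA]; omega) (by rw [← hn, ← hsz, ← hcB]; omega)
    (by rw [emain, ← hn]; simp [den, q13])
    (by
      intro i hi
      rw [← hn] at hi ⊢
      rw [emain]
      have := o1 i hi
      rw [← F13 0 rfl, ← F13 1 rfl] at this
      exact this)
    (by
      rw [← hn, emain]
      exact o2)
  rw [e0] at hD
  refine ⟨D, hD, fun k hk hFk => ?_⟩
  have hdegF : G.degSum F = ∑ v ∈ Fs, degOf m s d v := by
    rw [EdgeListGraph.degSum, hFs, Finset.sum_map]
    refine Finset.sum_congr rfl fun v _ => ?_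
    rw [EdgeListGraph.degree, degOf, hm, ← Fin.sum_univ_eq_sum_range]
    refine Finset.sum_congr rfl fun e _ => ?_
    simp only [hsG, hdG, Fin.valEmbedding_apply, Fin.val_inj]
  have hE₀ : σ9.reg 7 = ∑ v ∈ Fs, W v := by
    rw [E9]
    symm
    refine Finset.sum_subset (fun v hv => ?_) fun v _ hv => ?_
    · have := hchi_lt v ((hFs_mem v).1 hv)
      exact Finset.mem_range.2 (by omega)
    · by_contra h1
      exact hv (hWFs v h1).1
  have hWF : ∀ v ∈ Fs, W v = if degOf m s d v ≤ L then 2 ^ (L - degOf m s d v) else 0 := by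
    intro v hv
    rw [hW]
    exact if_congr (and_iff_right ((hFs_mem v).1 hv)) rfl rfl
  have hszL : 2 ^ L * sz ≤ Fs.card * L := by
    have h1 := hlabel.total
    rw [← hsz] at h1
    have h2 := sum_loadOf_le (n := n) (chi := chi) Fs hWFs
    omega
  have hdisc := hst.disc
  have hsumsize := sum_size_le (N := N) Fs hWFs hel0 N
  have hdisc' : ((σ10.reg 8 : ℤ) - σ9.reg 7) ^ 2 + ((σ10.reg 9 : ℤ) - σ9.reg 7) ^ 2 ≤
      2 * (2 ^ L) ^ 2 * max (2 ^ L) 2 * (Fs.card * L : ℕ) := by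
    refine hdisc.trans ?_
    exact mul_le_mul_of_nonneg_left (by exact_mod_cast hsumsize) (by positivity)
  have hcount : ∀ w : ℕ → ℕ, (∀ v, w v ≠ 0 → W v ≠ 0) →
      ((Finset.range n).filter fun v => chi v ≠ 0 ∧ w v = 0).card +
        ((Finset.range N).filter fun v => w v ≠ 0).card ≤ Fs.card := by
    intro w hw
    rw [← Finset.card_union_of_disjoint]
    · refine Finset.card_le_card fun v hv => ?_
      rw [Finset.mem_union, Finset.mem_filter, Finset.mem_filter] at hv
      rcases hv with hv | hv
      · exact (hFs_mem v).2 hv.2.1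
      · exact (hWFs v (hw v hv.2)).1
    · refine Finset.disjoint_left.2 fun v hv hv' => ?_
      exact (Finset.mem_filter.1 hv').2 (Finset.mem_filter.1 hv).2.2
  have hA := hcount _ hst.suppA
  have hB := hcount _ hst.suppB
  rw [← hcA] at hA
  rw [← hcB] at hB
  have hFk' : Fs.card ≤ k := by omega
  have hseen' : ∀ v, W v ≠ 0 → Balance.seen (Involves N s d el) N v ≤ degOf m s d v :=
    fun v hv => hseen v hv N
  have wA := width_le hk hFk' hWF hE₀ hL hL' hszL (hst.sum_le_card hseen')
    (by nlinarith [sq_nonneg ((σ10.reg 9 : ℤ) - σ9.reg 7)])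
  have wB := width_le hk hFk' hWF hE₀ hL hL' hszL (hst.swap.sum_le_card hseen')
    (by nlinarith [sq_nonneg ((σ10.reg 8 : ℤ) - σ9.reg 7)])
  rw [← hdegF] at wA wB
  have hDw' : (D.width : ℝ) ≤ (sz : ℝ) + 2 + max (cA : ℝ) cB - 1 := by exact_mod_cast hDw
  have hA' : (cA : ℝ) + ((Finset.range N).filter fun v => σ10.mem 12 v ≠ 0).card ≤ Fs.card := by
    exact_mod_cast hA
  have hB' : (cB : ℝ) + ((Finset.range N).filter fun v => σ10.mem 13 v ≠ 0).card ≤ Fs.card := by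
    exact_mod_cast hB
  rcases max_cases (cA : ℝ) cB with h | h <;> rw [h.1] at hDw' <;> linarith

end TreewidthProgram

theorem mainTheorem4 :
    ∃ (alg : RandRAM.Program) (poly : Polynomial ℕ) (δ : ℕ → ℝ),
      Tendsto δ atTop (𝓝 0) ∧
      ∀ (G : EdgeListGraph) (F : Finset (Fin G.n)), G.IsFVS F →
        RandRAM.expectedTime alg (inputStore G F) ≤ ((poly.eval (G.n + G.m) : ℕ) : ℝ≥0∞) ∧
        ∀ τ : RandRAM.Store, RandRAM.IsOutcome alg (inputStore G F) τ →
          ∃ D : G.TreeDecomposition, Describes τ D ∧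
            ∀ k : ℕ, 0 < k → F.card ≤ k →
              (D.width : ℝ) ≤ (1 - (2 : ℝ) ^ (-((G.degSum F : ℝ) / (k : ℝ))) + δ k) * (k : ℝ) := by
  open TreewidthProgram RandRAM in
  refine ⟨program, 2 + main.cost.comp (2 * Polynomial.X + 3), _, tendsto_error,
    fun G F hF => ?_⟩
  obtain ⟨t, ht, et⟩ := main.exists_after main_wf
    ((inputStore G F).setReg 2 (G.n + G.n + G.m + 3)) []
  have hrun : after (1 + 1 + t) ⟨[program], inputStore G F⟩ = PMF.pure
      ⟨[], main.den ((inputStore G F).setReg 2 (G.n + G.n + G.m + 3))⟩ := by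
    refine after_trans (after_trans (after_one rfl) (after_one ?_)) et
    rfl
  refine ⟨(expectedTime_le hrun).trans ?_, fun τ hτ => ?_⟩
  · -- the loop bound is at most `2 * (n + m) + 3`
    have hmono : Monotone fun x : ℕ => main.cost.eval x := by
      intro x y hxy
      simp only [Polynomial.eval_eq_sum_range]
      exact Finset.sum_le_sum fun i _ => Nat.mul_le_mul_left _ (Nat.pow_le_pow_left hxy i)
    have h1 := hmono (show G.n + G.n + G.m + 3 ≤ 2 * (G.n + G.m) + 3 by omega)
    have h2 : ((inputStore G F).setReg 2 (G.n + G.n + G.m + 3)).reg 2 = G.n + G.n + G.m + 3 := by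
      simp
    rw [h2] at ht
    have h3 : (2 + main.cost.comp (2 * Polynomial.X + 3)).eval (G.n + G.m) =
        2 + main.cost.eval (2 * (G.n + G.m) + 3) := by
      simp [Polynomial.eval_comp]
    rw [h3]
    exact_mod_cast (show 1 + 1 + t ≤ 2 + main.cost.eval (2 * (G.n + G.m) + 3) by
      simp only at h1; omega)
  · obtain rfl := hτ.eq_of_after hrun
    exact main_spec G F hF
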